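/- Consider pairs $(\omega,v)$ of finitely supported measures on $\mathbb R$, $\omega=\sum_{i=1}^n\omega_i\delta_{x_i}$, $v=\sum_{i=1}^n v_i\delta_{x_i}$ with $x_1<\dots<x_n$, $\omega_i\in\mathbb R$, $v_i\ge 0$, $|\omega_i|+v_i>0$ ($n$ is not prescribed), and the spectral problem $$-f''+\tfrac14 f=z\,\omega f+z^2 v f\quad\text{on }\mathbb R$$ in the sense of distributions, i.e. $-f''+\frac14 f=0$ off $\{x_1,\dots,x_n\}$, $f$ is continuous, and $f'(x_i-)=f'(x_i+)+(z\omega_i+z^2v_i)f(x_i)$. The eigenvalues are the $z\in\mathbb C$ that admit a nontrivial bounded solution. Let $\phi_\pm(z,\cdot)$ be the solutions equal to $e^{\mp x/2}$ near $\pm\infty$. For an eigenvalue $\lambda$ put $\gamma_\lambda^2=\int\phi_+(\lambda,x)^2\,d\omega(x)+2\lambda\int\phi_+(\lambda,x)^2\,dv(x)$; the norming constant is $\lambda\gamma_\lambda^2$. If $\lambda_1<\dots<\lambda_N$ are all the eigenvalues (they are real), write $\gamma_i=\gamma_{\lambda_i}$ and $\varphi_i(x)=\phi_+(\lambda_i,x)/\sqrt{\lambda_i\gamma_i^2}$;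 the interior spectral data of $(\omega,v)$ at $a\in\mathbb R$ is $\{\lambda_i,\varphi_i(a)\}_{i=1}^N$. **Theorem.** Let $a\in\mathbb R$ and let $\{\lambda_i,\varphi_i(a)\}_{i=1}^N$ be the interior spectral data at $a$ of some $(\omega,v)$. Suppose that $$\alpha:=1-\sum_{i=1}^N|\varphi_i(a)|^2=0,\qquad \beta:=-\sum_{i=1}^N\lambda_i|\varphi_i(a)|^2=0,$$ and that exactly $k$ of the numbers $\varphi_i(a)$ are zero. Then: 1. If $k\ge1$, infinitely many pairs $(\omega,v)$ have the interior spectral data $\{\lambda_i,\varphi_i(a)\}_{i=1}^N$ at $a$. 2. Let $\mathcal F\subset\mathbb R^{2N}$ be the set of the spectral data $(\lambda_1,\dots,\lambda_N,\lambda_1\gamma_1^2,\dots,\lambda_N\gamma_N^2)$ of all pairs $(\omega,v)$ with this interior spectral data at $a$. Then $\mathcal F$ is a (nonempty) connected embedded smooth submanifold of $\mathbb R^{2N}$ of dimension $k$. 3. Let $G(z)=\sum_{i=1}^N\frac{\lambda_i^2|\varphi_i(a)|^2}{\lambda_i-z}$, and let $B$ (respectively $C$) be the set of the real numbers $\mu\ne0$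 with $G(\mu)=0$ that lie in an interval $(\lambda_i,\lambda_{i+1})$, $1\le i<N$, with $\varphi_i(a)\varphi_{i+1}(a)<0$ (respectively $>0$). These sets are finite. For every $(\omega,v)$ with the given interior spectral data, $B$ is the set of the real zeros of $\phi_+(\cdot,a)$ that are not zeros of $\phi_-(\cdot,a)$, and $C$ is the set of the real zeros of $\phi_-(\cdot,a)$ that are not zeros of $\phi_+(\cdot,a)$. Moreover, $\mathcal F$ is the set of all $(\lambda_1,\dots,\lambda_N,c_1,\dots,c_N)$ with the given $\lambda_j$ such that $c_j\in(0,\infty)$ is arbitrary if $\varphi_j(a)=0$, and $$c_j=e^{-a}\prod_{i\ne j}\Bigl(1-\frac{\lambda_j}{\lambda_i}\Bigr)\prod_{\mu\in B}\Bigl(1-\frac{\lambda_j}{\mu}\Bigr)\prod_{\nu\in C}\Bigl(1-\frac{\lambda_j}{\nu}\Bigr)^{-1}$$ if $\varphi_j(a)\ne0$. -/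

import Mathlib

open Filter Topology

namespace Multipeakon

/-! ### Discrete pairs of measures and the generalized spectral problem -/

/-- A pair `(ω, v)` of finitely supported measures on the line, `ω = ∑ ωᵢ δ_{xᵢ}` real and
`v = ∑ vᵢ δ_{xᵢ}` nonnegative.  The two measures are recorded by the masses `ω x`, `v x` of the
points; the points `x₁ < ⋯ < xₙ` are those where `ω` or `v` has nonzero mass, so that
`|ωᵢ| + vᵢ > 0` for each of them, and each pair of measures is recorded exactly once. -/
@[ext]
structure Pair where
  ω : ℝ →₀ ℝ
  v : ℝ →₀ ℝ
  v_nonneg : ∀ x, 0 ≤ v x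

/-- The set `{x₁, …, xₙ}` of atoms. -/
noncomputable def Pair.atoms (S : Pair) : Finset ℝ := S.ω.support ∪ S.v.support

/-- `f` solves `-f'' + f / 4 = ∑ₓ q x δₓ f` (sum over `x ∈ s`) in the sense of distributions:
`-f'' + f / 4 = 0` off `s`, and at every `x ∈ s`, `f` is continuous and
`f'(x-) = f'(x+) + q x f(x)`. -/
structure IsSolutionOf {𝕜 : Type*} [RCLike 𝕜] (s : Finset ℝ) (q : ℝ → 𝕜) (f : ℝ → 𝕜) :
    Prop where
  ode : ∀ x, x ∉ s → DifferentiableAt ℝ f x ∧ HasDerivAt (deriv f) (f x / 4) x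
  jump : ∀ x ∈ s, ContinuousAt f x ∧ ∃ l r : 𝕜,
    Tendsto (deriv f) (𝓝[<] x) (𝓝 l) ∧ Tendsto (deriv f) (𝓝[>] x) (𝓝 r) ∧ l = r + q x * f x

/-- The coefficient `z ω + z² v` of the spectral problem. -/
noncomputable def Pair.weight {𝕜 : Type*} [RCLike 𝕜] (S : Pair) (z : 𝕜) (x : ℝ) : 𝕜 :=
  z * (S.ω x : 𝕜) + z ^ 2 * (S.v x : 𝕜)

/-- `f` solves `-f'' + f / 4 = z ω f + z² v f`. -/
def Pair.IsSolution {𝕜 : Type*} [RCLike 𝕜] (S : Pair) (z : 𝕜) (f : ℝ → 𝕜) : Prop :=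
  IsSolutionOf S.atoms (S.weight z) f

/-- Eigenvalues: the complex `z` that admit a nontrivial bounded solution. -/
def Pair.IsEigenvalue (S : Pair) (z : ℂ) : Prop :=
  ∃ f : ℝ → ℂ, S.IsSolution z f ∧ f ≠ 0 ∧ ∃ C : ℝ, ∀ x, ‖f x‖ ≤ C

/-- The solution that equals `e^{-x/2}` near `+∞`. -/
def Pair.IsJostPlus {𝕜 : Type*} [RCLike 𝕜] (S : Pair) (z : 𝕜) (f : ℝ → 𝕜) : Prop :=
  S.IsSolution z f ∧ ∀ᶠ x in atTop, f x = ((Real.exp (-x / 2) : ℝ) : 𝕜)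

/-- The solution that equals `e^{x/2}` near `-∞`. -/
def Pair.IsJostMinus {𝕜 : Type*} [RCLike 𝕜] (S : Pair) (z : 𝕜) (f : ℝ → 𝕜) : Prop :=
  S.IsSolution z f ∧ ∀ᶠ x in atBot, f x = ((Real.exp (x / 2) : ℝ) : 𝕜)

/-- `φ₊(z, ·)`; existence and uniqueness are `Pair.isJostPlus_phiPlus` and
`Pair.IsJostPlus.eq_phiPlus`. -/
noncomputable def Pair.phiPlus {𝕜 : Type*} [RCLike 𝕜] (S : Pair) (z : 𝕜) : ℝ → 𝕜 :=
  Classical.epsilon (S.IsJostPlus z)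

/-- `φ₋(z, ·)`; existence and uniqueness are `Pair.isJostMinus_phiMinus` and
`Pair.IsJostMinus.eq_phiMinus`. -/
noncomputable def Pair.phiMinus {𝕜 : Type*} [RCLike 𝕜] (S : Pair) (z : 𝕜) : ℝ → 𝕜 :=
  Classical.epsilon (S.IsJostMinus z)

/-! ### The Jost solutions exist and are unique -/

section Jost

variable {𝕜 : Type*} [RCLike 𝕜]

theorem exists_solution_atTop (s : Finset ℝ) (q : ℝ → 𝕜) :
    ∃ f : ℝ → 𝕜, IsSolutionOf s q f ∧
      ∀ᶠ x in atTop, f x = ((Real.exp (-x / 2) : ℝ) : 𝕜) := by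
  classical
  induction s using Finset.induction_on_min with
  | empty =>
    have h1 : ∀ x : ℝ, HasDerivAt (fun x : ℝ => Real.exp (-x / 2) • (1 : 𝕜))
        ((-(1 / 2) * Real.exp (-x / 2)) • (1 : 𝕜)) x := by
      intro x
      have : HasDerivAt (fun x : ℝ => Real.exp (-x / 2)) (-(1 / 2) * Real.exp (-x / 2)) x := by
        have := (((hasDerivAt_id x).neg).div_const 2).exp
        exact this.congr_deriv (by simp only [Pi.neg_apply, id]; ring)
      exact this.smul_const _
    have h2 : deriv (fun x : ℝ => Real.exp (-x / 2) • (1 : 𝕜)) =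
        fun x => (-(1 / 2) * Real.exp (-x / 2)) • (1 : 𝕜) := funext fun x => (h1 x).deriv
    refine ⟨fun x => Real.exp (-x / 2) • (1 : 𝕜), ⟨fun x _ => ⟨(h1 x).differentiableAt, ?_⟩, ?_⟩,
      Eventually.of_forall fun x => ?_⟩
    · rw [h2]
      have h3 : (fun x : ℝ => (-(1 / 2) * Real.exp (-x / 2)) • (1 : 𝕜)) =
          fun x => (-(1 / 2) : ℝ) • Real.exp (-x / 2) • (1 : 𝕜) :=
        funext fun y => mul_smul _ _ _
      rw [h3]
      refine ((h1 x).const_smul (-(1 / 2) : ℝ)).congr_deriv ?_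
      simp only [RCLike.real_smul_eq_coe_mul]; push_cast; ring
    · simp
    · simp [RCLike.real_smul_eq_coe_mul]
  | insert y s hy ih =>
    obtain ⟨g, hg, hg'⟩ := ih
    have hys : y ∉ s := fun h => lt_irrefl _ (hy y h)
    set c : 𝕜 := q y * g y with hc
    set h : ℝ → 𝕜 := fun x => (2 * Real.sinh ((y - x) / 2)) • c with hh
    have h1 : ∀ x : ℝ, HasDerivAt h ((-Real.cosh ((y - x) / 2)) • c) x := by
      intro x
      have h0 : HasDerivAt (fun x : ℝ => (y - x) / 2) (-1 / 2) x :=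
        ((hasDerivAt_id x).const_sub y).div_const 2
      exact ((h0.sinh.const_mul 2).smul_const c).congr_deriv (by congr 1; ring)
    have h2 : deriv h = fun x => (-Real.cosh ((y - x) / 2)) • c := funext fun x => (h1 x).deriv
    have h3 : ∀ x : ℝ, HasDerivAt (deriv h) (h x / 4) x := by
      intro x
      have h0 : HasDerivAt (fun x : ℝ => (y - x) / 2) (-1 / 2) x :=
        ((hasDerivAt_id x).const_sub y).div_const 2
      have := (h0.cosh.neg).smul_const c
      rw [h2]
      refine this.congr_deriv ?_
      simp only [hh, RCLike.real_smul_eq_coe_mul]; push_cast; ring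
    have hR : ∀ x, y < x → (fun x => if x < y then g x - h x else g x) =ᶠ[𝓝 x] g := by
      intro x hx
      filter_upwards [lt_mem_nhds hx] with t ht
      rw [if_neg (not_lt.mpr (le_of_lt ht))]
    have hL : ∀ x, x < y → (fun x => if x < y then g x - h x else g x) =ᶠ[𝓝 x]
        fun x => g x - h x := by
      intro x hx
      filter_upwards [gt_mem_nhds hx] with t ht
      rw [if_pos ht]
    have hns : ∀ᶠ x in 𝓝 y, x ∉ s := s.finite_toSet.isClosed.isOpen_compl.mem_nhds hys
    have hyy : h y = 0 := by simp [hh]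
    refine ⟨fun x => if x < y then g x - h x else g x, ⟨?_, ?_⟩, ?_⟩
    · intro x hx
      rw [Finset.mem_insert, not_or] at hx
      obtain ⟨hd, hd'⟩ := hg.ode x hx.2
      rcases lt_or_gt_of_ne hx.1 with hxy | hxy
      · refine ⟨(hd.sub (h1 x).differentiableAt).congr_of_eventuallyEq (hL x hxy), ?_⟩
        have hev : deriv (fun x => g x - h x) =ᶠ[𝓝 x] fun t => deriv g t - deriv h t := by
          have : ∀ᶠ t in 𝓝 x, t ∉ s := s.finite_toSet.isClosed.isOpen_compl.mem_nhds hx.2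
          filter_upwards [this] with t ht
          exact deriv_fun_sub (hg.ode t ht).1 (h1 t).differentiableAt
        have := (hd'.sub (h3 x)).congr_of_eventuallyEq ((hL x hxy).deriv.trans hev)
        refine this.congr_deriv ?_
        simp only [if_pos hxy]; ring
      · refine ⟨hd.congr_of_eventuallyEq (hR x hxy), ?_⟩
        have := hd'.congr_of_eventuallyEq (hR x hxy).deriv
        refine this.congr_deriv ?_
        simp only [if_neg (not_lt.mpr hxy.le)]
    · intro x hx
      rcases Finset.mem_insert.mp hx with rfl | hxs
      · obtain ⟨hd, hd'⟩ := hg.ode x hys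
        refine ⟨?_, deriv g x + c, deriv g x, ?_, ?_, ?_⟩
        · have hcont : ContinuousAt (fun t => g t - h t) x :=
            hd.continuousAt.sub (h1 x).continuousAt
          rw [continuousAt_iff_continuous_left'_right']
          constructor
          · refine (hcont.continuousWithinAt).congr_of_eventuallyEq ?_ ?_
            · filter_upwards [self_mem_nhdsWithin] with t ht
              rw [if_pos (show t < x from ht)]
            · simp [hyy]
          · refine (hd.continuousAt.continuousWithinAt).congr_of_eventuallyEq ?_ ?_
            · filter_upwards [self_mem_nhdsWithin] with t ht
              rw [if_neg (not_lt.mpr (le_of_lt (show x < t from ht)))]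
            · simp
        · have hlim : Tendsto (fun t => deriv g t - deriv h t) (𝓝[<] x)
              (𝓝 (deriv g x - deriv h x)) :=
            (hd'.continuousAt.sub (h3 x).continuousAt).tendsto.mono_left nhdsWithin_le_nhds
          have hval : deriv g x - deriv h x = deriv g x + c := by
            rw [h2]; simp
          rw [hval] at hlim
          refine hlim.congr' ?_
          filter_upwards [self_mem_nhdsWithin, nhdsWithin_le_nhds hns] with t ht hts
          rw [(hL t ht).deriv_eq]
          exact (deriv_fun_sub (hg.ode t hts).1 (h1 t).differentiableAt).symm
        · refine (hd'.continuousAt.tendsto.mono_left nhdsWithin_le_nhds).congr' ?_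
          filter_upwards [self_mem_nhdsWithin] with t ht
          exact (hR t ht).deriv_eq.symm
        · simp [hc]
      · have hxy := hy x hxs
        obtain ⟨hc', l, r, hl, hr, hlr⟩ := hg.jump x hxs
        refine ⟨hc'.congr (hR x hxy).symm, l, r, ?_, ?_, ?_⟩
        · exact hl.congr' (nhdsWithin_le_nhds (hR x hxy).deriv.symm)
        · exact hr.congr' (nhdsWithin_le_nhds (hR x hxy).deriv.symm)
        · rw [if_neg (not_lt.mpr hxy.le)]; exact hlr
    · filter_upwards [hg', eventually_gt_atTop y] with x hx hxy
      rw [if_neg (not_lt.mpr hxy.le)]; exact hx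

theorem IsSolutionOf.comp_neg {s t : Finset ℝ} {q : ℝ → 𝕜} {f : ℝ → 𝕜}
    (hf : IsSolutionOf s q f) (hst : ∀ x, x ∈ t ↔ -x ∈ s) :
    IsSolutionOf t (fun x => q (-x)) (fun x => f (-x)) := by
  have hd : deriv (fun x => f (-x)) = fun x => -deriv f (-x) := funext fun x => deriv_comp_neg f x
  refine ⟨fun x hx => ?_, fun x hx => ?_⟩
  · obtain ⟨h1, h2⟩ := hf.ode (-x) (fun h => hx ((hst x).2 h))
    refine ⟨h1.comp x differentiable_neg.differentiableAt, ?_⟩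
    rw [hd]
    have := (HasDerivAt.scomp x h2 (hasDerivAt_neg x)).neg
    refine this.congr_deriv ?_
    simp
  · obtain ⟨h1, l, r, hl, hr, hlr⟩ := hf.jump (-x) ((hst x).1 hx)
    refine ⟨ContinuousAt.comp (f := fun x : ℝ => -x) h1 continuous_neg.continuousAt,
      -r, -l, ?_, ?_, ?_⟩
    · rw [hd]; exact (hr.comp tendsto_neg_nhdsLT).neg
    · rw [hd]; exact (hl.comp tendsto_neg_nhdsGT).neg
    · rw [hlr]; ring

theorem IsSolutionOf.sub {s : Finset ℝ} {q : ℝ → 𝕜} {f g : ℝ → 𝕜}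
    (hf : IsSolutionOf s q f) (hg : IsSolutionOf s q g) :
    IsSolutionOf s q (fun x => f x - g x) := by
  have hd : ∀ x, x ∉ s → deriv (fun x => f x - g x) x = deriv f x - deriv g x :=
    fun x hx => deriv_fun_sub (hf.ode x hx).1 (hg.ode x hx).1
  refine ⟨fun x hx => ⟨(hf.ode x hx).1.sub (hg.ode x hx).1, ?_⟩, fun x hx => ?_⟩
  · have hns : ∀ᶠ t in 𝓝 x, t ∉ s := s.finite_toSet.isClosed.isOpen_compl.mem_nhds hx
    have := ((hf.ode x hx).2.sub (hg.ode x hx).2).congr_of_eventuallyEq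
      (show deriv (fun x => f x - g x) =ᶠ[𝓝 x] _ from hns.mono hd)
    refine this.congr_deriv ?_
    ring
  · obtain ⟨h1, l, r, hl, hr, hlr⟩ := hf.jump x hx
    obtain ⟨k1, l', r', hl', hr', hlr'⟩ := hg.jump x hx
    have hns : ∀ᶠ t in 𝓝[≠] x, t ∉ s := by
      have : ∀ᶠ t in 𝓝 x, t ∉ s.erase x :=
        (s.erase x).finite_toSet.isClosed.isOpen_compl.mem_nhds (by simp)
      filter_upwards [nhdsWithin_le_nhds this, self_mem_nhdsWithin] with t ht htx hts
      exact ht (Finset.mem_erase.2 ⟨htx, hts⟩)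
    refine ⟨h1.sub k1, l - l', r - r', ?_, ?_, ?_⟩
    · refine (hl.sub hl').congr' ?_
      filter_upwards [nhdsWithin_mono x (fun t ht => ne_of_lt ht) hns] with t ht
      exact (hd t ht).symm
    · refine (hr.sub hr').congr' ?_
      filter_upwards [nhdsWithin_mono x (fun t ht => ne_of_gt ht) hns] with t ht
      exact (hd t ht).symm
    · rw [hlr, hlr']; ring

/-- Along a solution, `e^{εx/2} (f' - ε f / 2)` (`ε = ±1`) is constant between the atoms. -/
theorem IsSolutionOf.eqOn_of_tendsto_zero {s : Finset ℝ} {q : ℝ → 𝕜} {f : ℝ → 𝕜}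
    (hf : IsSolutionOf s q f) {b c : ℝ} (hbc : b < c) (hs : ∀ x ∈ Set.Ioo b c, x ∉ s)
    (h0 : Tendsto f (𝓝[<] c) (𝓝 0)) (h1 : Tendsto (deriv f) (𝓝[<] c) (𝓝 0))
    (e : ℝ) (he : e ^ 2 = 1) :
    ∀ x ∈ Set.Ioo b c, deriv f x = (e / 2) • f x := by
  set u : ℝ → 𝕜 := fun x => Real.exp (e * x / 2) • (deriv f x - (e / 2) • f x) with hu
  have hud : ∀ x ∈ Set.Ioo b c, HasDerivAt u 0 x := by
    intro x hx
    obtain ⟨hd, hd'⟩ := hf.ode x (hs x hx)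
    have h2 : HasDerivAt (fun x : ℝ => Real.exp (e * x / 2)) (Real.exp (e * x / 2) * (e / 2)) x := by
      have := ((hasDerivAt_id x).const_mul (e / 2)).exp
      have hfun : (fun x : ℝ => Real.exp (e * x / 2)) = fun x => Real.exp (e / 2 * id x) :=
        funext fun y => by simp only [id]; ring_nf
      rw [hfun]
      exact this.congr_deriv (by simp only [id]; ring_nf)
    have h3 := h2.smul (hd'.sub (hd.hasDerivAt.const_smul (e / 2)))
    refine h3.congr_deriv ?_
    have he' : (e : 𝕜) ^ 2 = 1 := by exact_mod_cast he
    simp only [RCLike.real_smul_eq_coe_mul]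
    simp only [Pi.sub_apply, Pi.smul_apply, RCLike.real_smul_eq_coe_mul]
    push_cast
    linear_combination (-(Real.exp (e * x / 2) : 𝕜) * f x / 4) * he'
  have hlim : Tendsto u (𝓝[<] c) (𝓝 0) := by
    have h2 : Tendsto (fun x : ℝ => Real.exp (e * x / 2)) (𝓝[<] c) (𝓝 (Real.exp (e * c / 2))) :=
      (Continuous.tendsto (by fun_prop) c).mono_left nhdsWithin_le_nhds
    have := h2.smul (h1.sub (h0.const_smul (e / 2)))
    simpa [hu] using this
  intro x hx
  have hconst : ∀ t ∈ Set.Ioo b c, u t = u x := fun t ht =>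
    isOpen_Ioo.is_const_of_deriv_eq_zero isPreconnected_Ioo
      (fun t ht => (hud t ht).differentiableAt.differentiableWithinAt)
      (fun t ht => (hud t ht).deriv) ht hx
  have hux : u x = 0 := by
    refine tendsto_nhds_unique (tendsto_const_nhds.congr' ?_) hlim
    filter_upwards [Ioo_mem_nhdsLT hbc] with t ht
    exact (hconst t ht).symm
  have := (smul_eq_zero.1 hux).resolve_left (Real.exp_ne_zero _)
  exact sub_eq_zero.1 this

theorem IsSolutionOf.eq_of_atTop {s : Finset ℝ} {q : ℝ → 𝕜} {f g : ℝ → 𝕜}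
    (hf : IsSolutionOf s q f) (hg : IsSolutionOf s q g) (h : f =ᶠ[atTop] g) : f = g := by
  by_contra hne
  obtain ⟨x0, hx0⟩ := Function.ne_iff.1 hne
  have hh := hf.sub hg
  set d : ℝ → 𝕜 := fun x => f x - g x with hd
  have hdx0 : d x0 ≠ 0 := sub_ne_zero.2 hx0
  set T : Set ℝ := {x | ∀ y, x < y → d y = 0} with hT
  have hTne : T.Nonempty := by
    obtain ⟨b, hb⟩ := eventually_atTop.1 h
    exact ⟨b, fun y hy => sub_eq_zero.2 (hb y hy.le)⟩
  have hTb : BddBelow T := ⟨x0, fun t ht => not_lt.1 fun hlt => hdx0 (ht x0 hlt)⟩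
  set c := sInf T with hc
  have hpos : ∀ y, c < y → d y = 0 := by
    intro y hy
    obtain ⟨t, ht, hty⟩ := exists_lt_of_csInf_lt hTne hy
    exact ht y hty
  have hcont : ContinuousAt d c := by
    by_cases hcs : c ∈ s
    · exact (hh.jump c hcs).1
    · exact (hh.ode c hcs).1.continuousAt
  have hdc : d c = 0 := by
    refine tendsto_nhds_unique (hcont.tendsto.mono_left (nhdsWithin_le_nhds (s := Set.Ioi c))) ?_
    refine tendsto_const_nhds.congr' ?_
    filter_upwards [self_mem_nhdsWithin] with t ht
    exact (hpos t ht).symm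
  have hright : Tendsto (deriv d) (𝓝[>] c) (𝓝 0) := by
    refine tendsto_const_nhds.congr' ?_
    filter_upwards [self_mem_nhdsWithin] with t ht
    have : d =ᶠ[𝓝 t] fun _ => 0 := by
      filter_upwards [lt_mem_nhds (show c < t from ht)] with y hy
      exact hpos y hy
    rw [this.deriv_eq]; simp
  have hleft : Tendsto (deriv d) (𝓝[<] c) (𝓝 0) := by
    by_cases hcs : c ∈ s
    · obtain ⟨-, l, r, hl, hr, hlr⟩ := hh.jump c hcs
      have hr0 := tendsto_nhds_unique hr hright
      rw [hr0, hdc] at hlr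
      simpa [hlr] using hl
    · have hc' := (hh.ode c hcs).2.continuousAt.tendsto
      have := tendsto_nhds_unique (hc'.mono_left nhdsWithin_le_nhds) hright
      rw [this] at hc'
      exact hc'.mono_left nhdsWithin_le_nhds
  have hd0 : Tendsto d (𝓝[<] c) (𝓝 0) := by
    have := hcont.tendsto
    rw [hdc] at this
    exact this.mono_left nhdsWithin_le_nhds
  obtain ⟨b, hbc, hb⟩ : ∃ b < c, ∀ x ∈ Set.Ioo b c, x ∉ s := by
    have : ∀ᶠ t in 𝓝 c, t ∉ s.erase c :=
      (s.erase c).finite_toSet.isClosed.isOpen_compl.mem_nhds (by simp)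
    obtain ⟨b, hbc, hb⟩ := exists_Ioc_subset_of_mem_nhds this (exists_lt c)
    exact ⟨b, hbc, fun x hx hxs => hb ⟨hx.1, hx.2.le⟩ (Finset.mem_erase.2 ⟨hx.2.ne, hxs⟩)⟩
  have hz : ∀ x ∈ Set.Ioo b c, d x = 0 := by
    intro x hx
    have e1 := hh.eqOn_of_tendsto_zero hbc hb hd0 hleft 1 (by norm_num) x hx
    have e2 := hh.eqOn_of_tendsto_zero hbc hb hd0 hleft (-1) (by norm_num) x hx
    rw [e1] at e2
    have : ((1 : ℝ) / 2 - -1 / 2) • d x = 0 := by rw [sub_smul, e2, sub_self]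
    norm_num at this
    exact this
  have hbT : b ∈ T := by
    intro y hy
    rcases lt_trichotomy y c with hyc | rfl | hyc
    · exact hz y ⟨hy, hyc⟩
    · exact hdc
    · exact hpos y hyc
  exact absurd (csInf_le hTb hbT) (not_le.2 hbc)

theorem Pair.isJostPlus_phiPlus (S : Pair) (z : 𝕜) : S.IsJostPlus z (S.phiPlus z) :=
  Classical.epsilon_spec (p := S.IsJostPlus z) (exists_solution_atTop S.atoms (S.weight z))

theorem Pair.IsJostPlus.eq_phiPlus {S : Pair} {z : 𝕜} {f : ℝ → 𝕜} (hf : S.IsJostPlus z f) :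
    f = S.phiPlus z :=
  have h := S.isJostPlus_phiPlus z
  hf.1.eq_of_atTop h.1 (by filter_upwards [hf.2, h.2] with x h1 h2; rw [h1, h2])

theorem Pair.isJostMinus_phiMinus (S : Pair) (z : 𝕜) : S.IsJostMinus z (S.phiMinus z) := by
  refine Classical.epsilon_spec (p := S.IsJostMinus z) ?_
  obtain ⟨f, hf, hf'⟩ :=
    exists_solution_atTop (S.atoms.image (fun x => -x)) (fun x => S.weight z (-x))
  refine ⟨fun x => f (-x), ?_, ?_⟩
  · have := hf.comp_neg (t := S.atoms) (by simp)
    simpa [Pair.IsSolution] using this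
  · filter_upwards [tendsto_neg_atBot_atTop.eventually hf'] with x hx
    simpa using hx

theorem Pair.IsJostMinus.eq_phiMinus {S : Pair} {z : 𝕜} {f : ℝ → 𝕜} (hf : S.IsJostMinus z f) :
    f = S.phiMinus z := by
  have h := S.isJostMinus_phiMinus z
  have hneg : ∀ x, x ∈ S.atoms.image (fun x => -x) ↔ -x ∈ S.atoms := by
    intro x; simp [neg_eq_iff_eq_neg]
  have := (hf.1.comp_neg hneg).eq_of_atTop (h.1.comp_neg hneg) (by
    filter_upwards [tendsto_neg_atTop_atBot.eventually hf.2,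
      tendsto_neg_atTop_atBot.eventually h.2] with x h1 h2
    rw [h1, h2])
  funext x
  simpa using congrFun this (-x)

end Jost

/-! ### Spectral data and interior spectral data -/

/-- `γ_λ² = ∫ φ₊(λ, x)² dω(x) + 2 λ ∫ φ₊(λ, x)² dv(x)`. -/
noncomputable def Pair.gammaSq (S : Pair) (l : ℝ) : ℝ :=
  (S.ω.sum fun x m => m * |S.phiPlus l x| ^ 2) +
    2 * l * (S.v.sum fun x m => m * |S.phiPlus l x| ^ 2)

/-- The (modified) norming constant `λ γ_λ²`. -/
noncomputable def Pair.norming (S : Pair) (l : ℝ) : ℝ := l * S.gammaSq l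

/-- `(λ_i, φ_i(a))_{i < N}` is the interior spectral data of `S` at `a`: the `λ_i` enumerate
the spectrum increasingly, and `φ_i(a)` is the value at `a` of the normalized eigenfunction
`φ₊(λ_i, ·) / √(λ_i γ_i²)`. -/
def Pair.IsInteriorData (S : Pair) (a : ℝ) {N : ℕ} (lam phi : Fin N → ℝ) : Prop :=
  StrictMono lam ∧ (∀ z : ℂ, S.IsEigenvalue z ↔ ∃ i, z = (lam i : ℂ)) ∧
    ∀ i, phi i = S.phiPlus (lam i) a / √(S.norming (lam i))

/-- `α = 1 - ∑ |φ_i(a)|²`. -/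
noncomputable def alphaCoeff {N : ℕ} (phi : Fin N → ℝ) : ℝ := 1 - ∑ i, |phi i| ^ 2

/-- `β = -∑ λ_i |φ_i(a)|²`. -/
noncomputable def betaCoeff {N : ℕ} (lam phi : Fin N → ℝ) : ℝ := -∑ i, lam i * |phi i| ^ 2

/-- The rational function `G(z, a) = ∑ λ_i² |φ_i(a)|² / (λ_i - z)` at a real point. -/
noncomputable def greenSum {N : ℕ} (lam phi : Fin N → ℝ) (z : ℝ) : ℝ :=
  ∑ i, lam i ^ 2 * |phi i| ^ 2 / (lam i - z)

/-- The family `ℱ ⊆ ℝᴺ × ℝᴺ` of the spectral data `(λ_j, λ_j γ_j²)_j` of all `(ω, v)` that have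
the interior spectral data `(lam, phi)` at `a`. -/
def spectralFamily (a : ℝ) {N : ℕ} (lam phi : Fin N → ℝ) :
    Set ((Fin N → ℝ) × (Fin N → ℝ)) :=
  {p | ∃ S : Pair, S.IsInteriorData a lam phi ∧ p.1 = lam ∧ ∀ j, p.2 j = S.norming (lam j)}

open scoped ContDiff in
/-- `M` is an embedded smooth submanifold of dimension `k` of the finite-dimensional space `E`:
around each of its points a smooth chart of `E` turns `M` into a linear subspace of
dimension `k`. -/
def IsSubmanifold {E : Type*} [NormedAddCommGroup E] [NormedSpace ℝ E] [FiniteDimensional ℝ E]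
    (k : ℕ) (M : Set E) : Prop :=
  ∀ p ∈ M, ∃ (e : OpenPartialHomeomorph E E) (V : Submodule ℝ E),
    p ∈ e.source ∧ ContDiffOn ℝ ∞ e e.source ∧ ContDiffOn ℝ ∞ e.symm e.target ∧
      Module.finrank ℝ V = k ∧ ∀ x ∈ e.source, x ∈ M ↔ e x ∈ V

end Multipeakon

/-! In the variable `ξ = e^x` the function `e^{x/2} φ₊(z, x)` is continuous and piecewise affine in
`ξ` and polynomial in `z`. This polynomial is `Pair.jost ξ`, and its right derivative in `ξ` is `X *
Pair.slope ξ`; reflecting the line treats `φ₋` in the same way. Moving left through an atom and then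
a gap is one step of a continued fraction. It preserves the property that `slope / jost` is a finite
sum `∑ r / (x - z)` with positive masses (`IsStieltjesPair.extend`, `Pair.isStieltjesPair`).
Conversely, every such quotient whose denominator is `1` at `0` comes from measures on a half-line
(`Pair.exists_jost_eq`). The Wronskian `W` of the two Jost solutions is `jost 0`, so the eigenvalues
are its zeros. They are real and simple, and they determine `W` because `W(0) = 1`.

At the point `a`, the function `z φ₊ φ₋ / W` grows at most linearly, and its residues are given by
the interior data. It equals `α z + β + G(z)`, so for `α = β = 0` the data determine the product `φ₊
φ₋` (`X_mul_jost_mul_reflect`). A common zero of the two factors is a zero of `W`, hence an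
eigenvalue with `φ_j(a) = 0`. Every other zero of the product is a zero of `G` between consecutive
eigenvalues. As `G` increases there, each such interval contains at most one, and a sign change of
`φ₊(·, a)` from `λ_i` to `λ_{i+1}` tells which factor vanishes (`zeros_of_greenSum`,
`exists_consecutive_of_zero`). Hence `φ₊(·, a)` and `φ₋(·, a)` are known. At an eigenvalue `φ₊ = κ
φ₋`, and the norming constant is `-λ W'(λ) κ`. If `φ_j(a) ≠ 0`, then `κ` is a quotient of two known
values, which gives the product formula (`norming_eq_prod`).

If `φ_j(a) = 0`, then `λ_j` is a common pole of the Weyl functions of both half-lines at `a`, and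
the norming constant is proportional to the ratio of the two masses. The Wronskian contains only a
weighted sum of these masses. Mass can therefore be moved from one side to the other while both stay
positive, and the ratio takes every positive value. Solving the inverse problem on each half-line
and gluing the results around the old atom at `a` realizes this choice without changing `W` or the
values at `a` (`exists_slope_eq`, `exists_norming_eq`). So the family is a point times `(0, ∞)^k`.
-/

namespace Multipeakon

open Polynomial ComplexConjugate

/-! ### Pairs of polynomials whose quotient is a Herglotz--Nevanlinna function -/

/-- `Q / P` is a Stieltjes transform `∑ r_ζ / (ζ - z)` with positive masses `r_ζ`: the
denominator has only simple real zeros, and `Q / P` vanishes at infinity. -/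
structure IsStieltjesPair (P Q : ℝ[X]) : Prop where
  degree_lt : Q.degree < P.degree
  splits : P.Splits
  sign : ∀ x, P.eval x = 0 → Q.eval x * P.derivative.eval x < 0

/-- `Q / P` is a nonconstant Herglotz--Nevanlinna function and `P`, `Q` have no common zero. -/
structure IsNevanlinnaPair (P Q : ℝ[X]) : Prop where
  im_pos : ∀ z : ℂ, 0 < z.im → 0 < (aeval z Q * conj (aeval z P)).im
  wronskian_pos : ∀ x : ℝ,
    0 < Q.derivative.eval x * P.eval x - Q.eval x * P.derivative.eval x

namespace IsNevanlinnaPair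

variable {P Q : ℝ[X]}

/-- For `m = Q / P` this is the passage to `-1 / m`, which maps the upper half-plane to itself. -/
theorem rotate (h : IsNevanlinnaPair P Q) : IsNevanlinnaPair Q (-P) := by
  refine ⟨fun z hz => ?_, fun x => ?_⟩
  · have := h.im_pos z hz
    simp only [map_neg, Complex.mul_im, Complex.neg_re, Complex.neg_im, Complex.conj_re,
      Complex.conj_im] at this ⊢
    linarith
  · have := h.wronskian_pos x
    simp only [derivative_neg, eval_neg]
    linarith

theorem neg (h : IsNevanlinnaPair P Q) : IsNevanlinnaPair (-P) (-Q) :=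
  h.rotate.rotate

theorem add_C_mul (h : IsNevanlinnaPair P Q) (b : ℝ) : IsNevanlinnaPair P (Q + C b * P) := by
  refine ⟨fun z hz => ?_, fun x => ?_⟩
  · have := h.im_pos z hz
    simp only [map_add, map_mul, aeval_C, Complex.coe_algebraMap, Complex.mul_im, Complex.add_re,
      Complex.add_im, Complex.mul_re, Complex.ofReal_re, Complex.ofReal_im, Complex.conj_re,
      Complex.conj_im] at this ⊢
    linarith
  · have := h.wronskian_pos x
    simp only [derivative_add, derivative_C_mul, eval_add, eval_mul, eval_C]
    linarith

theorem aeval_ne_zero (h : IsNevanlinnaPair P Q) {z : ℂ} (hz : z.im ≠ 0) : aeval z P ≠ 0 := by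
  intro h0
  rcases lt_or_gt_of_ne hz with hz | hz
  · have := h.im_pos (conj z) (by simpa using hz)
    rw [Polynomial.aeval_conj P, h0] at this
    simp at this
  · have := h.im_pos z hz
    rw [h0] at this
    simp at this

theorem ne_zero (h : IsNevanlinnaPair P Q) : P ≠ 0 := by
  rintro rfl
  exact h.aeval_ne_zero (z := Complex.I) (by simp) (by simp)

/-- The strict inequality in the upper half-plane, together with conjugation, excludes nonreal
zeros, so all complex roots are real. -/
theorem splits (h : IsNevanlinnaPair P Q) : P.Splits := by
  refine Splits.of_splits_map (algebraMap ℝ ℂ) (IsAlgClosed.splits _) fun z hz => ?_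
  have hz0 : aeval z P = 0 := by
    have := (mem_roots'.1 hz).2
    rwa [IsRoot, eval_map_algebraMap] at this
  have him : z.im = 0 := by
    by_contra hne
    exact h.aeval_ne_zero hne hz0
  exact ⟨z.re, by apply Complex.ext <;> simp [him]⟩

theorem sign (h : IsNevanlinnaPair P Q) (x : ℝ) (hx : P.eval x = 0) :
    Q.eval x * P.derivative.eval x < 0 := by
  have := h.wronskian_pos x
  rw [hx] at this
  linarith

theorem isStieltjesPair (h : IsNevanlinnaPair P Q) (hd : Q.degree < P.degree) :
    IsStieltjesPair P Q :=
  ⟨hd, h.splits, h.sign⟩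

end IsNevanlinnaPair

/-! ### Partial fractions of Stieltjes pairs -/

theorem eval_divByMonic_of_root {P : ℝ[X]} {x : ℝ} (hx : P.eval x = 0) :
    (P /ₘ (X - C x)).eval x = P.derivative.eval x := by
  have h := mul_divByMonic_eq_iff_isRoot.2 hx
  have := congrArg (fun p => (derivative p).eval x) h
  simpa using this

theorem eval_divByMonic_of_ne {P : ℝ[X]} {x y : ℝ} (hx : P.eval x = 0) (hy : P.eval y = 0)
    (hne : y ≠ x) : (P /ₘ (X - C x)).eval y = 0 := by
  have h := mul_divByMonic_eq_iff_isRoot.2 hx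
  have := congrArg (eval y) h
  rw [eval_mul, hy] at this
  refine (mul_eq_zero.1 this).resolve_left ?_
  simpa [sub_eq_zero] using hne

namespace IsStieltjesPair

variable {P Q : ℝ[X]}

theorem ne_zero (h : IsStieltjesPair P Q) : P ≠ 0 := by
  rintro rfl
  simpa using h.degree_lt

theorem derivative_ne_zero (h : IsStieltjesPair P Q) {x : ℝ} (hx : P.eval x = 0) :
    P.derivative.eval x ≠ 0 := by
  intro h0
  have := h.sign x hx
  rw [h0] at this
  simp at this

theorem nodup_roots (h : IsStieltjesPair P Q) : P.roots.Nodup := by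
  rw [Multiset.nodup_iff_count_le_one]
  intro x
  by_contra hlt
  rw [count_roots, not_le, one_lt_rootMultiplicity_iff_isRoot h.ne_zero] at hlt
  exact h.derivative_ne_zero hlt.1 hlt.2

theorem mem_roots_toFinset (h : IsStieltjesPair P Q) {x : ℝ} :
    x ∈ P.roots.toFinset ↔ P.eval x = 0 := by
  simp [h.ne_zero]

theorem card_roots_toFinset (h : IsStieltjesPair P Q) : P.roots.toFinset.card = P.natDegree := by
  rw [Multiset.toFinset_card_of_nodup h.nodup_roots, h.splits.natDegree_eq_card_roots]

theorem roots_nonempty (h : IsStieltjesPair P Q) (hd : P.natDegree ≠ 0) :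
    P.roots.toFinset.Nonempty := by
  rw [← Finset.card_pos, h.card_roots_toFinset]; omega

/-- In the convention `r / (x - z)` the mass is minus the residue of `Q / P` at `x`, and the residue
is `Q(x) / P'(x)` because the zero is simple. -/
theorem mass_pos (h : IsStieltjesPair P Q) {x : ℝ} (hx : P.eval x = 0) :
    0 < -(Q.eval x / P.derivative.eval x) := by
  have h1 := h.sign x hx
  have h2 := h.derivative_ne_zero hx
  have : Q.eval x / P.derivative.eval x =
      Q.eval x * P.derivative.eval x / (P.derivative.eval x) ^ 2 := by
    field_simp
  rw [this, neg_pos]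
  exact div_neg_of_neg_of_pos h1 (by positivity)

/-- The partial fraction decomposition. -/
theorem eq_sum (h : IsStieltjesPair P Q) :
    Q = ∑ x ∈ P.roots.toFinset, C (Q.eval x / P.derivative.eval x) * (P /ₘ (X - C x)) := by
  have hPd : P.degree = P.roots.toFinset.card := by
    rw [h.card_roots_toFinset, degree_eq_natDegree h.ne_zero]
  refine eq_of_degrees_lt_of_eval_finset_eq P.roots.toFinset (hPd ▸ h.degree_lt) ?_ ?_
  · refine (degree_sum_le _ _).trans_lt ?_
    rw [← hPd, Finset.sup_lt_iff (bot_lt_iff_ne_bot.2 (by simpa using h.ne_zero))]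
    intro x hx
    have hx' := h.mem_roots_toFinset.1 hx
    rw [C_mul']
    exact (degree_smul_le _ _).trans_lt (degree_divByMonic_lt _ _ h.ne_zero (by simp))
  · intro y hy
    have hy' := h.mem_roots_toFinset.1 hy
    rw [eval_finsetSum, Finset.sum_eq_single y]
    · rw [eval_mul, eval_C, eval_divByMonic_of_root hy',
        div_mul_cancel₀ _ (h.derivative_ne_zero hy')]
    · intro x hx hxy
      rw [eval_mul, eval_divByMonic_of_ne (h.mem_roots_toFinset.1 hx) hy' hxy.symm, mul_zero]
    · exact fun hn => absurd hy hn

theorem aeval_ne_zero (h : IsStieltjesPair P Q) {z : ℂ} (hz : z.im ≠ 0) : aeval z P ≠ 0 := by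
  intro h0
  have hr := h.splits.mem_range_of_isRoot (i := algebraMap ℝ ℂ) h.ne_zero (x := z) (by
    rwa [IsRoot, eval_map_algebraMap])
  obtain ⟨x, rfl⟩ := hr
  simp at hz

/-- The left side is `|P|² Im (Q / P)`. The term of the pole `x` is its mass times `|P / (z - x)|²
Im z`, so positivity is visible term by term; the Wronskian on the real line is handled likewise
below. -/
theorem im_eq_sum (h : IsStieltjesPair P Q) (z : ℂ) :
    (aeval z Q * conj (aeval z P)).im = ∑ x ∈ P.roots.toFinset,
      -(Q.eval x / P.derivative.eval x) * Complex.normSq (aeval z (P /ₘ (X - C x))) * z.im := by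
  conv_lhs => rw [h.eq_sum]
  rw [map_sum, Finset.sum_mul, Complex.im_sum]
  refine Finset.sum_congr rfl fun x hx => ?_
  have h1 : aeval z P = (z - x) * aeval z (P /ₘ (X - C x)) := by
    conv_lhs => rw [← mul_divByMonic_eq_iff_isRoot.2 (h.mem_roots_toFinset.1 hx)]
    simp
  rw [h1]
  simp only [map_mul, aeval_C, Complex.coe_algebraMap, Complex.normSq_apply, Complex.mul_im,
    Complex.mul_re, Complex.ofReal_re, Complex.ofReal_im, Complex.conj_re, Complex.conj_im,
    Complex.sub_re, Complex.sub_im]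
  ring

theorem wronskian_eq_sum (h : IsStieltjesPair P Q) (t : ℝ) :
    Q.derivative.eval t * P.eval t - Q.eval t * P.derivative.eval t =
      ∑ x ∈ P.roots.toFinset,
        -(Q.eval x / P.derivative.eval x) * (P /ₘ (X - C x)).eval t ^ 2 := by
  conv_lhs => rw [h.eq_sum]
  rw [derivative_sum, eval_finsetSum, eval_finsetSum, Finset.sum_mul, Finset.sum_mul,
    ← Finset.sum_sub_distrib]
  refine Finset.sum_congr rfl fun x hx => ?_
  have h0 := mul_divByMonic_eq_iff_isRoot.2 (h.mem_roots_toFinset.1 hx)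
  set R := P /ₘ (X - C x) with hR
  have h1 : P.eval t = (t - x) * R.eval t := by
    rw [← h0]; simp
  have h2 : P.derivative.eval t = R.eval t + (t - x) * R.derivative.eval t := by
    rw [← h0]; simp
  simp only [derivative_C_mul, eval_mul, eval_C]
  rw [h1]
  generalize Q.eval x / P.derivative.eval x = r
  rw [h2]
  ring

theorem im_nonneg (h : IsStieltjesPair P Q) {z : ℂ} (hz : 0 < z.im) :
    0 ≤ (aeval z Q * conj (aeval z P)).im := by
  rw [h.im_eq_sum]
  exact Finset.sum_nonneg fun x hx => mul_nonneg (mul_nonneg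
    (h.mass_pos (h.mem_roots_toFinset.1 hx)).le (Complex.normSq_nonneg _)) hz.le

theorem wronskian_nonneg (h : IsStieltjesPair P Q) (t : ℝ) :
    0 ≤ Q.derivative.eval t * P.eval t - Q.eval t * P.derivative.eval t := by
  rw [h.wronskian_eq_sum]
  exact Finset.sum_nonneg fun x hx => mul_nonneg
    (h.mass_pos (h.mem_roots_toFinset.1 hx)).le (sq_nonneg _)

/-- A pole must exist for strict inequalities, which is why constant `P` (where `Q = 0`) is
excluded. At a real zero of `P` only the term of that zero survives in the Wronskian; elsewhere
every term is positive. -/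
theorem isNevanlinnaPair (h : IsStieltjesPair P Q) (hd : P.natDegree ≠ 0) :
    IsNevanlinnaPair P Q := by
  refine ⟨fun z hz => ?_, fun t => ?_⟩
  · rw [h.im_eq_sum]
    refine Finset.sum_pos (fun x hx => ?_) (h.roots_nonempty hd)
    refine mul_pos (mul_pos (h.mass_pos (h.mem_roots_toFinset.1 hx)) (Complex.normSq_pos.2 ?_)) hz
    intro h0
    refine h.aeval_ne_zero hz.ne' ?_
    rw [← mul_divByMonic_eq_iff_isRoot.2 (h.mem_roots_toFinset.1 hx), map_mul, h0, mul_zero]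
  · rw [h.wronskian_eq_sum]
    have hpos : ∀ x ∈ P.roots.toFinset, (P /ₘ (X - C x)).eval t ≠ 0 →
        0 < -(Q.eval x / P.derivative.eval x) * (P /ₘ (X - C x)).eval t ^ 2 := fun x hx h0 =>
      mul_pos (h.mass_pos (h.mem_roots_toFinset.1 hx)) (by positivity)
    refine Finset.sum_pos' (fun x hx => mul_nonneg
      (h.mass_pos (h.mem_roots_toFinset.1 hx)).le (sq_nonneg _)) ?_
    by_cases ht : P.eval t = 0
    · refine ⟨t, h.mem_roots_toFinset.2 ht, hpos t (h.mem_roots_toFinset.2 ht) ?_⟩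
      rw [eval_divByMonic_of_root ht]
      exact h.derivative_ne_zero ht
    · obtain ⟨x, hx⟩ := h.roots_nonempty hd
      refine ⟨x, hx, hpos x hx fun h0 => ht ?_⟩
      rw [← mul_divByMonic_eq_iff_isRoot.2 (h.mem_roots_toFinset.1 hx), eval_mul, h0, mul_zero]

/-- The leading behaviour of `z Q / P` at infinity. -/
theorem exists_coeff_eq (h : IsStieltjesPair P Q) :
    ∃ σ : ℝ, 0 ≤ σ ∧ (P.natDegree ≠ 0 → 0 < σ) ∧
      (X * Q).coeff P.natDegree = -σ * P.leadingCoeff := by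
  refine ⟨∑ x ∈ P.roots.toFinset, -(Q.eval x / P.derivative.eval x),
    Finset.sum_nonneg fun x hx => (h.mass_pos (h.mem_roots_toFinset.1 hx)).le,
    fun hd => Finset.sum_pos (fun x hx => h.mass_pos (h.mem_roots_toFinset.1 hx))
      (h.roots_nonempty hd), ?_⟩
  rcases Nat.eq_zero_or_pos P.natDegree with hd | hd
  · have : P.roots.toFinset = ∅ := by
      rw [← Finset.card_eq_zero, h.card_roots_toFinset, hd]
    simp [this, hd]
  · obtain ⟨n, hn⟩ : ∃ n, P.natDegree = n + 1 := ⟨P.natDegree - 1, by omega⟩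
    rw [hn, coeff_X_mul]
    conv_lhs => rw [h.eq_sum]
    rw [finsetSum_coeff, Finset.sum_neg_distrib, neg_neg, Finset.sum_mul]
    refine Finset.sum_congr rfl fun x hx => ?_
    rw [coeff_C_mul]
    congr 1
    have h0 := mul_divByMonic_eq_iff_isRoot.2 (h.mem_roots_toFinset.1 hx)
    have h1 : (P /ₘ (X - C x)).natDegree = n := by
      rw [natDegree_divByMonic _ (monic_X_sub_C x), natDegree_X_sub_C, hn]; rfl
    rw [← h1, coeff_natDegree]
    conv_rhs => rw [← h0]
    rw [leadingCoeff_mul, leadingCoeff_X_sub_C, one_mul]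

theorem natDegree_X_mul_le (h : IsStieltjesPair P Q) : (X * Q).natDegree ≤ P.natDegree := by
  rcases eq_or_ne Q 0 with rfl | hQ
  · simp
  · rw [natDegree_X_mul hQ]
    exact natDegree_lt_natDegree hQ h.degree_lt

theorem natDegree_X_mul (h : IsStieltjesPair P Q) (hd : P.natDegree ≠ 0) :
    (X * Q).natDegree = P.natDegree := by
  refine le_antisymm h.natDegree_X_mul_le (le_natDegree_of_ne_zero ?_)
  obtain ⟨σ, -, hσ, h2⟩ := h.exists_coeff_eq
  rw [h2]
  exact mul_ne_zero (neg_ne_zero.2 (hσ hd).ne') (by simpa using h.ne_zero)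

theorem neg (h : IsStieltjesPair P Q) : IsStieltjesPair (-P) (-Q) := by
  refine ⟨by simpa using h.degree_lt, by simpa using h.splits, fun x hx => ?_⟩
  simpa using h.sign x (by simpa using hx)

/-! ### The continued fraction of a Stieltjes pair -/

/-- One step of the division algorithm. -/
theorem exists_division (h : IsStieltjesPair P Q) (hd : P.natDegree ≠ 0) :
    ∃ (l b : ℝ) (R : ℝ[X]), 0 < l ∧ P = -((C l * X + C b) * Q + R) ∧ IsStieltjesPair Q R := by
  have hN := h.isNevanlinnaPair hd
  obtain ⟨σ, -, hσ, hcoef⟩ := h.exists_coeff_eq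
  have hσ := hσ hd
  have hQ : Q ≠ 0 := hN.rotate.ne_zero
  have hdeg := h.natDegree_X_mul hd
  rw [Polynomial.natDegree_X_mul hQ] at hdeg
  have hdX : (X * Q).degree = P.degree := by
    rw [degree_eq_natDegree (mul_ne_zero X_ne_zero hQ), degree_eq_natDegree h.ne_zero,
      h.natDegree_X_mul hd]
  have hlc : Q.leadingCoeff = -σ * P.leadingCoeff := by
    rw [← hcoef, ← hdeg, coeff_X_mul, coeff_natDegree]
  -- `X * Q` has leading coefficient `-σ` times that of `P`, so the quotient has linear coefficient
  -- `1 / σ`, positive because `σ` is the total mass.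
  have hT : (P + C (1 / σ) * (X * Q)).degree < P.degree := by
    have h1 : (P - C (-(1 / σ)) * (X * Q)).degree < P.degree := by
      refine degree_sub_lt_left ?_ h.ne_zero ?_
      · rw [degree_C_mul (by simpa using hσ.ne'), hdX]
      · rw [leadingCoeff_mul, leadingCoeff_C, leadingCoeff_mul, leadingCoeff_X, hlc]
        field_simp
    simpa using h1
  set T := P + C (1 / σ) * (X * Q) with hTdef
  have hTQ : T.degree ≤ Q.degree := by
    rw [degree_eq_natDegree h.ne_zero, ← hdeg] at hT
    rw [degree_eq_natDegree hQ]
    rw [degree_lt_iff_coeff_zero] at hT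
    rw [degree_le_iff_coeff_zero]
    exact fun m hm => hT m (Nat.succ_le_of_lt (by exact_mod_cast hm))
  -- The constant term of the quotient, chosen to remove the coefficient of `T` in the degree of
  -- `Q`. It may be zero.
  set b := -(T.coeff Q.natDegree / Q.leadingCoeff) with hb
  have hlQ : Q.leadingCoeff ≠ 0 := by simpa using hQ
  have hR : (T + C b * Q).degree < Q.degree := by
    rw [degree_eq_natDegree hQ, degree_lt_iff_coeff_zero]
    intro m hm
    rw [coeff_add, coeff_C_mul]
    rcases hm.eq_or_lt with rfl | hm
    · rw [coeff_natDegree, hb]; field_simp; ring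
    · rw [coeff_eq_zero_of_degree_lt (hTQ.trans_lt ?_), coeff_eq_zero_of_natDegree_lt hm]
      · simp
      · rw [degree_eq_natDegree hQ]; exact_mod_cast hm
  -- At a zero of `Q` the remainder equals `-P`, so its sign condition is that of the rotated pair
  -- `(Q, -P)`.
  refine ⟨1 / σ, b, -(T + C b * Q), by positivity, ?_, ?_, hN.rotate.splits, fun x hx => ?_⟩
  · rw [hTdef]; ring
  · rwa [degree_neg]
  · have := hN.rotate.sign x hx
    simpa [hTdef, hx] using this

/-- One step of the continued fraction expansion: `Q / P` is obtained from `Q₁ / P₁` by adding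
the dipole `w + v z` and then a gap of length `l`. -/
theorem exists_reduction (h : IsStieltjesPair P Q) (hd : P.natDegree ≠ 0) (h0 : P.eval 0 ≠ 0) :
    ∃ (l w v : ℝ) (P₁ Q₁ : ℝ[X]), 0 < l ∧ 0 ≤ v ∧ (w ≠ 0 ∨ v ≠ 0) ∧ IsStieltjesPair P₁ Q₁ ∧
      P₁.natDegree < P.natDegree ∧ Q = Q₁ + (C w + C v * X) * P₁ ∧ P = P₁ - C l * (X * Q) := by
  obtain ⟨l, b, R, hl, hP, hR⟩ := h.exists_division hd
  have hQP : Q.natDegree < P.natDegree := natDegree_lt_natDegree hR.ne_zero h.degree_lt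
  -- If `b = 0`, then `P₁ = -R` and a second division reads off the atom, with `v > 0`; a constant
  -- `Q` is impossible here because `P` would then be a multiple of `X`. If `b ≠ 0`, one division
  -- suffices: `P₁ = -(b Q + R)` has the degree of `Q`, and the atom has `w = -1 / b`, `v = 0`.
  rcases eq_or_ne b 0 with rfl | hb
  · have hdQ : Q.natDegree ≠ 0 := by
      intro hdQ
      have : R = 0 := by
        have := hR.degree_lt
        rw [degree_eq_natDegree hR.ne_zero, hdQ] at this
        exact degree_eq_bot.1 (Nat.WithBot.lt_zero_iff.1 (by simpa using this))
      rw [hP, this] at h0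
      simp at h0
    obtain ⟨l', b', R', hl', hQ, hR'⟩ := hR.exists_division hdQ
    refine ⟨l, b', l', -R, -R', hl, hl'.le, Or.inr hl'.ne', hR'.neg, ?_, ?_, ?_⟩
    · rw [natDegree_neg]
      exact (natDegree_lt_natDegree hR'.ne_zero hR.degree_lt).trans hQP
    · rw [hQ]; ring
    · rw [hP, C_0]; ring
  · have hdeg : (-(C b * Q + R)).degree = Q.degree := by
      rw [degree_neg, degree_add_eq_left_of_degree_lt, degree_C_mul hb]
      rw [degree_C_mul hb]; exact hR.degree_lt
    have hc : C b * C b⁻¹ = (1 : ℝ[X]) := by rw [← C_mul, mul_inv_cancel₀ hb, C_1]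
    have hQ : Q + C b⁻¹ * -(C b * Q + R) = -(C b⁻¹ * R) := by
      linear_combination (-Q) * hc
    refine ⟨l, -b⁻¹, 0, -(C b * Q + R), -(C b⁻¹ * R), hl, le_rfl, Or.inl (by simpa using hb), ?_,
      ?_, ?_, ?_⟩
    · have hd' : (-(C b⁻¹ * R)).degree < (-(C b * Q + R)).degree := by
        rw [hdeg, degree_neg, degree_C_mul (inv_ne_zero hb)]
        exact hR.degree_lt
      rcases eq_or_ne Q.natDegree 0 with hdQ | hdQ
      · have h1 : (-(C b * Q + R)).natDegree = 0 := by
          rw [natDegree_eq_of_degree_eq hdeg, hdQ]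
        refine ⟨hd', Splits.of_natDegree_eq_zero h1, fun x hx => ?_⟩
        rw [eq_C_of_natDegree_eq_zero h1, eval_C] at hx
        have h2 := eq_C_of_natDegree_eq_zero h1
        rw [hx, C_0] at h2
        rw [h2, degree_zero] at hdeg
        exact absurd (degree_eq_bot.1 hdeg.symm) hR.ne_zero
      -- The new quotient is `1 / b - 1 / (R / Q + b)`, obtained from `R / Q` by real translations
      -- and a rotation.
      · have hN := ((hR.isNevanlinnaPair hdQ).add_C_mul b)
        have hN' : IsNevanlinnaPair (-(C b * Q + R)) Q := by
          simpa [add_comm] using hN.rotate.neg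
        have := hN'.add_C_mul b⁻¹
        rw [hQ] at this
        exact this.isStieltjesPair hd'
    · rwa [natDegree_eq_of_degree_eq hdeg]
    · rw [C_neg, C_0]
      linear_combination hQ
    · linear_combination hP

theorem const {P : ℝ[X]} (hP : P.natDegree = 0) (h0 : P ≠ 0) : IsStieltjesPair P 0 := by
  refine ⟨by simpa [bot_lt_iff_ne_bot] using h0, Splits.of_natDegree_eq_zero hP, fun x hx => ?_⟩
  have h2 := eq_C_of_natDegree_eq_zero hP
  rw [h2, eval_C] at hx
  rw [hx, C_0] at h2
  exact absurd h2 h0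

theorem right_eq_zero (h : IsStieltjesPair P Q) (hd : P.natDegree = 0) : Q = 0 := by
  have := h.degree_lt
  rw [degree_eq_natDegree h.ne_zero, hd] at this
  exact degree_eq_bot.1 (Nat.WithBot.lt_zero_iff.1 (by simpa using this))

/-- Adding a dipole and a gap to a Stieltjes pair. -/
theorem extend (h : IsStieltjesPair P Q) {l w v : ℝ} (hl : 0 < l) (hv : 0 ≤ v)
    (hwv : w ≠ 0 ∨ v ≠ 0) :
    IsStieltjesPair (P - C l * (X * (Q + (C w + C v * X) * P))) (Q + (C w + C v * X) * P) := by
  set Q₁ := Q + (C w + C v * X) * P with hQ₁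
  have hne : (C w + C v * X : ℝ[X]) ≠ 0 := by
    intro h0
    rcases hwv with hw | hw
    · exact hw (by simpa using congrArg (fun p => coeff p 0) h0)
    · exact hw (by simpa using congrArg (fun p => coeff p 1) h0)
  have hd1 : P.degree ≤ ((C w + C v * X) * P).degree := by
    rw [degree_mul]
    exact le_add_of_nonneg_left (zero_le_degree_iff.2 hne)
  have hd2 : Q₁.degree = ((C w + C v * X) * P).degree :=
    degree_add_eq_right_of_degree_lt (h.degree_lt.trans_le hd1)
  have hQ₁0 : Q₁ ≠ 0 := by
    intro h0
    rw [h0, degree_zero] at hd2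
    exact mul_ne_zero hne h.ne_zero (degree_eq_bot.1 hd2.symm)
  have hX : Q₁.degree < (C l * (X * Q₁)).degree := by
    rw [degree_C_mul hl.ne', degree_eq_natDegree hQ₁0,
      degree_eq_natDegree (mul_ne_zero X_ne_zero hQ₁0), Polynomial.natDegree_X_mul hQ₁0]
    exact_mod_cast Nat.lt_succ_self _
  have hdeg : Q₁.degree < (P - C l * (X * Q₁)).degree := by
    rwa [degree_sub_eq_right_of_degree_lt ((hd1.trans hd2.ge).trans_lt hX)]
  refine IsNevanlinnaPair.isStieltjesPair ⟨fun z hz => ?_, fun x => ?_⟩ hdeg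
  -- Three nonnegative contributions: the old pair, the mass `v` and the gap `l`. If the gap term
  -- vanishes, the old pair contributes strictly unless `P` is constant; in that case `Q₁ = (w + v
  -- z) P` has no nonreal zero. On the real line, the term of `v` takes over when `P` is constant.
  · have e1 : (aeval z Q₁ * conj (aeval z (P - C l * (X * Q₁)))).im =
        ((aeval z Q * conj (aeval z P)).im + v * Complex.normSq (aeval z P) * z.im) +
          l * Complex.normSq (aeval z Q₁) * z.im := by
      simp only [hQ₁, map_add, map_sub, map_mul, aeval_C, aeval_X, Complex.coe_algebraMap,
        Complex.normSq_apply, Complex.mul_im, Complex.mul_re, Complex.add_re, Complex.add_im,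
        Complex.sub_re, Complex.sub_im, Complex.ofReal_re, Complex.ofReal_im, Complex.conj_re,
        Complex.conj_im]
      ring
    have e2 := h.im_nonneg hz
    have e3 : 0 ≤ v * Complex.normSq (aeval z P) * z.im :=
      mul_nonneg (mul_nonneg hv (Complex.normSq_nonneg _)) hz.le
    have e4 : 0 ≤ l * Complex.normSq (aeval z Q₁) * z.im :=
      mul_nonneg (mul_nonneg hl.le (Complex.normSq_nonneg _)) hz.le
    rcases eq_or_ne (aeval z Q₁) 0 with h0 | h0
    · rcases eq_or_ne P.natDegree 0 with hd | hd
      · rw [hQ₁, h.right_eq_zero hd, zero_add, map_mul] at h0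
        have h5 := (mul_eq_zero.1 h0).resolve_right (h.aeval_ne_zero hz.ne')
        have h6 := congrArg Complex.im h5
        have h7 := congrArg Complex.re h5
        simp at h6 h7
        rcases h6 with h6 | h6
        · rw [h6] at h7; simp at h7; tauto
        · exact absurd h6 hz.ne'
      · have := (h.isNevanlinnaPair hd).im_pos z hz
        rw [e1]; linarith
    · have : 0 < l * Complex.normSq (aeval z Q₁) * z.im :=
        mul_pos (mul_pos hl (Complex.normSq_pos.2 h0)) hz
      rw [e1]; linarith
  · have e1 : Q₁.derivative.eval x * (P - C l * (X * Q₁)).eval x -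
        Q₁.eval x * (P - C l * (X * Q₁)).derivative.eval x =
        (Q.derivative.eval x * P.eval x - Q.eval x * P.derivative.eval x) +
          v * P.eval x ^ 2 + l * Q₁.eval x ^ 2 := by
      simp only [hQ₁, derivative_add, derivative_sub, derivative_mul, derivative_C, derivative_X,
        eval_add, eval_sub, eval_mul, eval_C, eval_X, eval_zero, eval_one]
      ring
    have e2 := h.wronskian_nonneg x
    have e3 : 0 ≤ v * P.eval x ^ 2 := mul_nonneg hv (sq_nonneg _)
    have e4 : 0 ≤ l * Q₁.eval x ^ 2 := mul_nonneg hl.le (sq_nonneg _)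
    rcases eq_or_ne (Q₁.eval x) 0 with h0 | h0
    · rcases eq_or_ne P.natDegree 0 with hd | hd
      · have hPx : P.eval x ≠ 0 := by
          intro hx
          have := h.sign x hx
          rw [h.right_eq_zero hd] at this
          simp at this
        rw [hQ₁, h.right_eq_zero hd, zero_add, eval_mul] at h0
        have h5 := (mul_eq_zero.1 h0).resolve_right hPx
        simp at h5
        have hv0 : v ≠ 0 := by
          rintro rfl
          simp at h5
          tauto
        have : 0 < v * P.eval x ^ 2 := by positivity
        rw [e1]; linarith
      · have := (h.isNevanlinnaPair hd).wronskian_pos x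
        rw [e1]; linarith
    · have : 0 < l * Q₁.eval x ^ 2 := by positivity
      rw [e1]; linarith

end IsStieltjesPair

/-! ### The polynomial solutions of the string -/

/-- The coefficient `z ω + z² v` at `y`, divided by `z`. -/
noncomputable def Pair.dipole (S : Pair) (y : ℝ) : ℝ[X] := C (S.ω y) + C (S.v y) * X

theorem Pair.dipole_eq_zero {S : Pair} {y : ℝ} (hy : y ∉ S.atoms) : S.dipole y = 0 := by
  simp only [Pair.atoms, Finset.mem_union, Finsupp.mem_support_iff, not_or, not_not] at hy
  simp [Pair.dipole, hy.1, hy.2]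

theorem Pair.mem_atoms {S : Pair} {y : ℝ} : y ∈ S.atoms ↔ S.ω y ≠ 0 ∨ S.v y ≠ 0 := by
  simp [Pair.atoms]

/-- The equation at `ξ` involves only values at atoms with `e^y > ξ`, so the system is triangular.
Adding a new smallest atom changes the solution only to the left of it, and hence at none of the
atoms. -/
theorem exists_volterra (s : Finset ℝ) (c : ℝ → ℝ[X]) :
    ∃ f : ℝ → ℝ[X], ∀ ξ, f ξ = 1 - X * ∑ y ∈ s with ξ < Real.exp y,
      C (1 - ξ * Real.exp (-y)) * (c y * f (Real.exp y)) := by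
  classical
  induction s using Finset.induction_on_min with
  | empty => exact ⟨fun _ => 1, fun ξ => by simp⟩
  | insert y s hy ih =>
    obtain ⟨g, hg⟩ := ih
    have hys : y ∉ s := fun h => lt_irrefl _ (hy y h)
    set f : ℝ → ℝ[X] := fun ξ => if ξ < Real.exp y then
      g ξ - X * (C (1 - ξ * Real.exp (-y)) * (c y * g (Real.exp y))) else g ξ with hf
    have hfg : ∀ t ∈ insert y s, f (Real.exp t) = g (Real.exp t) := by
      intro t ht
      refine if_neg (not_lt.2 (Real.exp_le_exp.2 ?_))
      rcases Finset.mem_insert.1 ht with rfl | ht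
      · exact le_rfl
      · exact (hy t ht).le
    refine ⟨f, fun ξ => ?_⟩
    have h1 : ∑ t ∈ insert y s with ξ < Real.exp t,
        C (1 - ξ * Real.exp (-t)) * (c t * f (Real.exp t)) =
        ∑ t ∈ insert y s with ξ < Real.exp t,
          C (1 - ξ * Real.exp (-t)) * (c t * g (Real.exp t)) :=
      Finset.sum_congr rfl fun t ht => by rw [hfg t (Finset.mem_filter.1 ht).1]
    rw [h1, Finset.sum_filter, Finset.sum_insert hys, ← Finset.sum_filter]
    by_cases hξ : ξ < Real.exp y
    · rw [hf]
      simp only [if_pos hξ]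
      rw [hg ξ]
      ring
    · rw [hf]
      simp only [if_neg hξ]
      rw [hg ξ]
      ring

/-- `S.jost (e^x)` is the polynomial `z ↦ e^{x/2} φ₊(z, x)`; the variable is `ξ = e^x ≥ 0`. -/
noncomputable def Pair.jost (S : Pair) : ℝ → ℝ[X] :=
  Classical.choose (exists_volterra S.atoms S.dipole)

theorem Pair.jost_eq (S : Pair) (ξ : ℝ) :
    S.jost ξ = 1 - X * ∑ y ∈ S.atoms with ξ < Real.exp y,
      C (1 - ξ * Real.exp (-y)) * (S.dipole y * S.jost (Real.exp y)) :=
  Classical.choose_spec (exists_volterra S.atoms S.dipole) ξ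

/-- The right derivative of `S.jost` with respect to `ξ`, divided by `z`. -/
noncomputable def Pair.slope (S : Pair) (ξ : ℝ) : ℝ[X] :=
  ∑ y ∈ S.atoms with ξ < Real.exp y, C (Real.exp (-y)) * (S.dipole y * S.jost (Real.exp y))

namespace Pair

variable {S : Pair}

/-- `y` need not be an atom, since the dipole vanishes otherwise; gaps may thus be cut at any point.
-/
theorem slope_of_gap {ξ y : ℝ} (hy : ξ < Real.exp y)
    (hgap : ∀ t ∈ S.atoms, ξ < Real.exp t → y ≤ t) :
    S.slope ξ = S.slope (Real.exp y) + C (Real.exp (-y)) * (S.dipole y * S.jost (Real.exp y)) := by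
  have h1 : C (Real.exp (-y)) * (S.dipole y * S.jost (Real.exp y)) = ∑ t ∈ S.atoms,
      if t = y then C (Real.exp (-t)) * (S.dipole t * S.jost (Real.exp t)) else 0 := by
    rw [Finset.sum_ite_eq']
    split_ifs with h
    · rfl
    · rw [dipole_eq_zero h]; simp
  rw [h1, slope, slope, Finset.sum_filter, Finset.sum_filter, ← Finset.sum_add_distrib]
  refine Finset.sum_congr rfl fun t ht => ?_
  rcases lt_trichotomy t y with h | rfl | h
  · have h2 : ¬ ξ < Real.exp t := fun h3 => absurd (hgap t ht h3) (not_le.2 h)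
    rw [if_neg h2, if_neg (not_lt.2 (Real.exp_le_exp.2 h.le)), if_neg h.ne]; simp
  · simp [hy]
  · rw [if_pos (hy.trans (Real.exp_lt_exp.2 h)), if_pos (Real.exp_lt_exp.2 h), if_neg h.ne']; simp

theorem jost_of_le {ξ η : ℝ} (h : ξ ≤ η) (hgap : ∀ t ∈ S.atoms, ξ < Real.exp t → η ≤ Real.exp t) :
    S.jost ξ = S.jost η - C (η - ξ) * (X * S.slope ξ) := by
  rw [S.jost_eq ξ, S.jost_eq η, slope, Finset.sum_filter, Finset.sum_filter, Finset.sum_filter]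
  have : ∑ t ∈ S.atoms, (if ξ < Real.exp t then
        C (1 - ξ * Real.exp (-t)) * (S.dipole t * S.jost (Real.exp t)) else 0) =
      (∑ t ∈ S.atoms, if η < Real.exp t then
        C (1 - η * Real.exp (-t)) * (S.dipole t * S.jost (Real.exp t)) else 0) +
      C (η - ξ) * ∑ t ∈ S.atoms, if ξ < Real.exp t then
        C (Real.exp (-t)) * (S.dipole t * S.jost (Real.exp t)) else 0 := by
    rw [Finset.mul_sum, ← Finset.sum_add_distrib]
    refine Finset.sum_congr rfl fun t ht => ?_
    by_cases h1 : ξ < Real.exp t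
    · rcases (hgap t ht h1).eq_or_lt with h2 | h2
      · subst h2
        have h3 : C (Real.exp t) * C (Real.exp (-t)) = (1 : ℝ[X]) := by
          rw [← C_mul, ← Real.exp_add]; simp
        simp only [h1, if_true, lt_irrefl, if_false, C_sub, C_mul, C_1]
        linear_combination (-(S.dipole t * S.jost (Real.exp t))) * h3
      · simp only [h1, h2, if_true, C_sub, C_mul, C_1]
        ring
    · have h2 : ¬ η < Real.exp t := fun h3 => h1 (h.trans_lt h3)
      simp [h1, h2]
  rw [this]
  ring

theorem jost_of_gap {ξ y : ℝ} (hy : ξ < Real.exp y)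
    (hgap : ∀ t ∈ S.atoms, ξ < Real.exp t → y ≤ t) :
    S.jost ξ = S.jost (Real.exp y) - C (Real.exp y - ξ) * (X * S.slope ξ) :=
  jost_of_le hy.le fun t ht h => Real.exp_le_exp.2 (hgap t ht h)

theorem slope_of_le {ξ η : ℝ} (h : ξ ≤ η) (hgap : ∀ t ∈ S.atoms, ξ < Real.exp t → η < Real.exp t) :
    S.slope ξ = S.slope η := by
  rw [slope, slope]
  congr 1
  ext t
  simp only [Finset.mem_filter, and_congr_right_iff]
  exact fun ht => ⟨hgap t ht, fun h1 => h.trans_lt h1⟩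

theorem slope_of_forall_le {ξ : ℝ} (h : ∀ y ∈ S.atoms, Real.exp y ≤ ξ) : S.slope ξ = 0 := by
  rw [slope, Finset.filter_false_of_mem fun y hy => not_lt.2 (h y hy), Finset.sum_empty]

theorem jost_of_forall_le {ξ : ℝ} (h : ∀ y ∈ S.atoms, Real.exp y ≤ ξ) : S.jost ξ = 1 := by
  rw [jost_eq, Finset.filter_false_of_mem fun y hy => not_lt.2 (h y hy), Finset.sum_empty]
  simp

theorem jost_eval_zero (ξ : ℝ) : (S.jost ξ).eval 0 = 1 := by
  rw [jost_eq]; simp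

end Pair

/-- Induction over the gaps of a finite set, from `+∞` downwards. -/
theorem gap_induction {p : ℝ → Prop} (s : Finset ℝ)
    (top : ∀ ξ, (∀ y ∈ s, Real.exp y ≤ ξ) → p ξ)
    (step : ∀ ξ, ∀ y ∈ s, ξ < Real.exp y → (∀ t ∈ s, ξ < Real.exp t → y ≤ t) →
      p (Real.exp y) → p ξ) (ξ : ℝ) : p ξ := by
  suffices ∀ n, ∀ ξ, (s.filter fun y => ξ < Real.exp y).card = n → p ξ from this _ ξ rfl
  intro n
  induction n using Nat.strong_induction_on with
  | _ n ih =>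
    intro ξ hξ
    rcases (s.filter fun y => ξ < Real.exp y).eq_empty_or_nonempty with h | h
    · refine top ξ fun y hy => not_lt.1 fun hlt => ?_
      exact Finset.notMem_empty y (h ▸ Finset.mem_filter.2 ⟨hy, hlt⟩)
    · obtain ⟨y, hy, hmin⟩ := Finset.exists_min_image _ id h
      obtain ⟨hys, hyξ⟩ := Finset.mem_filter.1 hy
      refine step ξ y hys hyξ (fun t ht h1 => hmin t (Finset.mem_filter.2 ⟨ht, h1⟩)) ?_
      refine ih _ ?_ _ rfl
      rw [← hξ]
      refine Finset.card_lt_card ⟨fun t ht => ?_, fun hsub => ?_⟩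
      · obtain ⟨h1, h2⟩ := Finset.mem_filter.1 ht
        exact Finset.mem_filter.2 ⟨h1, hyξ.trans h2⟩
      · exact absurd (Finset.mem_filter.1 (hsub hy)).2 (lt_irrefl _)

namespace Pair

/-- Right of all atoms the pair is `(1, 0)`, and every atom followed by a gap is an application of
`extend` with masses scaled by `e^{-y}`. This is where `v ≥ 0` enters. -/
theorem isStieltjesPair (S : Pair) (ξ : ℝ) : IsStieltjesPair (S.jost ξ) (S.slope ξ) := by
  refine gap_induction (p := fun ξ => IsStieltjesPair (S.jost ξ) (S.slope ξ)) S.atoms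
    (fun ξ h => ?_) (fun ξ y hy hlt hgap ih => ?_) ξ
  · rw [jost_of_forall_le h, slope_of_forall_le h]
    exact .const (by simp) one_ne_zero
  · have he := Real.exp_pos (-y)
    have := ih.extend (l := Real.exp y - ξ) (w := Real.exp (-y) * S.ω y)
      (v := Real.exp (-y) * S.v y) (sub_pos.2 hlt) (mul_nonneg he.le (S.v_nonneg y))
      (by simpa [he.ne'] using mem_atoms.1 hy)
    have hs : S.slope ξ = S.slope (Real.exp y) +
        (C (Real.exp (-y) * S.ω y) + C (Real.exp (-y) * S.v y) * X) * S.jost (Real.exp y) := by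
      rw [slope_of_gap hlt hgap, dipole, C_mul, C_mul]; ring
    rw [← hs, ← jost_of_gap hlt hgap] at this
    exact this

/-- Only atoms strictly to the right of a point are seen from it. This is what allows solutions of
two half-line problems to be glued. -/
theorem jost_slope_congr {S T : Pair} {ξ₀ : ℝ}
    (h : ∀ y, ξ₀ < Real.exp y → S.ω y = T.ω y ∧ S.v y = T.v y) {ξ : ℝ} (hξ : ξ₀ ≤ ξ) :
    S.jost ξ = T.jost ξ ∧ S.slope ξ = T.slope ξ := by
  have hatom : ∀ y, ξ₀ < Real.exp y → (y ∈ S.atoms ↔ y ∈ T.atoms) := fun y hy => by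
    rw [mem_atoms, mem_atoms, (h y hy).1, (h y hy).2]
  refine gap_induction (p := fun ξ => ξ₀ ≤ ξ → S.jost ξ = T.jost ξ ∧ S.slope ξ = T.slope ξ) S.atoms
    (fun ξ h1 hξ => ?_) (fun ξ y hy hlt hgap ih hξ => ?_) ξ hξ
  · have h2 : ∀ y ∈ T.atoms, Real.exp y ≤ ξ := fun y hy => by
      by_contra hlt
      exact hlt (h1 y ((hatom y (hξ.trans_lt (not_le.1 hlt))).2 hy))
    rw [jost_of_forall_le h1, slope_of_forall_le h1, jost_of_forall_le h2, slope_of_forall_le h2]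
    exact ⟨rfl, rfl⟩
  · obtain ⟨h1, h2⟩ := ih (hξ.trans hlt.le)
    have hgap' : ∀ t ∈ T.atoms, ξ < Real.exp t → y ≤ t := fun t ht hlt' =>
      hgap t ((hatom t (hξ.trans_lt hlt')).2 ht) hlt'
    have hd : S.dipole y = T.dipole y := by
      have := h y (hξ.trans_lt hlt)
      rw [dipole, dipole, this.1, this.2]
    have h3 : S.slope ξ = T.slope ξ := by
      rw [slope_of_gap hlt hgap, slope_of_gap hlt hgap', h1, h2, hd]
    refine ⟨?_, h3⟩
    rw [jost_of_gap hlt hgap, jost_of_gap hlt hgap', h1, h3]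

/-! ### Reflection and the Wronskian -/

/-- The image of the pair under `x ↦ -x`. -/
noncomputable def reflect (S : Pair) : Pair where
  ω := S.ω.equivMapDomain (Equiv.neg ℝ)
  v := S.v.equivMapDomain (Equiv.neg ℝ)
  v_nonneg x := by simpa [Finsupp.equivMapDomain_apply] using S.v_nonneg (-x)

@[simp] theorem reflect_ω (S : Pair) (x : ℝ) : S.reflect.ω x = S.ω (-x) := rfl

@[simp] theorem reflect_v (S : Pair) (x : ℝ) : S.reflect.v x = S.v (-x) := rfl

@[simp] theorem reflect_dipole (S : Pair) (x : ℝ) : S.reflect.dipole x = S.dipole (-x) := rfl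

theorem mem_atoms_reflect {S : Pair} {x : ℝ} : x ∈ S.reflect.atoms ↔ -x ∈ S.atoms := by
  simp [mem_atoms]

/-- The Wronskian of the two Jost solutions in terms of their values at `x`. -/
theorem wronskian_eq_reflect (S : Pair) (x : ℝ) :
    S.jost (Real.exp x) * S.reflect.jost (Real.exp (-x)) -
      X * (C (Real.exp (-x)) * S.jost (Real.exp x) * S.reflect.slope (Real.exp (-x)) +
        C (Real.exp x) * S.slope (Real.exp x) * S.reflect.jost (Real.exp (-x)) +
        S.dipole x * S.jost (Real.exp x) * S.reflect.jost (Real.exp (-x))) =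
      S.reflect.jost 0 := by
  -- Both slopes leave out the atom at `x` itself, so its dipole is a separate term. The expression
  -- is computed directly right of all atoms and is unchanged across each gap.
  suffices ∀ ξ x, Real.exp x = ξ →
      S.jost (Real.exp x) * S.reflect.jost (Real.exp (-x)) -
      X * (C (Real.exp (-x)) * S.jost (Real.exp x) * S.reflect.slope (Real.exp (-x)) +
        C (Real.exp x) * S.slope (Real.exp x) * S.reflect.jost (Real.exp (-x)) +
        S.dipole x * S.jost (Real.exp x) * S.reflect.jost (Real.exp (-x))) =
      S.reflect.jost 0 from this _ x rfl
  have hinv : ∀ x : ℝ, C (Real.exp x) * C (Real.exp (-x)) = (1 : ℝ[X]) := fun x => by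
    rw [← C_mul, ← Real.exp_add]; simp
  refine gap_induction S.atoms (fun ξ h => ?_) (fun ξ y hy hlt hgap ih => ?_)
  · rintro x rfl
    have hgap : ∀ t ∈ S.reflect.atoms, 0 < Real.exp t → -x ≤ t := fun t ht _ => by
      have := h (-t) (mem_atoms_reflect.1 ht)
      rw [Real.exp_le_exp] at this; linarith
    have h1 := S.reflect.slope_of_gap (Real.exp_pos (-x)) hgap
    have h2 := S.reflect.jost_of_gap (Real.exp_pos (-x)) hgap
    rw [h2, h1, jost_of_forall_le h, slope_of_forall_le h]
    simp only [neg_neg, reflect_dipole, sub_zero]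
    linear_combination (X * S.dipole x * S.reflect.jost (Real.exp (-x))) * hinv x
  · rintro x rfl
    rw [← ih y rfl]
    have hxy : x < y := Real.exp_lt_exp.1 hlt
    have hlt' : Real.exp (-y) < Real.exp (-x) := Real.exp_lt_exp.2 (neg_lt_neg hxy)
    have hgap' : ∀ t ∈ S.reflect.atoms, Real.exp (-y) < Real.exp t → -x ≤ t := by
      intro t ht h
      by_contra hx
      have h1 : Real.exp x < Real.exp (-t) := Real.exp_lt_exp.2 (by linarith)
      have h2 := hgap (-t) (mem_atoms_reflect.1 ht) h1
      have h3 := Real.exp_lt_exp.1 h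
      linarith
    have h1 := S.reflect.slope_of_gap hlt' hgap'
    have h2 := S.reflect.jost_of_gap hlt' hgap'
    have h3 := slope_of_gap hlt hgap
    have h4 := jost_of_gap hlt hgap
    simp only [neg_neg, reflect_dipole] at h1 h2
    rw [h2, h4, h1, h3]
    simp only [C_sub]
    have ex := hinv x
    have ey := hinv y
    generalize C (Real.exp x) = a at *
    generalize C (Real.exp (-x)) = a' at *
    generalize C (Real.exp y) = b at *
    generalize C (Real.exp (-y)) = b' at *
    generalize S.dipole x = cx at *
    generalize S.dipole y = cy at *
    generalize S.jost (Real.exp y) = p at *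
    generalize S.slope (Real.exp y) = q at *
    generalize S.reflect.jost (Real.exp (-x)) = p' at *
    generalize S.reflect.slope (Real.exp (-x)) = q' at *
    linear_combination
      (X * (p - (b - a) * (X * (q + b' * (cy * p)))) * cx * p' -
        X ^ 2 * (q + b' * (cy * p)) * (q' + a * (cx * p'))) * ex +
      (X ^ 2 * (q + b' * (cy * p)) * (q' + a * (cx * p')) -
        X * cy * p * (p' - (a' - b') * (X * (q' + a * (cx * p'))))) * ey

theorem exists_forall_atoms_gt (S : Pair) : ∃ b : ℝ, ∀ y ∈ S.atoms, b < y := by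
  obtain ⟨b, hb⟩ := S.atoms.bddBelow
  exact ⟨b - 1, fun y hy => by linarith [hb hy]⟩

theorem exists_forall_atoms_lt (S : Pair) : ∃ b : ℝ, ∀ y ∈ S.atoms, y < b := by
  obtain ⟨b, hb⟩ := S.atoms.bddAbove
  exact ⟨b + 1, fun y hy => by linarith [hb hy]⟩

theorem slope_of_forall_gt {S : Pair} {x : ℝ} (h : ∀ y ∈ S.atoms, x < y) :
    S.slope (Real.exp x) = S.slope 0 :=
  (slope_of_le (Real.exp_pos x).le fun t ht _ => Real.exp_lt_exp.2 (h t ht)).symm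

theorem jost_of_forall_gt {S : Pair} {x : ℝ} (h : ∀ y ∈ S.atoms, x < y) :
    S.jost (Real.exp x) = S.jost 0 + C (Real.exp x) * (X * S.slope 0) := by
  rw [jost_of_le (Real.exp_pos x).le fun t ht _ => (Real.exp_lt_exp.2 (h t ht)).le, sub_zero]
  ring

/-- The Wronskian does not depend on the point. Left of all atoms the reflected solution is `1`, and
the expression collapses to `jost 0`. -/
theorem jost_reflect_zero (S : Pair) : S.reflect.jost 0 = S.jost 0 := by
  obtain ⟨b, hb⟩ := S.exists_forall_atoms_gt
  have hr : ∀ y ∈ S.reflect.atoms, Real.exp y ≤ Real.exp (-b) := fun y hy => by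
    rw [Real.exp_le_exp]
    have := hb _ (mem_atoms_reflect.1 hy)
    linarith
  have hd : S.dipole b = 0 := dipole_eq_zero fun h => lt_irrefl _ (hb b h)
  rw [← S.wronskian_eq_reflect b, jost_of_forall_le hr, slope_of_forall_le hr, hd,
    jost_of_forall_gt hb, slope_of_forall_gt hb]
  ring

theorem wronskian_eq (S : Pair) (x : ℝ) :
    S.jost (Real.exp x) * S.reflect.jost (Real.exp (-x)) -
      X * (C (Real.exp (-x)) * S.jost (Real.exp x) * S.reflect.slope (Real.exp (-x)) +
        C (Real.exp x) * S.slope (Real.exp x) * S.reflect.jost (Real.exp (-x)) +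
        S.dipole x * S.jost (Real.exp x) * S.reflect.jost (Real.exp (-x))) =
      S.jost 0 := by
  rw [S.wronskian_eq_reflect x, S.jost_reflect_zero]

/-- The Green function `φ₊ φ₋ / W` does not grow faster than a constant. -/
theorem natDegree_mul_reflect_le (S : Pair) (x : ℝ) :
    (S.jost (Real.exp x) * S.reflect.jost (Real.exp (-x))).natDegree ≤ (S.jost 0).natDegree := by
  have hP := S.isStieltjesPair (Real.exp x)
  have hP' := S.reflect.isStieltjesPair (Real.exp (-x))
  obtain ⟨σ, hσ, -, hc⟩ := hP.exists_coeff_eq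
  obtain ⟨σ', hσ', -, hc'⟩ := hP'.exists_coeff_eq
  have hXQ := hP.natDegree_X_mul_le
  have hXQ' := hP'.natDegree_X_mul_le
  have hW := S.wronskian_eq x
  set P := S.jost (Real.exp x)
  set P' := S.reflect.jost (Real.exp (-x))
  set Q := S.slope (Real.exp x)
  set Q' := S.reflect.slope (Real.exp (-x))
  have hlead : P.leadingCoeff * P'.leadingCoeff ≠ 0 :=
    mul_ne_zero (by simpa using hP.ne_zero) (by simpa using hP'.ne_zero)
  set n := P.natDegree + P'.natDegree with hn
  have hPP : (P * P').natDegree = n := natDegree_mul hP.ne_zero hP'.ne_zero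
  set T := P * P' - C (Real.exp (-x)) * (P * (X * Q')) - C (Real.exp x) * ((X * Q) * P') with hT
  have hWT : S.jost 0 = T - C (S.ω x) * (P * P') * X - C (S.v x) * (P * P') * X ^ 2 := by
    rw [← hW, hT, dipole]; ring
  have hPPn : (P * P').coeff n = P.leadingCoeff * P'.leadingCoeff :=
    coeff_mul_add_eq_of_natDegree_le le_rfl le_rfl
  have hPP1 : ∀ m, n < m → (P * P').coeff m = 0 := fun m hm =>
    coeff_eq_zero_of_natDegree_lt (by rwa [hPP])
  have h1 : ∀ m, n < m → (P * (X * Q')).coeff m = 0 := fun m hm =>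
    coeff_eq_zero_of_natDegree_lt
      ((natDegree_mul_le.trans (Nat.add_le_add_left hXQ' _)).trans_lt hm)
  have h2 : ∀ m, n < m → ((X * Q) * P').coeff m = 0 := fun m hm =>
    coeff_eq_zero_of_natDegree_lt
      ((natDegree_mul_le.trans (Nat.add_le_add_right hXQ _)).trans_lt hm)
  have hT1 : ∀ m, n < m → T.coeff m = 0 := fun m hm => by
    simp [hT, hPP1 m hm, h1 m hm, h2 m hm]
  rw [hPP]
  -- `W` has a nonzero coefficient in degree `n + 2`, `n + 1` or `n`, according to whether `v x ≠
  -- 0`, only `ω x ≠ 0`, or there is no atom at `x`. In the last case `σ, σ' ≥ 0` prevent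
  -- cancellation: the factor is `1 + e^{-x} σ' + e^x σ`.
  rcases eq_or_ne (S.v x) 0 with hv | hv
  · rcases eq_or_ne (S.ω x) 0 with hω | hω
    · refine le_natDegree_of_ne_zero ?_
      have e1 : (P * (X * Q')).coeff n = P.leadingCoeff * (-σ' * P'.leadingCoeff) := by
        rw [← hc']; exact coeff_mul_add_eq_of_natDegree_le le_rfl hXQ'
      have e2 : ((X * Q) * P').coeff n = (-σ * P.leadingCoeff) * P'.leadingCoeff := by
        rw [← hc]; exact coeff_mul_add_eq_of_natDegree_le hXQ le_rfl
      have e3 : (S.jost 0).coeff n =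
          (P.leadingCoeff * P'.leadingCoeff) * (1 + Real.exp (-x) * σ' + Real.exp x * σ) := by
        rw [hWT, hv, hω, hT]
        simp only [coeff_sub, coeff_C_mul, C_0, zero_mul, sub_zero, e1, e2, hPPn]
        ring
      rw [e3]
      exact mul_ne_zero hlead (by positivity)
    · refine (Nat.le_succ n).trans (le_natDegree_of_ne_zero ?_)
      rw [hWT, hv]
      simp only [C_0, zero_mul, sub_zero, coeff_sub, coeff_mul_X, coeff_C_mul,
        hT1 _ (Nat.lt_succ_self n), hPPn]
      simpa [hω] using hlead
  · refine (Nat.le_add_right n 2).trans (le_natDegree_of_ne_zero ?_)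
    rw [hWT]
    simp only [coeff_sub, coeff_mul_X_pow, coeff_C_mul, hT1 _ (show n < n + 2 by omega), hPPn]
    rw [coeff_mul_X, coeff_C_mul, hPP1 _ (Nat.lt_succ_self n)]
    simpa [hv] using hlead

/-- The discrete Lagrange identity for the derivative with respect to `z`. -/
theorem eval_derivative_wronskian (S : Pair) (z ξ : ℝ) :
    (derivative (X * S.slope ξ) * S.jost ξ - X * S.slope ξ * derivative (S.jost ξ)).eval z =
      ∑ y ∈ S.atoms with ξ < Real.exp y,
        (S.ω y + 2 * z * S.v y) * (Real.exp (-y) * (S.jost (Real.exp y)).eval z ^ 2) := by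
  refine gap_induction (p := fun ξ =>
    (derivative (X * S.slope ξ) * S.jost ξ - X * S.slope ξ * derivative (S.jost ξ)).eval z =
      ∑ y ∈ S.atoms with ξ < Real.exp y,
        (S.ω y + 2 * z * S.v y) * (Real.exp (-y) * (S.jost (Real.exp y)).eval z ^ 2)) S.atoms
    (fun ξ h => ?_) (fun ξ y hy hlt hgap ih => ?_) ξ
  · rw [slope_of_forall_le h, jost_of_forall_le h,
      Finset.filter_false_of_mem fun y hy => not_lt.2 (h y hy)]
    simp
  · have h1 : (S.atoms.filter fun t => ξ < Real.exp t) =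
        insert y (S.atoms.filter fun t => Real.exp y < Real.exp t) := by
      ext t
      simp only [Finset.mem_filter, Finset.mem_insert]
      constructor
      · rintro ⟨h1, h2⟩
        rcases (hgap t h1 h2).eq_or_lt with h3 | h3
        · exact Or.inl h3.symm
        · exact Or.inr ⟨h1, Real.exp_lt_exp.2 h3⟩
      · rintro (rfl | ⟨h1, h2⟩)
        · exact ⟨hy, hlt⟩
        · exact ⟨h1, hlt.trans h2⟩
    rw [h1, Finset.sum_insert (by simp), ← ih, jost_of_gap hlt hgap, slope_of_gap hlt hgap, dipole]
    simp only [derivative_sub, derivative_add, derivative_mul, derivative_C, derivative_X,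
      eval_sub, eval_add, eval_mul, eval_C, eval_X, eval_zero, eval_one]
    ring

end Pair

/-! ### The inverse problem on a half-line -/

namespace Pair

/-- `S` with the masses at `y` replaced by `w` and `v`. -/
noncomputable def update (S : Pair) (y w v : ℝ) (hv : 0 ≤ v) : Pair where
  ω := S.ω.update y w
  v := S.v.update y v
  v_nonneg x := by
    rw [Finsupp.coe_update]
    rcases eq_or_ne x y with rfl | h
    · simpa using hv
    · simpa [h] using S.v_nonneg x

/-- Every normalized Stieltjes pair is the Weyl function of a pair of measures on `(a, ∞)`. -/
theorem exists_jost_eq {P Q : ℝ[X]} (h : IsStieltjesPair P Q) (h0 : P.eval 0 = 1) (a : ℝ) :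
    ∃ S : Pair, (∀ y ∈ S.atoms, a < y) ∧ S.jost (Real.exp a) = P ∧ S.slope (Real.exp a) = Q := by
  induction hn : P.natDegree using Nat.strong_induction_on generalizing P Q a with
  | _ n ih =>
    rcases eq_or_ne P.natDegree 0 with hd | hd
    · refine ⟨⟨0, 0, fun _ => le_rfl⟩, by simp [mem_atoms], ?_, ?_⟩
      · rw [jost_of_forall_le (by simp [mem_atoms])]
        have := eq_C_of_natDegree_eq_zero hd
        rw [this, eval_C] at h0
        rw [this, h0, C_1]
      · rw [slope_of_forall_le (by simp [mem_atoms]), h.right_eq_zero hd]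
    · obtain ⟨l, w, v, P₁, Q₁, hl, hv, hwv, h₁, hlt, hQ, hP⟩ :=
        h.exists_reduction hd (by rw [h0]; exact one_ne_zero)
      have h10 : P₁.eval 0 = 1 := by
        rw [← h0, hP]; simp
      have hpos : 0 < Real.exp a + l := by positivity
      -- A gap of length `l` in the variable `e^x` puts the first atom here.
      set y := Real.log (Real.exp a + l) with hy
      have hey : Real.exp y = Real.exp a + l := Real.exp_log hpos
      have hay : Real.exp a < Real.exp y := by rw [hey]; linarith
      obtain ⟨S, hS, hSP, hSQ⟩ := ih P₁.natDegree (hn ▸ hlt) h₁ h10 y rfl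
      -- The masses carry a factor `e^y` because `slope` weights the dipole at `y` by `e^{-y}`.
      have hv' : 0 ≤ Real.exp y * v := mul_nonneg (Real.exp_pos y).le hv
      set T := S.update y (Real.exp y * w) (Real.exp y * v) hv' with hT
      have hne : ∀ t, t ≠ y → T.ω t = S.ω t ∧ T.v t = S.v t := fun t ht => by
        simp [hT, update, ht]
      have hTy : T.dipole y = C (Real.exp y) * (C w + C v * X) := by
        simp [hT, update, dipole]; ring
      have hatoms : ∀ t ∈ T.atoms, y ≤ t := fun t ht => by
        rcases eq_or_ne t y with rfl | hty
        · exact le_rfl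
        · rw [mem_atoms, (hne t hty).1, (hne t hty).2, ← mem_atoms] at ht
          exact (hS t ht).le
      obtain ⟨e1, e2⟩ := jost_slope_congr (S := T) (T := S) (ξ₀ := Real.exp y)
        (fun t ht => hne t (Real.exp_lt_exp.1 ht).ne') le_rfl
      have hslope : T.slope (Real.exp a) = Q := by
        have hinv : C (Real.exp (-y)) * C (Real.exp y) = (1 : ℝ[X]) := by
          rw [← C_mul, ← Real.exp_add]; simp
        rw [slope_of_gap hay fun t ht _ => hatoms t ht, e1, e2, hSP, hSQ, hTy, hQ]
        linear_combination ((C w + C v * X) * P₁) * hinv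
      refine ⟨T, fun t ht => (Real.exp_lt_exp.1 hay).trans_le (hatoms t ht), ?_, hslope⟩
      rw [jost_of_gap hay fun t ht _ => hatoms t ht, hslope, e1, hSP, hP, hey]
      congr 3
      ring

/-- The pair that agrees with `L` on the left of `a`, with `S` at `a` and with `R` on the right. -/
noncomputable def glue (a : ℝ) (L S R : Pair) : Pair where
  ω := L.ω.filter (· < a) + S.ω.filter (· = a) + R.ω.filter (a < ·)
  v := L.v.filter (· < a) + S.v.filter (· = a) + R.v.filter (a < ·)
  v_nonneg x := by
    simp only [Finsupp.add_apply, Finsupp.filter_apply]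
    have h1 := L.v_nonneg x
    have h2 := S.v_nonneg x
    have h3 := R.v_nonneg x
    refine add_nonneg (add_nonneg ?_ ?_) ?_ <;> split_ifs <;> first | assumption | exact le_rfl

/-- The masses on both sides of `a` may be changed as long as the Jost solutions keep their
values at `a` and their Wronskian. -/
theorem exists_slope_eq (S : Pair) (a : ℝ) {Q Q' : ℝ[X]}
    (hQ : IsStieltjesPair (S.jost (Real.exp a)) Q)
    (hQ' : IsStieltjesPair (S.reflect.jost (Real.exp (-a))) Q')
    (hsum : C (Real.exp (-a)) * S.jost (Real.exp a) * Q' +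
        C (Real.exp a) * Q * S.reflect.jost (Real.exp (-a)) =
      C (Real.exp (-a)) * S.jost (Real.exp a) * S.reflect.slope (Real.exp (-a)) +
        C (Real.exp a) * S.slope (Real.exp a) * S.reflect.jost (Real.exp (-a))) :
    ∃ T : Pair, T.jost (Real.exp a) = S.jost (Real.exp a) ∧ T.slope (Real.exp a) = Q ∧
      T.reflect.jost (Real.exp (-a)) = S.reflect.jost (Real.exp (-a)) ∧
      T.reflect.slope (Real.exp (-a)) = Q' ∧ T.jost 0 = S.jost 0 := by
  obtain ⟨R, -, hR1, hR2⟩ := exists_jost_eq hQ (jost_eval_zero _) a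
  obtain ⟨L, -, hL1, hL2⟩ := exists_jost_eq hQ' (jost_eval_zero _) (-a)
  set T := glue a L.reflect S R with hT
  obtain ⟨e1, e2⟩ := jost_slope_congr (S := T) (T := R) (ξ₀ := Real.exp a) (fun t ht => by
    have : a < t := Real.exp_lt_exp.1 ht
    simp [hT, glue, this, this.not_gt, this.ne']) le_rfl
  obtain ⟨e3, e4⟩ := jost_slope_congr (S := T.reflect) (T := L) (ξ₀ := Real.exp (-a))
    (fun t ht => by
      have h1 : -a < t := Real.exp_lt_exp.1 ht
      have h2 : -t < a := by linarith
      simp [hT, glue, h2, h2.not_gt, h2.ne]) le_rfl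
  have hd : T.dipole a = S.dipole a := by
    simp [hT, glue, dipole]
  rw [hR1] at e1
  rw [hR2] at e2
  rw [hL1] at e3
  rw [hL2] at e4
  refine ⟨T, e1, e2, e3, e4, ?_⟩
  -- The values and the dipole at `a` are unchanged, so the Wronskian depends on the choice only
  -- through the weighted sum fixed by `hsum`.
  rw [← T.wronskian_eq a, ← S.wronskian_eq a, e1, e2, e3, e4, hd]
  linear_combination (-X) * hsum

end Pair

/-! ### Solutions of the differential equation -/

section Solutions

variable {𝕜 : Type*} [RCLike 𝕜]

theorem eventually_notMem_punctured (s : Finset ℝ) (x : ℝ) : ∀ᶠ t in 𝓝[≠] x, t ∉ s := by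
  have : ∀ᶠ t in 𝓝 x, t ∉ s.erase x :=
    (s.erase x).finite_toSet.isClosed.isOpen_compl.mem_nhds (by simp)
  filter_upwards [nhdsWithin_le_nhds this, self_mem_nhdsWithin] with t ht htx hts
  exact ht (Finset.mem_erase.2 ⟨htx, hts⟩)

theorem hasDerivAt_exp_neg_half (x : ℝ) :
    HasDerivAt (fun x : ℝ => Real.exp (-x / 2)) (-(1 / 2) * Real.exp (-x / 2)) x :=
  (((hasDerivAt_id x).neg).div_const 2).exp.congr_deriv (by simp only [Pi.neg_apply, id]; ring)

/-- The fundamental solution with source `y`. -/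
noncomputable def kink (y x : ℝ) : ℝ := if x < y then 2 * Real.sinh ((y - x) / 2) else 0

/-- The derivative of `kink y`. -/
noncomputable def kinkDeriv (y x : ℝ) : ℝ := if x < y then -Real.cosh ((y - x) / 2) else 0

theorem hasDerivAt_kink {y x : ℝ} (h : x ≠ y) : HasDerivAt (kink y) (kinkDeriv y x) x := by
  rcases lt_or_gt_of_ne h with h | h
  · have h0 : HasDerivAt (fun x : ℝ => (y - x) / 2) (-1 / 2) x :=
      ((hasDerivAt_id x).const_sub y).div_const 2
    refine ((h0.sinh.const_mul 2).congr_of_eventuallyEq ?_).congr_deriv ?_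
    · filter_upwards [gt_mem_nhds h] with t ht
      exact if_pos ht
    · rw [kinkDeriv, if_pos h]; ring
  · rw [kinkDeriv, if_neg h.not_gt]
    refine (hasDerivAt_const x (0 : ℝ)).congr_of_eventuallyEq ?_
    filter_upwards [lt_mem_nhds h] with t ht
    exact if_neg (not_lt.2 (le_of_lt ht))

theorem hasDerivAt_kinkDeriv {y x : ℝ} (h : x ≠ y) :
    HasDerivAt (kinkDeriv y) (kink y x / 4) x := by
  rcases lt_or_gt_of_ne h with h | h
  · have h0 : HasDerivAt (fun x : ℝ => (y - x) / 2) (-1 / 2) x :=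
      ((hasDerivAt_id x).const_sub y).div_const 2
    refine (h0.cosh.neg.congr_of_eventuallyEq ?_).congr_deriv ?_
    · filter_upwards [gt_mem_nhds h] with t ht
      exact if_pos ht
    · rw [kink, if_pos h]; ring
  · rw [kink, if_neg h.not_gt, zero_div]
    refine (hasDerivAt_const x (0 : ℝ)).congr_of_eventuallyEq ?_
    filter_upwards [lt_mem_nhds h] with t ht
    exact if_neg (not_lt.2 (le_of_lt ht))

theorem continuous_kink (y : ℝ) : Continuous (kink y) := by
  have : kink y = fun x => 2 * Real.sinh (max (y - x) 0 / 2) := by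
    funext x
    rw [kink]
    split_ifs with h
    · rw [max_eq_left (by linarith)]
    · rw [max_eq_right (by linarith)]; simp
  rw [this]
  fun_prop

theorem tendsto_kinkDeriv_right (y x : ℝ) :
    Tendsto (kinkDeriv y) (𝓝[>] x) (𝓝 (kinkDeriv y x)) := by
  by_cases h : x < y
  · exact (hasDerivAt_kinkDeriv h.ne).continuousAt.tendsto.mono_left nhdsWithin_le_nhds
  · rw [kinkDeriv, if_neg h]
    refine tendsto_const_nhds.congr' ?_
    filter_upwards [self_mem_nhdsWithin] with t ht
    exact (if_neg (not_lt.2 ((not_lt.1 h).trans (le_of_lt ht)))).symm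

/-- At its source `kinkDeriv y` takes the right limit `0`, while the left limit is `-1`. The unit
jump is what produces the point masses. -/
theorem tendsto_kinkDeriv_left (y x : ℝ) :
    Tendsto (kinkDeriv y) (𝓝[<] x) (𝓝 (kinkDeriv y x - if x = y then 1 else 0)) := by
  by_cases h : x = y
  · subst h
    have h1 : Tendsto (fun t : ℝ => -Real.cosh ((x - t) / 2)) (𝓝[<] x)
        (𝓝 (-Real.cosh ((x - x) / 2))) :=
      (Continuous.tendsto (by fun_prop) x).mono_left nhdsWithin_le_nhds
    have h2 : kinkDeriv x x - (if x = x then 1 else 0) = -Real.cosh ((x - x) / 2) := by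
      simp [kinkDeriv]
    rw [h2]
    refine h1.congr' ?_
    filter_upwards [self_mem_nhdsWithin] with t ht
    exact (if_pos ht).symm
  · rw [if_neg h, sub_zero]
    exact (hasDerivAt_kinkDeriv h).continuousAt.tendsto.mono_left nhdsWithin_le_nhds

/-- Variation of constants: each `kink y` solves the free equation off `y` and has a unit jump of
the derivative there, so the term of `y` contributes exactly the jump `q y * f y`. -/
theorem isSolutionOf_of_volterra {s : Finset ℝ} {q f : ℝ → 𝕜}
    (hf : ∀ x, f x = Real.exp (-x / 2) • (1 : 𝕜) - ∑ y ∈ s, kink y x • (q y * f y)) :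
    IsSolutionOf s q f := by
  set g : ℝ → 𝕜 := fun x =>
    (-(1 / 2) * Real.exp (-x / 2)) • (1 : 𝕜) - ∑ y ∈ s, kinkDeriv y x • (q y * f y) with hg
  have hfun := funext hf
  have h1 : ∀ x, x ∉ s → HasDerivAt f (g x) x := fun x hx => by
    rw [hfun]
    exact ((hasDerivAt_exp_neg_half x).smul_const _).sub (HasDerivAt.fun_sum fun y hy =>
      (hasDerivAt_kink (ne_of_mem_of_not_mem hy hx).symm).smul_const _)
  have h2 : ∀ x, x ∉ s → HasDerivAt g (f x / 4) x := fun x hx => by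
    have := (((hasDerivAt_exp_neg_half x).const_mul (-(1 / 2))).smul_const (1 : 𝕜)).sub
      (HasDerivAt.fun_sum fun y hy =>
        (hasDerivAt_kinkDeriv (ne_of_mem_of_not_mem hy hx).symm).smul_const (q y * f y))
    refine this.congr_deriv ?_
    rw [hf x, sub_div, Finset.sum_div]
    simp only [RCLike.real_smul_eq_coe_mul]
    push_cast
    congr 1
    · ring
    · exact Finset.sum_congr rfl fun y _ => by ring
  refine ⟨fun x hx => ⟨(h1 x hx).differentiableAt, (h2 x hx).congr_of_eventuallyEq ?_⟩,
    fun x hx => ⟨?_, g x + q x * f x, g x, ?_, ?_, rfl⟩⟩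
  · have : ∀ᶠ t in 𝓝 x, t ∉ s := s.finite_toSet.isClosed.isOpen_compl.mem_nhds hx
    filter_upwards [this] with t ht
    exact (h1 t ht).deriv
  · rw [hfun]
    refine Continuous.continuousAt (Continuous.sub (by fun_prop) ?_)
    exact continuous_finsetSum _ fun y _ => (continuous_kink y).smul continuous_const
  · have h3 : g x + q x * f x = (-(1 / 2) * Real.exp (-x / 2)) • (1 : 𝕜) -
        ∑ y ∈ s, (kinkDeriv y x - if x = y then 1 else 0) • (q y * f y) := by
      simp only [hg, sub_smul, Finset.sum_sub_distrib, ite_smul, one_smul, zero_smul,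
        Finset.sum_ite_eq, hx, if_true]
      ring
    rw [h3]
    have h4 : Tendsto g (𝓝[<] x) (𝓝 ((-(1 / 2) * Real.exp (-x / 2)) • (1 : 𝕜) -
        ∑ y ∈ s, (kinkDeriv y x - if x = y then 1 else 0) • (q y * f y))) := by
      refine Tendsto.sub ?_ (tendsto_finsetSum _ fun y _ =>
        (tendsto_kinkDeriv_left y x).smul_const _)
      exact (Continuous.tendsto (by fun_prop) x).mono_left nhdsWithin_le_nhds
    refine h4.congr' ?_
    filter_upwards [nhdsWithin_mono x (fun t ht => ne_of_lt ht)
      (eventually_notMem_punctured s x)] with t ht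
    exact (h1 t ht).deriv.symm
  · have h4 : Tendsto g (𝓝[>] x) (𝓝 (g x)) := by
      refine Tendsto.sub ?_ (tendsto_finsetSum _ fun y _ =>
        (tendsto_kinkDeriv_right y x).smul_const _)
      exact (Continuous.tendsto (by fun_prop) x).mono_left nhdsWithin_le_nhds
    refine h4.congr' ?_
    filter_upwards [nhdsWithin_mono x (fun t ht => ne_of_gt ht)
      (eventually_notMem_punctured s x)] with t ht
    exact (h1 t ht).deriv.symm

theorem IsSolutionOf.const_mul {s : Finset ℝ} {q f : ℝ → 𝕜} (hf : IsSolutionOf s q f) (c : 𝕜) :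
    IsSolutionOf s q (fun x => c * f x) := by
  have hd : deriv (fun x => c * f x) = fun x => c * deriv f x :=
    funext fun x => deriv_const_mul_field c
  refine ⟨fun x hx => ?_, fun x hx => ?_⟩
  · obtain ⟨h1, h2⟩ := hf.ode x hx
    refine ⟨h1.const_mul c, ?_⟩
    rw [hd]
    exact (h2.const_mul c).congr_deriv (by ring)
  · obtain ⟨h1, l, r, hl, hr, hlr⟩ := hf.jump x hx
    refine ⟨continuousAt_const.mul h1, c * l, c * r, ?_, ?_, by rw [hlr]; ring⟩
    · rw [hd]; exact hl.const_mul c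
    · rw [hd]; exact hr.const_mul c

theorem IsSolutionOf.continuous {s : Finset ℝ} {q f : ℝ → 𝕜} (hf : IsSolutionOf s q f) :
    Continuous f :=
  continuous_iff_continuousAt.2 fun x => by
    by_cases hx : x ∈ s
    · exact (hf.jump x hx).1
    · exact (hf.ode x hx).1.continuousAt

/-- Near `+∞` a solution is a combination of `e^{x/2}` and `e^{-x/2}`. -/
theorem IsSolutionOf.exists_eq_of_forall_lt {s : Finset ℝ} {q f : ℝ → 𝕜} (hf : IsSolutionOf s q f)
    {b : ℝ} (hb : ∀ y ∈ s, y < b) :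
    ∃ A B : 𝕜, ∀ x, b < x → f x = Real.exp (x / 2) • A + Real.exp (-x / 2) • B := by
  have key : ∀ e : ℝ, e ^ 2 = 1 → ∃ c : 𝕜, ∀ x, b < x →
      Real.exp (e * x / 2) • (deriv f x - (e / 2) • f x) = c := by
    intro e he
    set u : ℝ → 𝕜 := fun x => Real.exp (e * x / 2) • (deriv f x - (e / 2) • f x) with hu
    have hud : ∀ x ∈ Set.Ioi b, HasDerivAt u 0 x := by
      intro x hx
      obtain ⟨hd, hd'⟩ := hf.ode x (fun h => lt_asymm (hb x h) hx)
      have h2 : HasDerivAt (fun x : ℝ => Real.exp (e * x / 2))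
          (Real.exp (e * x / 2) * (e / 2)) x :=
        (((hasDerivAt_id x).const_mul e).div_const 2).exp.congr_deriv (by simp)
      refine (h2.smul (hd'.sub (hd.hasDerivAt.const_smul (e / 2)))).congr_deriv ?_
      have he' : (e : 𝕜) ^ 2 = 1 := by exact_mod_cast he
      simp only [Pi.sub_apply, Pi.smul_apply, RCLike.real_smul_eq_coe_mul]
      push_cast
      linear_combination (-(Real.exp (e * x / 2) : 𝕜) * f x / 4) * he'
    exact ⟨u (b + 1), fun x hx => isOpen_Ioi.is_const_of_deriv_eq_zero isPreconnected_Ioi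
      (fun t ht => (hud t ht).differentiableAt.differentiableWithinAt)
      (fun t ht => (hud t ht).deriv) hx (show b < b + 1 by linarith)⟩
  obtain ⟨c₁, h₁⟩ := key 1 (by norm_num)
  obtain ⟨c₂, h₂⟩ := key (-1) (by norm_num)
  refine ⟨c₂, -c₁, fun x hx => ?_⟩
  rw [← h₁ x hx, ← h₂ x hx]
  have hE : Real.exp (x / 2) * Real.exp (-x / 2) = 1 := by
    rw [← Real.exp_add, show x / 2 + -x / 2 = 0 by ring, Real.exp_zero]
  have hE' : (Real.exp (x / 2) : 𝕜) * (Real.exp (-x / 2) : 𝕜) = 1 := by exact_mod_cast hE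
  rw [show (1 : ℝ) * x / 2 = x / 2 by ring, show (-1 : ℝ) * x / 2 = -x / 2 by ring]
  simp only [RCLike.real_smul_eq_coe_mul]
  push_cast
  linear_combination (-f x) * hE'

end Solutions

/-! ### Jost solutions, eigenvalues and norming constants through the polynomials -/

namespace Pair

section

variable {𝕜 : Type*} [RCLike 𝕜]

theorem weight_eq_aeval (S : Pair) (z : 𝕜) (y : ℝ) : S.weight z y = z * aeval z (S.dipole y) := by
  simp [weight, dipole, RCLike.algebraMap_eq_ofReal]
  ring

/-- Multiplication by `e^{-x/2}` turns the kernel `1 - e^{x-y}` into `2 sinh((y-x)/2) e^{-y/2}`. The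
polynomial Volterra equation thus becomes the one for the differential equation, and uniqueness of
the Jost solution concludes. -/
theorem phiPlus_eq (S : Pair) (z : 𝕜) (x : ℝ) :
    S.phiPlus z x = Real.exp (-x / 2) • aeval z (S.jost (Real.exp x)) := by
  have hsol : S.IsJostPlus z fun x => Real.exp (-x / 2) • aeval z (S.jost (Real.exp x)) := by
    refine ⟨isSolutionOf_of_volterra fun x => ?_, ?_⟩
    · rw [jost_eq, Finset.sum_filter]
      rw [map_sub, map_one, map_mul, aeval_X, map_sum, smul_sub, Finset.mul_sum, Finset.smul_sum]
      congr 1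
      refine Finset.sum_congr rfl fun y _ => ?_
      rw [weight_eq_aeval, kink]
      by_cases hxy : x < y
      · rw [if_pos hxy, if_pos (Real.exp_lt_exp.2 hxy), map_mul, map_mul, aeval_C,
          RCLike.algebraMap_eq_ofReal]
        have h : Real.exp (-x / 2) * (1 - Real.exp x * Real.exp (-y)) =
            2 * Real.sinh ((y - x) / 2) * Real.exp (-y / 2) := by
          rw [Real.sinh_eq, mul_div_cancel₀ _ (two_ne_zero' ℝ), mul_sub, sub_mul, ← Real.exp_add,
            ← Real.exp_add, ← Real.exp_add, ← Real.exp_add, mul_one]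
          ring_nf
        have h' := congrArg (fun r : ℝ => (r : 𝕜)) h
        simp only [RCLike.real_smul_eq_coe_mul]
        push_cast at h' ⊢
        linear_combination
          (z * aeval z (S.dipole y) * aeval z (S.jost (Real.exp y))) * h'
      · rw [if_neg hxy, if_neg fun h => hxy (Real.exp_lt_exp.1 h)]
        simp
    · obtain ⟨b, hb⟩ := S.exists_forall_atoms_lt
      filter_upwards [eventually_gt_atTop b] with x hx
      rw [jost_of_forall_le fun y hy => Real.exp_le_exp.2 ((hb y hy).trans hx).le]
      simp [RCLike.real_smul_eq_coe_mul]
  exact (congrFun hsol.eq_phiPlus x).symm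

theorem phiMinus_eq_reflect (S : Pair) (z : 𝕜) (x : ℝ) :
    S.phiMinus z x = S.reflect.phiPlus z (-x) := by
  have hsol : S.IsJostMinus z fun x => S.reflect.phiPlus z (-x) := by
    obtain ⟨h1, h2⟩ := S.reflect.isJostPlus_phiPlus z
    refine ⟨?_, ?_⟩
    · have := h1.comp_neg (t := S.atoms) (fun x => by simp [mem_atoms_reflect])
      have hw : S.weight z = fun x => S.reflect.weight z (-x) := by
        funext x; simp [weight]
      rwa [IsSolution, hw]
    · filter_upwards [tendsto_neg_atBot_atTop.eventually h2] with x hx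
      simpa using hx
  exact (congrFun hsol.eq_phiMinus x).symm

theorem phiMinus_eq (S : Pair) (z : 𝕜) (x : ℝ) :
    S.phiMinus z x = Real.exp (x / 2) • aeval z (S.reflect.jost (Real.exp (-x))) := by
  rw [phiMinus_eq_reflect, phiPlus_eq, neg_neg]

/-- Exhibits `jost 0` as the coefficient of the exponential that grows at `-∞`. -/
theorem phiPlus_of_forall_gt (S : Pair) (z : 𝕜) {x : ℝ} (h : ∀ y ∈ S.atoms, x < y) :
    S.phiPlus z x = Real.exp (-x / 2) • aeval z (S.jost 0) +
      Real.exp (x / 2) • (z * aeval z (S.slope 0)) := by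
  have hE : Real.exp (-x / 2) * Real.exp x = Real.exp (x / 2) := by
    rw [← Real.exp_add]; ring_nf
  have hE' := congrArg (fun r : ℝ => (r : 𝕜)) hE
  rw [phiPlus_eq, jost_of_forall_gt h]
  simp only [map_add, map_mul, aeval_C, aeval_X, RCLike.algebraMap_eq_ofReal,
    RCLike.real_smul_eq_coe_mul]
  push_cast at hE' ⊢
  linear_combination (z * aeval z (S.slope 0)) * hE'

/-- At an eigenvalue the two Jost solutions are proportional. -/
theorem phiPlus_eq_mul_phiMinus (S : Pair) {z : 𝕜} (hz : aeval z (S.jost 0) = 0)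
    (hA : z * aeval z (S.slope 0) ≠ 0) (x : ℝ) :
    S.phiPlus z x = z * aeval z (S.slope 0) * S.phiMinus z x := by
  have hsol : S.IsJostMinus z fun x => (z * aeval z (S.slope 0))⁻¹ * S.phiPlus z x := by
    refine ⟨(S.isJostPlus_phiPlus z).1.const_mul _, ?_⟩
    obtain ⟨b, hb⟩ := S.exists_forall_atoms_gt
    filter_upwards [eventually_lt_atBot b] with x hx
    rw [S.phiPlus_of_forall_gt z fun y hy => hx.trans (hb y hy), hz, smul_zero, zero_add,
      RCLike.real_smul_eq_coe_mul, mul_comm, mul_assoc, mul_inv_cancel₀ hA, mul_one]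
  rw [← congrFun hsol.eq_phiMinus x, mul_inv_cancel_left₀ hA]

end

/-- The eigenvalues are the zeros of the Wronskian. -/
theorem isEigenvalue_iff (S : Pair) (z : ℂ) : S.IsEigenvalue z ↔ aeval z (S.jost 0) = 0 := by
  obtain ⟨b, hb⟩ := S.exists_forall_atoms_lt
  obtain ⟨a, ha⟩ := S.exists_forall_atoms_gt
  constructor
  · rintro ⟨f, hf, hne, K, hK⟩
    obtain ⟨A, B, hAB⟩ := hf.exists_eq_of_forall_lt hb
    -- Boundedness at `+∞` kills the coefficient of `e^{x/2}`, so `f` is a multiple of `φ₊`.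
    have hA : A = 0 := by
      by_contra hA
      have h1 : Tendsto (fun x : ℝ => Real.exp (x / 2) * ‖A‖ - ‖B‖ * Real.exp (-x / 2)) atTop
          atTop := by
        have h2 : Tendsto (fun x : ℝ => Real.exp (x / 2) * ‖A‖) atTop atTop :=
          (Real.tendsto_exp_atTop.comp (tendsto_id.atTop_div_const two_pos)).atTop_mul_const
            (norm_pos_iff.2 hA)
        have h3 : Tendsto (fun x : ℝ => ‖B‖ * Real.exp (-x / 2)) atTop (𝓝 (‖B‖ * 0)) :=
          (Real.tendsto_exp_atBot.comp
            (tendsto_neg_atTop_atBot.atBot_div_const two_pos)).const_mul _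
        simpa [sub_eq_add_neg] using h2.atTop_add h3.neg
      obtain ⟨x, hx, hxb⟩ := ((h1.eventually_gt_atTop K).and (eventually_gt_atTop b)).exists
      have h4 := hK x
      rw [hAB x hxb] at h4
      have h5 := norm_sub_le_norm_add (Real.exp (x / 2) • A) (Real.exp (-x / 2) • B)
      rw [norm_smul, norm_smul, Real.norm_of_nonneg (Real.exp_pos _).le,
        Real.norm_of_nonneg (Real.exp_pos _).le] at h5
      linarith [mul_comm ‖B‖ (Real.exp (-x / 2))]
    have hfB : f = fun x => B * S.phiPlus z x := by
      refine hf.eq_of_atTop ((S.isJostPlus_phiPlus z).1.const_mul B) ?_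
      filter_upwards [(S.isJostPlus_phiPlus z).2, eventually_gt_atTop b] with x h1 h2
      rw [hAB x h2, h1, hA, smul_zero, zero_add, RCLike.real_smul_eq_coe_mul, mul_comm]
    have hB : B ≠ 0 := by
      rintro rfl
      exact hne (by rw [hfB]; funext x; simp)
    -- If the Wronskian were nonzero, `φ₊` would grow like `e^{-x/2}` at `-∞`.
    by_contra hW
    set W := aeval z (S.jost 0)
    set D := z * aeval z (S.slope 0)
    have h1 : Tendsto (fun x : ℝ => ‖B‖ * (Real.exp (-x / 2) * ‖W‖ - ‖D‖ * Real.exp (x / 2))) atBot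
        atTop := by
      have h2 : Tendsto (fun x : ℝ => Real.exp (-x / 2) * ‖W‖) atBot atTop :=
        (Real.tendsto_exp_atTop.comp
          (tendsto_neg_atBot_atTop.atTop_div_const two_pos)).atTop_mul_const (norm_pos_iff.2 hW)
      have h3 : Tendsto (fun x : ℝ => ‖D‖ * Real.exp (x / 2)) atBot (𝓝 (‖D‖ * 0)) :=
        (Real.tendsto_exp_atBot.comp (tendsto_id.atBot_div_const two_pos)).const_mul _
      refine Tendsto.const_mul_atTop (norm_pos_iff.2 hB) ?_
      simpa [sub_eq_add_neg] using h2.atTop_add h3.neg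
    obtain ⟨x, hx, hxa⟩ := ((h1.eventually_gt_atTop K).and (eventually_lt_atBot a)).exists
    have h4 := hK x
    rw [hfB] at h4
    simp only [norm_mul] at h4
    rw [S.phiPlus_of_forall_gt z fun y hy => hxa.trans (ha y hy)] at h4
    have h5 := norm_sub_le_norm_add (Real.exp (-x / 2) • W) (Real.exp (x / 2) • D)
    rw [norm_smul, norm_smul, Real.norm_of_nonneg (Real.exp_pos _).le,
      Real.norm_of_nonneg (Real.exp_pos _).le] at h5
    have h6 := mul_le_mul_of_nonneg_left h5 (norm_nonneg B)
    rw [mul_comm ‖D‖] at hx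
    linarith
  · intro hW
    refine ⟨S.phiPlus z, (S.isJostPlus_phiPlus z).1, ?_, ?_⟩
    · intro h0
      obtain ⟨x, hx⟩ := (S.isJostPlus_phiPlus z).2.exists
      rw [h0] at hx
      simp only [Pi.zero_apply] at hx
      exact Real.exp_ne_zero _ (Complex.ofReal_eq_zero.1 hx.symm)
    · have hcont : Continuous (S.phiPlus z) := (S.isJostPlus_phiPlus z).1.continuous
      obtain ⟨c, hc⟩ := eventually_atTop.1 (S.isJostPlus_phiPlus z).2
      obtain ⟨K, hK⟩ := (isCompact_Icc (a := min a 0 - 1) (b := max c 0)).exists_bound_of_continuousOn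
        hcont.continuousOn
      refine ⟨max K (max 1 ‖z * aeval z (S.slope 0)‖), fun x => ?_⟩
      rcases lt_or_ge x (min a 0 - 1) with h1 | h1
      · have h2 : x < a := by linarith [min_le_left a 0]
        have h3 : x < 0 := by linarith [min_le_right a 0]
        rw [S.phiPlus_of_forall_gt z fun y hy => h2.trans (ha y hy), hW, smul_zero, zero_add,
          norm_smul, Real.norm_of_nonneg (Real.exp_pos _).le]
        refine (mul_le_of_le_one_left (norm_nonneg _) (Real.exp_le_one_iff.2 (by linarith))).trans ?_
        exact (le_max_right _ _).trans (le_max_right _ _)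
      rcases le_or_gt x (max c 0) with h2 | h2
      · exact (hK x ⟨h1, h2⟩).trans (le_max_left _ _)
      · rw [hc x ((le_max_left _ _).trans h2.le), RCLike.norm_ofReal,
          abs_of_pos (Real.exp_pos _)]
        have h3 : 0 < x := (le_max_right _ _).trans_lt h2
        refine (Real.exp_le_one_iff.2 (by linarith)).trans ?_
        exact (le_max_left _ _).trans (le_max_right _ _)

/-- The Lagrange identity at `ξ = 0`, that is `x = -∞`, where every atom is counted. -/
theorem gammaSq_eq (S : Pair) (l : ℝ) :
    S.gammaSq l = (derivative (X * S.slope 0) * S.jost 0 -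
      X * S.slope 0 * derivative (S.jost 0)).eval l := by
  have hφ : ∀ y, |S.phiPlus l y| ^ 2 = Real.exp (-y) * (S.jost (Real.exp y)).eval l ^ 2 := fun y => by
    rw [sq_abs, phiPlus_eq, coe_aeval_eq_eval, smul_eq_mul, mul_pow, ← Real.exp_nat_mul]
    congr 2
    push_cast; ring
  rw [eval_derivative_wronskian, Finset.filter_true_of_mem fun y _ => Real.exp_pos y, gammaSq,
    Finsupp.sum_of_support_subset S.ω (s := S.atoms) Finset.subset_union_left _ (by simp),
    Finsupp.sum_of_support_subset S.v (s := S.atoms) Finset.subset_union_right _ (by simp),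
    Finset.mul_sum, ← Finset.sum_add_distrib]
  refine Finset.sum_congr rfl fun y _ => ?_
  rw [hφ]; ring

theorem norming_eq (S : Pair) {l : ℝ} (hl : (S.jost 0).eval l = 0) :
    S.norming l = -(l ^ 2 * ((S.slope 0).eval l * (derivative (S.jost 0)).eval l)) := by
  rw [norming, gammaSq_eq]
  simp [hl]
  ring

theorem ne_zero_of_eval_jost {S : Pair} {ξ l : ℝ} (hl : (S.jost ξ).eval l = 0) : l ≠ 0 := by
  rintro rfl
  rw [jost_eval_zero] at hl
  exact one_ne_zero hl

/-- The norming constant is `λ²` times minus the product of `slope 0` and `W'` at `λ`, which is the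
sign condition of the Stieltjes pair at `-∞`. The square roots in the interior data are therefore
nonzero. -/
theorem norming_pos (S : Pair) {l : ℝ} (hl : (S.jost 0).eval l = 0) : 0 < S.norming l := by
  rw [norming_eq S hl, neg_pos]
  have := ne_zero_of_eval_jost hl
  exact mul_neg_of_pos_of_neg (by positivity) ((S.isStieltjesPair 0).sign l hl)

end Pair

/-! ### Product formulas and changes of the masses -/

namespace IsStieltjesPair

variable {P Q : ℝ[X]}

/-- The zeros are real and simple and the value at `0` is `1`, so the zeros determine the
polynomial. This applies to `W` and to both Jost solutions at `a`. -/
theorem eval_eq_prod (h : IsStieltjesPair P Q) (h0 : P.eval 0 = 1) (z : ℝ) :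
    P.eval z = ∏ x ∈ P.roots.toFinset, (1 - z / x) := by
  have key : ∀ t, P.eval t = P.leadingCoeff * ∏ x ∈ P.roots.toFinset, (t - x) := fun t => by
    rw [h.splits.eval_eq_prod_roots t, Finset.prod_multiset_map_count]
    congr 1
    refine Finset.prod_congr rfl fun x hx => ?_
    rw [Multiset.count_eq_one_of_mem h.nodup_roots (Multiset.mem_toFinset.1 hx), pow_one]
  have hne : ∀ x ∈ P.roots.toFinset, x ≠ 0 := fun x hx h1 => by
    rw [h.mem_roots_toFinset, h1, h0] at hx
    exact one_ne_zero hx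
  have h1 := key 0
  rw [h0] at h1
  have h2 : ∏ x ∈ P.roots.toFinset, (z - x) =
      (∏ x ∈ P.roots.toFinset, (0 - x)) * ∏ x ∈ P.roots.toFinset, (1 - z / x) := by
    rw [← Finset.prod_mul_distrib]
    refine Finset.prod_congr rfl fun x hx => ?_
    have := hne x hx
    field_simp
    ring
  rw [key z, h2, ← mul_assoc, ← h1, one_mul]

theorem derivative_eval_eq_prod (h : IsStieltjesPair P Q) (h0 : P.eval 0 = 1) {x : ℝ}
    (hx : P.eval x = 0) :
    -(x * P.derivative.eval x) = ∏ y ∈ P.roots.toFinset.erase x, (1 - x / y) := by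
  have hmem := h.mem_roots_toFinset.2 hx
  have hx0 : x ≠ 0 := by
    rintro rfl
    rw [h0] at hx
    exact one_ne_zero hx
  have hP : P = (1 - C x⁻¹ * X) * ∏ y ∈ P.roots.toFinset.erase x, (1 - C y⁻¹ * X) := by
    refine Polynomial.funext fun z => ?_
    rw [h.eval_eq_prod h0, ← Finset.mul_prod_erase _ _ hmem, eval_mul, eval_prod]
    simp [div_eq_inv_mul]
  have hd := congrArg (fun p => (derivative p).eval x) hP
  simp only [derivative_mul, derivative_sub, derivative_one, derivative_C, derivative_X, eval_add,
    eval_mul, eval_sub, eval_one, eval_C, eval_X, eval_neg, eval_prod, zero_mul, mul_one, zero_add,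
    zero_sub, inv_mul_cancel₀ hx0, sub_self, add_zero, mul_one] at hd
  rw [hd, neg_mul, mul_neg, neg_neg, mul_inv_cancel_left₀ hx0]
  exact Finset.prod_congr rfl fun y _ => by rw [div_eq_inv_mul]

/-- Changing the masses at some of the poles. -/
theorem perturb (h : IsStieltjesPair P Q) {s : Finset ℝ} (hs : ∀ x ∈ s, P.eval x = 0)
    {ε : ℝ → ℝ} (hε : ∀ x ∈ s, 0 < -(Q.eval x / P.derivative.eval x) + ε x) :
    IsStieltjesPair P (Q - ∑ x ∈ s, C (ε x) * (P /ₘ (X - C x))) ∧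
      ∀ x ∈ s, (Q - ∑ x ∈ s, C (ε x) * (P /ₘ (X - C x))).eval x =
        -(-(Q.eval x / P.derivative.eval x) + ε x) * P.derivative.eval x := by
  have hval : ∀ x ∈ s, (Q - ∑ x ∈ s, C (ε x) * (P /ₘ (X - C x))).eval x =
        -(-(Q.eval x / P.derivative.eval x) + ε x) * P.derivative.eval x := fun x hx => by
    rw [eval_sub, eval_finsetSum, Finset.sum_eq_single x]
    · have := h.derivative_ne_zero (hs x hx)
      rw [eval_mul, eval_C, eval_divByMonic_of_root (hs x hx)]
      field_simp
      ring
    · intro y hy hyx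
      rw [eval_mul, eval_divByMonic_of_ne (hs y hy) (hs x hx) hyx.symm, mul_zero]
    · exact fun hn => absurd hx hn
  refine ⟨⟨?_, h.splits, fun x hx => ?_⟩, hval⟩
  · refine (degree_sub_le _ _).trans_lt (max_lt h.degree_lt ?_)
    refine (degree_sum_le _ _).trans_lt ?_
    rw [Finset.sup_lt_iff (bot_lt_iff_ne_bot.2 (by simpa using h.ne_zero))]
    intro x _
    rw [C_mul']
    exact (degree_smul_le _ _).trans_lt (degree_divByMonic_lt _ _ h.ne_zero (by simp))
  · by_cases hxs : x ∈ s
    · rw [hval x hxs]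
      have h1 := hε x hxs
      have h2 := h.derivative_ne_zero hx
      have h3 : 0 < (-(Q.eval x / P.derivative.eval x) + ε x) * P.derivative.eval x ^ 2 := by
        positivity
      linarith
    · rw [eval_sub, eval_finsetSum, Finset.sum_eq_zero, sub_zero]
      · exact h.sign x hx
      · intro y hy
        rw [eval_mul, eval_divByMonic_of_ne (hs y hy) hx fun h => hxs (h ▸ hy), mul_zero]

end IsStieltjesPair

/-! ### Spectral data and interior spectral data -/

namespace Pair

theorem phiPlus_real (S : Pair) (z x : ℝ) :
    S.phiPlus z x = Real.exp (-x / 2) * (S.jost (Real.exp x)).eval z := by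
  rw [phiPlus_eq, coe_aeval_eq_eval, smul_eq_mul]

theorem phiMinus_real (S : Pair) (z x : ℝ) :
    S.phiMinus z x = Real.exp (x / 2) * (S.reflect.jost (Real.exp (-x))).eval z := by
  rw [phiMinus_eq, coe_aeval_eq_eval, smul_eq_mul]

theorem phiPlus_eq_zero_iff (S : Pair) {z x : ℝ} :
    S.phiPlus z x = 0 ↔ (S.jost (Real.exp x)).eval z = 0 := by
  rw [phiPlus_real, mul_eq_zero, or_iff_right (Real.exp_ne_zero _)]

theorem phiMinus_eq_zero_iff (S : Pair) {z x : ℝ} :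
    S.phiMinus z x = 0 ↔ (S.reflect.jost (Real.exp (-x))).eval z = 0 := by
  rw [phiMinus_real, mul_eq_zero, or_iff_right (Real.exp_ne_zero _)]

variable {S : Pair} {l : ℝ}

theorem mul_slope_ne_zero (hl : (S.jost 0).eval l = 0) : l * (S.slope 0).eval l ≠ 0 := by
  refine mul_ne_zero (ne_zero_of_eval_jost hl) fun h => ?_
  have := (S.isStieltjesPair 0).sign l hl
  rw [h, zero_mul] at this
  exact lt_irrefl _ this

theorem phiPlus_eq_mul_phiMinus_real (hl : (S.jost 0).eval l = 0) (x : ℝ) :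
    S.phiPlus l x = l * (S.slope 0).eval l * S.phiMinus l x := by
  have := S.phiPlus_eq_mul_phiMinus (z := l) (by rwa [coe_aeval_eq_eval])
    (by rw [coe_aeval_eq_eval]; exact mul_slope_ne_zero hl) x
  rwa [coe_aeval_eq_eval] at this

theorem eval_jost_eq_zero_iff_reflect (hl : (S.jost 0).eval l = 0) (x : ℝ) :
    (S.jost (Real.exp x)).eval l = 0 ↔ (S.reflect.jost (Real.exp (-x))).eval l = 0 := by
  rw [← phiPlus_eq_zero_iff, ← phiMinus_eq_zero_iff, phiPlus_eq_mul_phiMinus_real hl,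
    mul_eq_zero, or_iff_right (mul_slope_ne_zero hl)]

/-- At an eigenvalue `φ₊ = κ φ₋` with `κ = λ * slope 0 (λ)`, and the norming constant is `-λ W'(λ)
κ`. Eliminating `κ` leaves a relation between values at `x`. -/
theorem norming_mul_reflect_jost (hl : (S.jost 0).eval l = 0) (x : ℝ) :
    S.norming l * (Real.exp x * (S.reflect.jost (Real.exp (-x))).eval l) =
      -(l * (derivative (S.jost 0)).eval l) * (S.jost (Real.exp x)).eval l := by
  have h := phiPlus_eq_mul_phiMinus_real hl x
  rw [phiPlus_real, phiMinus_real] at h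
  have hE : Real.exp (x / 2) * Real.exp (x / 2) = Real.exp x := by
    rw [← Real.exp_add]; ring_nf
  have hE' : Real.exp (x / 2) * Real.exp (-x / 2) = 1 := by
    rw [← Real.exp_add, show x / 2 + -x / 2 = 0 by ring, Real.exp_zero]
  have h1 : (S.jost (Real.exp x)).eval l =
      l * (S.slope 0).eval l * (Real.exp x * (S.reflect.jost (Real.exp (-x))).eval l) := by
    have := congrArg (Real.exp (x / 2) * ·) h
    rw [← mul_assoc, hE', one_mul] at this
    rw [this, ← hE]; ring
  rw [norming_eq S hl, h1]
  ring

theorem exists_gap_right (S : Pair) (a : ℝ) : ∃ y, a < y ∧ ∀ t ∈ S.atoms, a < t → y ≤ t := by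
  rcases (S.atoms.filter (a < ·)).eq_empty_or_nonempty with h | h
  · exact ⟨a + 1, by linarith, fun t ht hat =>
      absurd (h ▸ Finset.mem_filter.2 ⟨ht, hat⟩) (Finset.notMem_empty t)⟩
  · obtain ⟨y, hy, hmin⟩ := Finset.exists_min_image _ id h
    exact ⟨y, (Finset.mem_filter.1 hy).2, fun t ht hat => hmin t (Finset.mem_filter.2 ⟨ht, hat⟩)⟩

/-- The norming constant of an eigenvalue whose eigenfunction vanishes at `a`. -/
theorem norming_mul_reflect_slope (hl : (S.jost 0).eval l = 0) {a : ℝ}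
    (ha : (S.jost (Real.exp a)).eval l = 0) :
    S.norming l * (S.reflect.slope (Real.exp (-a))).eval l =
      Real.exp a * (l * (derivative (S.jost 0)).eval l) * (S.slope (Real.exp a)).eval l := by
  have ha' := (eval_jost_eq_zero_iff_reflect hl a).1 ha
  obtain ⟨y, hay, hgap⟩ := S.exists_gap_right a
  have hexp : Real.exp a < Real.exp y := Real.exp_lt_exp.2 hay
  have hexp' : Real.exp (-y) < Real.exp (-a) := Real.exp_lt_exp.2 (neg_lt_neg hay)
  have hgap1 : ∀ t ∈ S.atoms, Real.exp a < Real.exp t → y ≤ t := fun t ht h =>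
    hgap t ht (Real.exp_lt_exp.1 h)
  have hgap2 : ∀ t ∈ S.reflect.atoms, Real.exp (-y) < Real.exp t → -a ≤ t := fun t ht h => by
    by_contra hlt
    have h1 := hgap (-t) (mem_atoms_reflect.1 ht) (by linarith)
    have h2 := Real.exp_lt_exp.1 h
    linarith
  have h1 := congrArg (eval l) (S.jost_of_gap hexp hgap1)
  have h2 := congrArg (eval l) (S.reflect.jost_of_gap hexp' hgap2)
  have h3 := congrArg (eval l) (S.reflect.slope_of_gap hexp' hgap2)
  have h4 := phiPlus_eq_mul_phiMinus_real hl y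
  simp only [eval_sub, eval_add, eval_mul, eval_C, eval_X, ha, ha', mul_zero, add_zero, zero_sub]
    at h1 h2 h3
  rw [phiPlus_real, phiMinus_real, h2, h3] at h4
  have hE : Real.exp (y / 2) * Real.exp (y / 2) = Real.exp y := by
    rw [← Real.exp_add]; ring_nf
  have hE' : Real.exp (y / 2) * Real.exp (-y / 2) = 1 := by
    rw [← Real.exp_add, show y / 2 + -y / 2 = 0 by ring, Real.exp_zero]
  have hE2 : Real.exp y * Real.exp (-y) = 1 := by rw [← Real.exp_add]; simp
  have hE3 : Real.exp a * Real.exp (-a) = 1 := by rw [← Real.exp_add]; simp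
  have hl0 := ne_zero_of_eval_jost hl
  have hne : (Real.exp y - Real.exp a) * l ≠ 0 := mul_ne_zero (sub_pos.2 hexp).ne' hl0
  -- Both solutions vanish at `a`, so the factor `κ` is read off at a point `y` with no atoms in
  -- `(a, y)`. There each solution is affine in its own variable, and the values at `y` reduce to
  -- the slopes.
  have h5 : Real.exp a * (S.slope (Real.exp a)).eval l =
      -(l * (S.slope 0).eval l * (S.reflect.slope (Real.exp (-a))).eval l) := by
    refine mul_left_cancel₀ hne ?_
    have h6 := congrArg (Real.exp (y / 2) * ·) h4
    rw [← mul_assoc, hE', one_mul] at h6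
    generalize (S.slope 0).eval l = q₀ at *
    generalize (S.reflect.slope (Real.exp (-a))).eval l = q' at *
    generalize (S.slope (Real.exp a)).eval l = q at *
    generalize (S.jost (Real.exp y)).eval l = p at *
    have h7 : p = -(l * q₀ * (Real.exp y * ((Real.exp (-a) - Real.exp (-y)) * (l * q')))) := by
      rw [h6, ← hE]; ring
    rw [h7] at h1
    linear_combination Real.exp a * h1 + l * q₀ * l * q' * Real.exp a * hE2 -
      l * q₀ * l * q' * Real.exp y * hE3
  rw [norming_eq S hl]
  linear_combination (-(l * (derivative (S.jost 0)).eval l)) * h5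

end Pair

/-! ### The Green function at the interior point -/

section InteriorData

variable {S : Pair} {a : ℝ} {N : ℕ} {lam phi : Fin N → ℝ}

namespace Pair.IsInteriorData

theorem eval_jost_zero_iff (h : S.IsInteriorData a lam phi) {x : ℝ} :
    (S.jost 0).eval x = 0 ↔ ∃ i, x = lam i := by
  have h1 := (S.isEigenvalue_iff (x : ℂ)).symm.trans (h.2.1 x)
  have h2 : aeval (x : ℂ) (S.jost 0) = (((S.jost 0).eval x : ℝ) : ℂ) := by
    rw [← Complex.coe_algebraMap, aeval_algebraMap_apply, coe_aeval_eq_eval]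
  rw [h2, Complex.ofReal_eq_zero] at h1
  simpa using h1

theorem eval_jost_lam (h : S.IsInteriorData a lam phi) (i : Fin N) :
    (S.jost 0).eval (lam i) = 0 :=
  h.eval_jost_zero_iff.2 ⟨i, rfl⟩

theorem lam_ne_zero (h : S.IsInteriorData a lam phi) (i : Fin N) : lam i ≠ 0 :=
  Pair.ne_zero_of_eval_jost (h.eval_jost_lam i)

theorem roots_toFinset (h : S.IsInteriorData a lam phi) :
    (S.jost 0).roots.toFinset = Finset.univ.image lam := by
  ext x
  rw [(S.isStieltjesPair 0).mem_roots_toFinset, h.eval_jost_zero_iff]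
  simp [eq_comm]

theorem neg_mul_derivative_eq_prod (h : S.IsInteriorData a lam phi) (j : Fin N) :
    -(lam j * (derivative (S.jost 0)).eval (lam j)) =
      ∏ i ∈ Finset.univ.erase j, (1 - lam j / lam i) := by
  rw [(S.isStieltjesPair 0).derivative_eval_eq_prod (Pair.jost_eval_zero 0) (h.eval_jost_lam j),
    h.roots_toFinset, ← Finset.image_erase h.1.injective,
    Finset.prod_image fun i _ k _ hik => h.1.injective hik]

theorem derivative_ne_zero (h : S.IsInteriorData a lam phi) (j : Fin N) :
    (derivative (S.jost 0)).eval (lam j) ≠ 0 :=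
  (S.isStieltjesPair 0).derivative_ne_zero (h.eval_jost_lam j)

theorem norming_pos (h : S.IsInteriorData a lam phi) (j : Fin N) : 0 < S.norming (lam j) :=
  S.norming_pos (h.eval_jost_lam j)

theorem phi_mul_sqrt (h : S.IsInteriorData a lam phi) (j : Fin N) :
    phi j * √(S.norming (lam j)) = Real.exp (-a / 2) * (S.jost (Real.exp a)).eval (lam j) := by
  rw [h.2.2 j, Pair.phiPlus_real, div_mul_cancel₀ _ (Real.sqrt_pos.2 (h.norming_pos j)).ne']

theorem phi_eq_zero_iff (h : S.IsInteriorData a lam phi) (j : Fin N) :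
    phi j = 0 ↔ (S.jost (Real.exp a)).eval (lam j) = 0 := by
  have h1 := h.phi_mul_sqrt j
  have h2 := (Real.sqrt_pos.2 (h.norming_pos j)).ne'
  constructor
  · intro h0
    rw [h0, zero_mul, eq_comm, mul_eq_zero, or_iff_right (Real.exp_ne_zero _)] at h1
    exact h1
  · intro h0
    rw [h0, mul_zero, mul_eq_zero, or_iff_left h2] at h1
    exact h1

theorem phi_eq_zero_iff_reflect (h : S.IsInteriorData a lam phi) (j : Fin N) :
    phi j = 0 ↔ (S.reflect.jost (Real.exp (-a))).eval (lam j) = 0 :=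
  (h.phi_eq_zero_iff j).trans (Pair.eval_jost_eq_zero_iff_reflect (h.eval_jost_lam j) a)

/-- The products `φ_i φ_j` have the sign of the products of the values of `φ₊(·, a)`. -/
theorem exists_phi_mul_phi (h : S.IsInteriorData a lam phi) (i j : Fin N) : ∃ c : ℝ, 0 < c ∧
    (S.jost (Real.exp a)).eval (lam i) * (S.jost (Real.exp a)).eval (lam j) =
      c * (phi i * phi j) := by
  have hE : Real.exp a * (Real.exp (-a / 2) * Real.exp (-a / 2)) = 1 := by
    rw [← Real.exp_add, ← Real.exp_add, show a + (-a / 2 + -a / 2) = 0 by ring, Real.exp_zero]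
  refine ⟨Real.exp a * (√(S.norming (lam i)) * √(S.norming (lam j))), ?_, ?_⟩
  · exact mul_pos (Real.exp_pos a) (mul_pos (Real.sqrt_pos.2 (h.norming_pos i))
      (Real.sqrt_pos.2 (h.norming_pos j)))
  · have h1 := h.phi_mul_sqrt i
    have h2 := h.phi_mul_sqrt j
    have : Real.exp a * (√(S.norming (lam i)) * √(S.norming (lam j))) * (phi i * phi j) =
        Real.exp a * ((phi i * √(S.norming (lam i))) * (phi j * √(S.norming (lam j)))) := by ring
    rw [this, h1, h2]
    linear_combination (-((S.jost (Real.exp a)).eval (lam i) *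
      (S.jost (Real.exp a)).eval (lam j))) * hE

/-- The residues of the Green function. -/
theorem eval_mul_reflect (h : S.IsInteriorData a lam phi) (j : Fin N) :
    (S.jost (Real.exp a)).eval (lam j) * (S.reflect.jost (Real.exp (-a))).eval (lam j) =
      -(lam j * (derivative (S.jost 0)).eval (lam j)) * phi j ^ 2 := by
  have hn := h.norming_pos j
  have h1 := h.phi_mul_sqrt j
  have h2 := Pair.norming_mul_reflect_jost (h.eval_jost_lam j) a
  have hE : Real.exp a * (Real.exp (-a / 2) * Real.exp (-a / 2)) = 1 := by
    rw [← Real.exp_add, ← Real.exp_add, show a + (-a / 2 + -a / 2) = 0 by ring, Real.exp_zero]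
  have h3 : phi j ^ 2 * S.norming (lam j) = Real.exp (-a / 2) * Real.exp (-a / 2) *
      (S.jost (Real.exp a)).eval (lam j) ^ 2 := by
    have : phi j ^ 2 * S.norming (lam j) = (phi j * √(S.norming (lam j))) ^ 2 := by
      rw [mul_pow, Real.sq_sqrt hn.le]
    rw [this, h1]; ring
  have hne : S.norming (lam j) * Real.exp a ≠ 0 := mul_ne_zero hn.ne' (Real.exp_ne_zero a)
  refine mul_left_cancel₀ hne ?_
  generalize (S.jost (Real.exp a)).eval (lam j) = p at *
  generalize lam j * (derivative (S.jost 0)).eval (lam j) = d at *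
  linear_combination p * h2 + (d * Real.exp a) * h3 + (d * p ^ 2) * hE

end Pair.IsInteriorData

/-- Each term increases between its poles. Eigenvalues with `φ_j = 0` are not poles, so the interval
may touch or contain them; this is needed to compare with the value at such an eigenvalue. -/
theorem greenSum_lt_greenSum (hlam : ∀ j, lam j ≠ 0) {s t : ℝ} (hst : s < t)
    (hpole : ∀ j, phi j ≠ 0 → lam j < s ∨ t < lam j) (hne : ∃ j, phi j ≠ 0) :
    greenSum lam phi s < greenSum lam phi t := by
  have key : ∀ j, phi j ≠ 0 → lam j ^ 2 * |phi j| ^ 2 / (lam j - s) <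
      lam j ^ 2 * |phi j| ^ 2 / (lam j - t) := fun j hj => by
    have h0 : 0 < lam j ^ 2 * |phi j| ^ 2 := by
      have := hlam j
      positivity
    have hd : 0 < (lam j - s) * (lam j - t) := by
      rcases hpole j hj with h | h
      · exact mul_pos_of_neg_of_neg (by linarith) (by linarith)
      · exact mul_pos (by linarith) (by linarith)
    have h1 : lam j - s ≠ 0 := left_ne_zero_of_mul hd.ne'
    have h2 : lam j - t ≠ 0 := right_ne_zero_of_mul hd.ne'
    have h3 : lam j ^ 2 * |phi j| ^ 2 / (lam j - t) - lam j ^ 2 * |phi j| ^ 2 / (lam j - s) =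
        lam j ^ 2 * |phi j| ^ 2 * (t - s) / ((lam j - s) * (lam j - t)) := by
      field_simp
      ring
    have h4 : 0 < lam j ^ 2 * |phi j| ^ 2 * (t - s) / ((lam j - s) * (lam j - t)) :=
      div_pos (mul_pos h0 (by linarith)) hd
    linarith
  obtain ⟨j, hj⟩ := hne
  refine Finset.sum_lt_sum (fun i _ => ?_) ⟨j, Finset.mem_univ j, key j hj⟩
  by_cases hi : phi i = 0
  · simp [hi]
  · exact (key i hi).le

theorem exists_phi_ne_zero (halpha : alphaCoeff phi = 0) : ∃ j, phi j ≠ 0 := by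
  by_contra! h
  simp [alphaCoeff, h] at halpha

namespace Pair.IsInteriorData

/-- The Green function at `a` is `∑ λ_j φ_j² / (λ_j - z)`. -/
theorem X_mul_jost_mul_reflect (h : S.IsInteriorData a lam phi) (halpha : alphaCoeff phi = 0)
    (hbeta : betaCoeff lam phi = 0) :
    X * (S.jost (Real.exp a) * S.reflect.jost (Real.exp (-a))) =
      ∑ j, C (-(lam j ^ 2 * phi j ^ 2)) * (S.jost 0 /ₘ (X - C (lam j))) := by
  have hdeg := S.natDegree_mul_reflect_le a
  have hPP := h.eval_mul_reflect
  have h0 : (S.jost (Real.exp a) * S.reflect.jost (Real.exp (-a))).eval 0 = 1 := by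
    rw [eval_mul, Pair.jost_eval_zero, Pair.jost_eval_zero, one_mul]
  set G := S.jost (Real.exp a) * S.reflect.jost (Real.exp (-a)) with hG
  have hW := S.isStieltjesPair 0
  have hW0 : (S.jost 0).eval 0 = 1 := Pair.jost_eval_zero 0
  have hfac : ∀ j, (X - C (lam j)) * (S.jost 0 /ₘ (X - C (lam j))) = S.jost 0 := fun j =>
    mul_divByMonic_eq_iff_isRoot.2 (h.eval_jost_lam j)
  set W := S.jost 0 with hWdef
  set E : ℝ[X] := ∑ j, C (-(lam j ^ 2 * phi j ^ 2)) * (W /ₘ (X - C (lam j))) with hE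
  have hEeval : ∀ i, E.eval (lam i) = -(lam i ^ 2 * phi i ^ 2) * (derivative W).eval (lam i) :=
    fun i => by
      rw [hE, eval_finsetSum, Finset.sum_eq_single i]
      · rw [eval_mul, eval_C, eval_divByMonic_of_root (h.eval_jost_lam i)]
      · intro j _ hji
        rw [eval_mul, eval_divByMonic_of_ne (h.eval_jost_lam j) (h.eval_jost_lam i)
          fun h' => hji (h.1.injective h').symm, mul_zero]
      · exact fun hn => absurd (Finset.mem_univ i) hn
  -- The residues agree, so the difference vanishes at all zeros of `W`, which are simple.
  have hdvd : W ∣ X * G - E := by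
    rcases eq_or_ne (X * G - E) 0 with h1 | h1
    · rw [h1]; exact dvd_zero _
    refine hW.splits.dvd_of_roots_le_roots hW.ne_zero ?_
    rw [Multiset.le_iff_subset hW.nodup_roots]
    intro x hx
    rw [mem_roots hW.ne_zero] at hx
    obtain ⟨i, rfl⟩ := h.eval_jost_zero_iff.1 hx
    rw [mem_roots h1, IsRoot, eval_sub, hEeval, eval_mul, eval_X, hG, eval_mul, hPP i]
    ring
  obtain ⟨R, hR⟩ := hdvd
  -- The Green function is bounded at infinity, so the factor `X` leaves at most a linear quotient.
  have hRdeg : R.natDegree ≤ 1 := by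
    rcases eq_or_ne R 0 with rfl | hR0
    · simp
    have h1 : (X * G - E).natDegree ≤ W.natDegree + 1 := by
      refine (natDegree_sub_le _ _).trans (max_le ?_ ?_)
      · refine natDegree_mul_le.trans ?_
        rw [natDegree_X]; omega
      · refine natDegree_sum_le_of_forall_le _ _ fun j _ => ?_
        refine (natDegree_C_mul_le _ _).trans ?_
        rw [natDegree_divByMonic _ (monic_X_sub_C _)]; omega
    rw [hR, natDegree_mul hW.ne_zero hR0] at h1
    omega
  have hb : ∑ j, lam j * phi j ^ 2 = 0 := by
    simpa [betaCoeff] using hbeta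
  have ha : ∑ j, phi j ^ 2 = 1 := by
    have : (1 : ℝ) - ∑ j, phi j ^ 2 = 0 := by simpa [alphaCoeff] using halpha
    linarith
  have hq0 : ∀ j, (W /ₘ (X - C (lam j))).eval 0 = -(lam j)⁻¹ := fun j => by
    have h1 := congrArg (eval 0) (hfac j)
    have h2 := h.lam_ne_zero j
    rw [eval_mul, hW0] at h1
    simp only [eval_sub, eval_X, eval_C, zero_sub] at h1
    field_simp
    linarith
  have hq1 : ∀ j, (derivative (W /ₘ (X - C (lam j)))).eval 0 =
      -((lam j)⁻¹ ^ 2 + (derivative W).eval 0 * (lam j)⁻¹) := fun j => by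
    have h1 := congrArg (fun p => (derivative p).eval 0) (hfac j)
    have h2 := h.lam_ne_zero j
    simp only [derivative_mul, derivative_sub, derivative_X, derivative_C, sub_zero, one_mul,
      eval_add, eval_mul, eval_sub, eval_X, eval_C, zero_sub, hq0] at h1
    rw [← h1]
    field_simp
    ring
  have hE0 : E.eval 0 = 0 := by
    rw [hE, eval_finsetSum]
    refine Eq.trans ?_ hb
    refine Finset.sum_congr rfl fun j _ => ?_
    have h2 := h.lam_ne_zero j
    rw [eval_mul, eval_C, hq0]
    field_simp
  have hE1 : (derivative E).eval 0 = 1 := by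
    have h1 : (derivative E).eval 0 = ∑ j, (phi j ^ 2 + (derivative W).eval 0 *
        (lam j * phi j ^ 2)) := by
      rw [hE, derivative_sum, eval_finsetSum]
      refine Finset.sum_congr rfl fun j _ => ?_
      have h2 := h.lam_ne_zero j
      rw [derivative_C_mul, eval_mul, eval_C, hq1]
      field_simp
    rw [h1, Finset.sum_add_distrib, ← Finset.mul_sum, ha, hb]
    ring
  -- In general the quotient is `α X + β`: the value at `0` gives `β`, and the derivative at `0`
  -- then gives `α`. Both are zero by assumption.
  obtain ⟨r₁, r₀, rfl⟩ := exists_eq_X_add_C_of_natDegree_le_one hRdeg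
  have h1 := congrArg (eval 0) hR
  have h2 := congrArg (fun p => (derivative p).eval 0) hR
  simp only [eval_sub, eval_mul, eval_add, eval_X, eval_C, hE0, hW0, zero_mul, mul_zero, sub_zero,
    zero_add, one_mul] at h1
  simp only [derivative_sub, derivative_mul, derivative_add, derivative_X, derivative_C, eval_sub,
    eval_mul, eval_add, eval_X, eval_C, hE1, hW0, h0, zero_mul, mul_zero, zero_add, one_mul,
    add_zero, mul_one] at h2
  rw [← h1] at h2
  have h3 : r₁ = 0 := by linarith
  rw [← h1, h3] at hR
  simp only [C_0, zero_mul, add_zero, mul_zero] at hR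
  exact sub_eq_zero.1 hR

theorem greenSum_mul_eval_jost (h : S.IsInteriorData a lam phi) (halpha : alphaCoeff phi = 0)
    (hbeta : betaCoeff lam phi = 0) {z : ℝ} (hz : ∀ j, z ≠ lam j) :
    greenSum lam phi z * (S.jost 0).eval z =
      z * ((S.jost (Real.exp a)).eval z * (S.reflect.jost (Real.exp (-a))).eval z) := by
  have h1 := congrArg (eval z) (h.X_mul_jost_mul_reflect halpha hbeta)
  rw [eval_mul, eval_X, eval_mul, eval_finsetSum] at h1
  rw [h1, greenSum, Finset.sum_mul]
  refine Finset.sum_congr rfl fun j _ => ?_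
  have h2 := congrArg (eval z) (mul_divByMonic_eq_iff_isRoot.2 (h.eval_jost_lam j))
  have h3 : lam j - z ≠ 0 := sub_ne_zero.2 (hz j).symm
  rw [eval_mul, eval_sub, eval_X, eval_C] at h2
  rw [← h2, eval_mul, eval_C, sq_abs]
  field_simp
  ring

/-- Both Jost solutions vanish at `λ_i`, so their product has a double zero while `W` has a simple
one. The term of `i` itself is `0 / 0 = 0` by convention, so the remaining sum is the true value of
`G` there. -/
theorem greenSum_lam_eq_zero (h : S.IsInteriorData a lam phi) (halpha : alphaCoeff phi = 0)
    (hbeta : betaCoeff lam phi = 0) {i : Fin N} (hi : phi i = 0) :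
    greenSum lam phi (lam i) = 0 := by
  have h1 := congrArg (fun p => (derivative p).eval (lam i))
    (h.X_mul_jost_mul_reflect halpha hbeta)
  simp only [derivative_mul, eval_add, eval_mul, (h.phi_eq_zero_iff i).1 hi,
    (h.phi_eq_zero_iff_reflect i).1 hi, mul_zero, zero_mul, add_zero, derivative_sum,
    eval_finsetSum, derivative_C, eval_C, zero_add] at h1
  have hd := h.derivative_ne_zero i
  have h2 : greenSum lam phi (lam i) * (derivative (S.jost 0)).eval (lam i) = 0 := by
    rw [greenSum, Finset.sum_mul]
    refine Eq.trans ?_ h1.symm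
    refine Finset.sum_congr rfl fun j _ => ?_
    rcases eq_or_ne j i with rfl | hji
    · simp [hi]
    have hne : lam j - lam i ≠ 0 := sub_ne_zero.2 fun h' => hji (h.1.injective h')
    have h3 := congrArg (fun p => (derivative p).eval (lam i))
      (mul_divByMonic_eq_iff_isRoot.2 (h.eval_jost_lam j))
    have h4 := eval_divByMonic_of_ne (h.eval_jost_lam j) (h.eval_jost_lam i)
      fun h' => hji (h.1.injective h').symm
    simp only [derivative_mul, derivative_sub, derivative_X, derivative_C, sub_zero, one_mul,
      eval_add, eval_mul, eval_sub, eval_X, eval_C, h4, zero_add] at h3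
    rw [← h3, sq_abs]
    field_simp
    ring
  exact (mul_eq_zero.1 h2).resolve_right hd

end Pair.IsInteriorData

/-! ### Zeros of the Jost solutions at `a` -/

theorem exists_consecutive {μ : ℝ} (hlam : StrictMono lam) (hne : ∀ i, μ ≠ lam i)
    (hlow : ∃ i, lam i < μ) (hup : ∃ i, μ < lam i) :
    ∃ i j : Fin N, (i : ℕ) + 1 = j ∧ lam i < μ ∧ μ < lam j := by
  classical
  obtain ⟨i₀, hi₀⟩ := hlow
  obtain ⟨j₀, hj₀⟩ := hup
  obtain ⟨i, hi, hmax⟩ := Finset.exists_max_image (Finset.univ.filter fun i => lam i < μ) id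
    ⟨i₀, by simpa using hi₀⟩
  have hiμ : lam i < μ := (Finset.mem_filter.1 hi).2
  have hij₀ : i < j₀ := hlam.lt_iff_lt.1 (hiμ.trans hj₀)
  have hlt : (i : ℕ) + 1 < N := lt_of_le_of_lt hij₀ j₀.2
  refine ⟨i, ⟨i + 1, hlt⟩, rfl, hiμ, lt_of_le_of_ne (not_lt.1 fun h => ?_) (hne _)⟩
  have h1 : (⟨i + 1, hlt⟩ : Fin N) ≤ i := hmax _ (by simpa using h)
  have h2 : (i : ℕ) + 1 ≤ i := h1
  omega

theorem ne_lam_of_consecutive {i j : Fin N} {μ : ℝ} (hlam : StrictMono lam)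
    (hij : (i : ℕ) + 1 = j) (hi : lam i < μ) (hj : μ < lam j) (k : Fin N) : μ ≠ lam k := by
  rintro rfl
  have h1 : (i : ℕ) < k := hlam.lt_iff_lt.1 hi
  have h2 : (k : ℕ) < j := hlam.lt_iff_lt.1 hj
  omega

theorem pole_of_consecutive {i j : Fin N} {s t : ℝ} (hlam : StrictMono lam)
    (hij : (i : ℕ) + 1 = j) (hi : lam i < s) (hj : t < lam j) (k : Fin N) :
    lam k < s ∨ t < lam k := by
  rcases le_or_gt k i with h | h
  · exact Or.inl ((hlam.monotone h).trans_lt hi)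
  · have : j ≤ k := by
      have h' : (i : ℕ) < k := h
      exact Fin.le_def.2 (by omega)
    exact Or.inr (hj.trans_le (hlam.monotone this))

theorem exists_root_of_mul_neg (P : ℝ[X]) {s t : ℝ} (hst : s < t)
    (h : P.eval s * P.eval t < 0) : ∃ x ∈ Set.Ioo s t, P.eval x = 0 := by
  have hc : ContinuousOn (fun x => P.eval x) (Set.Icc s t) := P.continuous.continuousOn
  rcases mul_neg_iff.1 h with ⟨h1, h2⟩ | ⟨h1, h2⟩
  · obtain ⟨x, hx, hx0⟩ := intermediate_value_Ioo' hst.le hc ⟨h2, h1⟩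
    exact ⟨x, hx, hx0⟩
  · obtain ⟨x, hx, hx0⟩ := intermediate_value_Ioo hst.le hc ⟨h1, h2⟩
    exact ⟨x, hx, hx0⟩

/-- Every term of the Wronskian contains one of the two solutions at `a`. -/
theorem Pair.eval_jost_zero_of_common_zero (S : Pair) {a z : ℝ}
    (h1 : (S.jost (Real.exp a)).eval z = 0)
    (h2 : (S.reflect.jost (Real.exp (-a))).eval z = 0) : (S.jost 0).eval z = 0 := by
  rw [← S.wronskian_eq a]
  simp [h1, h2]

namespace Pair.IsInteriorData

/-- In the interval between two consecutive eigenvalues, a nonzero zero of the Green function is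
a zero of exactly one of the Jost solutions, and it is the only one. -/
theorem zeros_of_greenSum (h : S.IsInteriorData a lam phi) (halpha : alphaCoeff phi = 0)
    (hbeta : betaCoeff lam phi = 0) {i j : Fin N} {μ : ℝ} (hij : (i : ℕ) + 1 = j) (hi : lam i < μ)
    (hj : μ < lam j) (hμ0 : μ ≠ 0) (hμ : greenSum lam phi μ = 0) :
    (phi i * phi j < 0 → (S.jost (Real.exp a)).eval μ = 0 ∧
      (S.reflect.jost (Real.exp (-a))).eval μ ≠ 0) ∧
    (0 < phi i * phi j → (S.reflect.jost (Real.exp (-a))).eval μ = 0 ∧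
      (S.jost (Real.exp a)).eval μ ≠ 0) := by
  have hne := ne_lam_of_consecutive h.1 hij hi hj
  have hW : (S.jost 0).eval μ ≠ 0 := fun h0 => by
    obtain ⟨k, hk⟩ := h.eval_jost_zero_iff.1 h0
    exact hne k hk
  have hprod := h.greenSum_mul_eval_jost halpha hbeta hne
  -- `G(0) = -β = 0` comes from the factor `z`, not from a zero of a Jost solution; hence the
  -- exclusion of `0`.
  rw [hμ, zero_mul, eq_comm, mul_eq_zero, or_iff_right hμ0, mul_eq_zero] at hprod
  have hnot : ¬((S.jost (Real.exp a)).eval μ = 0 ∧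
      (S.reflect.jost (Real.exp (-a))).eval μ = 0) := fun h0 =>
    hW (S.eval_jost_zero_of_common_zero h0.1 h0.2)
  -- A zero of `φ₊(·, a)` in the interval is a zero of `G`, and `G` is strictly increasing there.
  have huniq : ∀ ν ∈ Set.Ioo (lam i) (lam j), (S.jost (Real.exp a)).eval ν = 0 → ν = μ := by
    intro ν hν h0
    have hneν := ne_lam_of_consecutive h.1 hij hν.1 hν.2
    have h1 := h.greenSum_mul_eval_jost halpha hbeta hneν
    rw [h0, zero_mul, mul_zero, mul_eq_zero] at h1
    have h2 : greenSum lam phi ν = 0 := h1.resolve_right fun h0 => by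
      obtain ⟨k, hk⟩ := h.eval_jost_zero_iff.1 h0
      exact hneν k hk
    by_contra hνμ
    rcases lt_or_gt_of_ne hνμ with hlt | hlt
    · have := greenSum_lt_greenSum (phi := phi) h.lam_ne_zero hlt
        (fun k _ => pole_of_consecutive h.1 hij hν.1 hj k) (exists_phi_ne_zero halpha)
      linarith
    · have := greenSum_lt_greenSum (phi := phi) h.lam_ne_zero hlt
        (fun k _ => pole_of_consecutive h.1 hij hi hν.2 k) (exists_phi_ne_zero halpha)
      linarith
  obtain ⟨c, hc, hsign⟩ := h.exists_phi_mul_phi i j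
  refine ⟨fun hneg => ?_, fun hpos => ?_⟩
  · obtain ⟨ν, hν, hν0⟩ := exists_root_of_mul_neg (S.jost (Real.exp a)) (hi.trans hj)
      (by rw [hsign]; exact mul_neg_of_pos_of_neg hc hneg)
    rw [huniq ν hν hν0] at hν0
    exact ⟨hν0, fun h1 => hnot ⟨hν0, h1⟩⟩
  -- With equal signs at the ends, a zero at `μ` makes the cofactor of `X - μ` change sign. Its zero
  -- is either another zero of `φ₊(·, a)`, against uniqueness, or `μ` again, against simplicity.
  · have hPμ : (S.jost (Real.exp a)).eval μ ≠ 0 := by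
      intro h0
      have hd := (S.isStieltjesPair (Real.exp a)).derivative_ne_zero h0
      have hfac := mul_divByMonic_eq_iff_isRoot.2 h0
      rw [← eval_divByMonic_of_root h0] at hd
      set R := S.jost (Real.exp a) /ₘ (X - C μ)
      have hev : ∀ x, (S.jost (Real.exp a)).eval x = (x - μ) * R.eval x := fun x => by
        rw [← hfac]; simp
      have h1 : 0 < (S.jost (Real.exp a)).eval (lam i) * (S.jost (Real.exp a)).eval (lam j) := by
        rw [hsign]; exact mul_pos hc hpos
      rw [hev, hev] at h1
      have h2 : (lam i - μ) * (lam j - μ) < 0 :=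
        mul_neg_of_neg_of_pos (by linarith) (by linarith)
      have h3 : R.eval (lam i) * R.eval (lam j) < 0 := by
        by_contra hge
        have := mul_nonpos_of_nonpos_of_nonneg h2.le (not_lt.1 hge)
        linarith
      obtain ⟨ν, hν, hν0⟩ := exists_root_of_mul_neg R (hi.trans hj) h3
      have := huniq ν hν (by rw [hev, hν0, mul_zero])
      rw [this] at hν0
      exact hd hν0
    exact ⟨hprod.resolve_left hPμ, hPμ⟩

/-- A zero of exactly one of the Jost solutions at `a` lies between two consecutive eigenvalues
whose eigenfunctions do not vanish at `a`. -/
theorem exists_consecutive_of_zero (h : S.IsInteriorData a lam phi) (halpha : alphaCoeff phi = 0)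
    (hbeta : betaCoeff lam phi = 0) {μ : ℝ}
    (h0 : (S.jost (Real.exp a)).eval μ * (S.reflect.jost (Real.exp (-a))).eval μ = 0)
    (hnot : ¬((S.jost (Real.exp a)).eval μ = 0 ∧
      (S.reflect.jost (Real.exp (-a))).eval μ = 0)) :
    μ ≠ 0 ∧ greenSum lam phi μ = 0 ∧ ∃ i j : Fin N, (i : ℕ) + 1 = j ∧ lam i < μ ∧ μ < lam j ∧
      phi i * phi j ≠ 0 := by
  have hμ0 : μ ≠ 0 := by
    rintro rfl
    simp [Pair.jost_eval_zero] at h0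
  have hW : (S.jost 0).eval μ ≠ 0 := fun hW => by
    have := Pair.eval_jost_eq_zero_iff_reflect hW a
    rcases mul_eq_zero.1 h0 with h1 | h1
    · exact hnot ⟨h1, this.1 h1⟩
    · exact hnot ⟨this.2 h1, h1⟩
  have hne : ∀ k, μ ≠ lam k := fun k hk => hW (h.eval_jost_zero_iff.2 ⟨k, hk⟩)
  have hg : greenSum lam phi μ = 0 := by
    have := h.greenSum_mul_eval_jost halpha hbeta hne
    rw [h0, mul_zero] at this
    exact (mul_eq_zero.1 this).resolve_right hW
  refine ⟨hμ0, hg, ?_⟩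
  obtain ⟨k, hk⟩ := exists_phi_ne_zero halpha
  have hterm : ∀ i, phi i ≠ 0 → 0 < lam i ^ 2 * |phi i| ^ 2 := fun i hi => by
    have := h.lam_ne_zero i
    positivity
  -- Outside the range of the eigenvalues all terms of `G` have the same sign, so `G` has no zero
  -- there.
  have hlow : ∃ i, lam i < μ := by
    by_contra! hall
    have : 0 < greenSum lam phi μ := by
      refine Finset.sum_pos' (fun i _ => ?_) ⟨k, Finset.mem_univ k, ?_⟩
      · exact div_nonneg (by positivity) (by linarith [hall i])
      · exact div_pos (hterm k hk) (sub_pos.2 (lt_of_le_of_ne (hall k) (hne k)))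
    linarith
  have hup : ∃ i, μ < lam i := by
    by_contra! hall
    have : greenSum lam phi μ < 0 := by
      refine Finset.sum_neg' (fun i _ => ?_) ⟨k, Finset.mem_univ k, ?_⟩
      · exact div_nonpos_of_nonneg_of_nonpos (by positivity) (by linarith [hall i])
      · exact div_neg_of_pos_of_neg (hterm k hk)
          (sub_neg.2 (lt_of_le_of_ne (hall k) (hne k).symm))
    linarith
  obtain ⟨i, j, hij, hi, hj⟩ := exists_consecutive h.1 hne hlow hup
  refine ⟨i, j, hij, hi, hj, mul_ne_zero (fun hphi => ?_) fun hphi => ?_⟩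
  -- If `φ_i = 0`, then `G` vanishes at `λ_i` as well as at `μ` and has no pole between them,
  -- against strict monotonicity. The right end is treated in the same way.
  · have h1 := h.greenSum_lam_eq_zero halpha hbeta hphi
    have := greenSum_lt_greenSum (phi := phi) h.lam_ne_zero hi (fun m hm => ?_) ⟨k, hk⟩
    · linarith
    · rcases pole_of_consecutive h.1 hij hi hj m with h2 | h2
      · refine Or.inl (h.1.lt_iff_lt.2 (lt_of_le_of_ne (not_lt.1 fun h3 => ?_) fun h3 => hm (h3 ▸ hphi)))
        have h4 := h.1.lt_iff_lt.1 (h2.trans hj)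
        have h5 : (i : ℕ) < m := h3
        have h6 : (m : ℕ) < j := h4
        omega
      · exact Or.inr h2
  · have h1 := h.greenSum_lam_eq_zero halpha hbeta hphi
    have := greenSum_lt_greenSum (phi := phi) h.lam_ne_zero hj (fun m hm => ?_) ⟨k, hk⟩
    · linarith
    · rcases pole_of_consecutive h.1 hij hi hj m with h2 | h2
      · exact Or.inl h2
      · refine Or.inr (h.1.lt_iff_lt.2 (lt_of_le_of_ne (not_lt.1 fun h3 => ?_)
          fun h3 => hm (h3 ▸ hphi)))
        have h4 := h.1.lt_iff_lt.1 (hi.trans h2)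
        have h5 : (m : ℕ) < j := h3
        have h6 : (i : ℕ) < m := h4
        omega

theorem zero_phiPlus_iff (h : S.IsInteriorData a lam phi) (halpha : alphaCoeff phi = 0)
    (hbeta : betaCoeff lam phi = 0) (μ : ℝ) :
    (μ ≠ 0 ∧ greenSum lam phi μ = 0 ∧
      ∃ i j : Fin N, (i : ℕ) + 1 = j ∧ lam i < μ ∧ μ < lam j ∧ phi i * phi j < 0) ↔
    (S.jost (Real.exp a)).eval μ = 0 ∧ (S.reflect.jost (Real.exp (-a))).eval μ ≠ 0 := by
  constructor
  · rintro ⟨h0, hg, i, j, hij, hi, hj, hs⟩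
    exact (h.zeros_of_greenSum halpha hbeta hij hi hj h0 hg).1 hs
  · rintro ⟨h1, h2⟩
    obtain ⟨h0, hg, i, j, hij, hi, hj, hs⟩ :=
      h.exists_consecutive_of_zero halpha hbeta (by rw [h1, zero_mul]) fun h3 => h2 h3.2
    refine ⟨h0, hg, i, j, hij, hi, hj, lt_of_le_of_ne (not_lt.1 fun hpos => ?_) hs⟩
    exact ((h.zeros_of_greenSum halpha hbeta hij hi hj h0 hg).2 hpos).2 h1

theorem zero_phiMinus_iff (h : S.IsInteriorData a lam phi) (halpha : alphaCoeff phi = 0)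
    (hbeta : betaCoeff lam phi = 0) (μ : ℝ) :
    (μ ≠ 0 ∧ greenSum lam phi μ = 0 ∧
      ∃ i j : Fin N, (i : ℕ) + 1 = j ∧ lam i < μ ∧ μ < lam j ∧ 0 < phi i * phi j) ↔
    (S.reflect.jost (Real.exp (-a))).eval μ = 0 ∧ (S.jost (Real.exp a)).eval μ ≠ 0 := by
  constructor
  · rintro ⟨h0, hg, i, j, hij, hi, hj, hs⟩
    exact (h.zeros_of_greenSum halpha hbeta hij hi hj h0 hg).2 hs
  · rintro ⟨h1, h2⟩
    obtain ⟨h0, hg, i, j, hij, hi, hj, hs⟩ :=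
      h.exists_consecutive_of_zero halpha hbeta (by rw [h1, mul_zero]) fun h3 => h2 h3.1
    refine ⟨h0, hg, i, j, hij, hi, hj, lt_of_le_of_ne (not_lt.1 fun hneg => ?_) hs.symm⟩
    exact ((h.zeros_of_greenSum halpha hbeta hij hi hj h0 hg).1 hneg).2 h1

/-! ### The norming constants -/

/-- The norming constants of the eigenvalues whose eigenfunctions do not vanish at `a`. -/
theorem norming_eq_prod (h : S.IsInteriorData a lam phi) {B C : Finset ℝ}
    (hB : ∀ μ, μ ∈ B ↔ (S.jost (Real.exp a)).eval μ = 0 ∧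
      (S.reflect.jost (Real.exp (-a))).eval μ ≠ 0)
    (hC : ∀ μ, μ ∈ C ↔ (S.reflect.jost (Real.exp (-a))).eval μ = 0 ∧
      (S.jost (Real.exp a)).eval μ ≠ 0) {j : Fin N} (hj : phi j ≠ 0) :
    S.norming (lam j) = Real.exp (-a) * (∏ i ∈ Finset.univ.erase j, (1 - lam j / lam i)) *
      (∏ μ ∈ B, (1 - lam j / μ)) * (∏ ν ∈ C, (1 - lam j / ν))⁻¹ := by
  have h1 := norming_mul_reflect_jost (h.eval_jost_lam j) a
  rw [h.neg_mul_derivative_eq_prod j] at h1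
  have hP' : (S.reflect.jost (Real.exp (-a))).eval (lam j) ≠ 0 := fun h0 =>
    hj ((h.phi_eq_zero_iff_reflect j).2 h0)
  have hSP := S.isStieltjesPair (Real.exp a)
  have hSP' := S.reflect.isStieltjesPair (Real.exp (-a))
  have e1 := hSP.eval_eq_prod (jost_eval_zero _) (lam j)
  have e2 := hSP'.eval_eq_prod (jost_eval_zero _) (lam j)
  set s := (S.jost (Real.exp a)).roots.toFinset with hs
  set t := (S.reflect.jost (Real.exp (-a))).roots.toFinset with ht
  have hB' : B = s \ t := by
    ext x
    rw [hB, Finset.mem_sdiff, hSP.mem_roots_toFinset, hSP'.mem_roots_toFinset]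
  have hC' : C = t \ s := by
    ext x
    rw [hC, Finset.mem_sdiff, hSP.mem_roots_toFinset, hSP'.mem_roots_toFinset]
  -- The common zeros contribute the same factor to both values; it is nonzero because `φ_j ≠ 0`,
  -- and it cancels.
  rw [← Finset.prod_inter_mul_prod_sdiff s t, ← hB'] at e1
  rw [← Finset.prod_inter_mul_prod_sdiff t s, ← hC', Finset.inter_comm] at e2
  have hE : Real.exp a * Real.exp (-a) = 1 := by rw [← Real.exp_add]; simp
  rw [e1, e2] at h1
  rw [e2] at hP'
  have hI := left_ne_zero_of_mul hP'
  have hCne := right_ne_zero_of_mul hP'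
  generalize ∏ x ∈ s ∩ t, (1 - lam j / x) = p at *
  generalize ∏ x ∈ B, (1 - lam j / x) = b at *
  generalize ∏ x ∈ C, (1 - lam j / x) = c at *
  rw [eq_mul_inv_iff_mul_eq₀ hCne]
  refine mul_left_cancel₀ hI ?_
  linear_combination Real.exp (-a) * h1 - S.norming (lam j) * p * c * hE

end Pair.IsInteriorData

/-! ### Transfer of mass between the half-lines -/

/-- Redistributing the mass of a common pole between the two half-lines. -/
theorem exists_mass_transfer {n c e r r' : ℝ} (hn : 0 < n) (hc : 0 < c) (he : 0 < e) (hr : 0 < r)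
    (hr' : 0 < r') :
    ∃ ε, 0 < r + ε ∧ 0 < r' + -(e * ε) ∧ c * ((r' + -(e * ε)) * r) = n * (r' * (r + ε)) := by
  have hD : 0 < n * r' + c * e * r := by positivity
  have h1 : r + r * r' * (c - n) / (n * r' + c * e * r) =
      c * (r * (e * r + r')) / (n * r' + c * e * r) := by
    field_simp; ring
  have h2 : r' + -(e * (r * r' * (c - n) / (n * r' + c * e * r))) =
      n * (r' * (e * r + r')) / (n * r' + c * e * r) := by
    field_simp; ring
  -- The required identity is linear in `ε`, and this is its solution. Replacing `n` by `c`
  -- multiplies the ratio `r / r'` by `c / n`.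
  refine ⟨r * r' * (c - n) / (n * r' + c * e * r), ?_, ?_, ?_⟩
  · rw [h1]; positivity
  · rw [h2]; positivity
  · rw [h1, h2]; ring

/-- Redistributing the masses of common poles of the two Weyl functions at `a`. -/
theorem Pair.exists_transfer (S : Pair) (a : ℝ) {s : Finset ℝ} {ε : ℝ → ℝ}
    (hs : ∀ x ∈ s, (S.jost (Real.exp a)).eval x = 0)
    (hs' : ∀ x ∈ s, (S.reflect.jost (Real.exp (-a))).eval x = 0)
    (hε : ∀ x ∈ s, 0 < -((S.slope (Real.exp a)).eval x /
      (derivative (S.jost (Real.exp a))).eval x) + ε x)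
    (hε' : ∀ x ∈ s, 0 < -((S.reflect.slope (Real.exp (-a))).eval x /
      (derivative (S.reflect.jost (Real.exp (-a)))).eval x) + -(Real.exp a ^ 2 * ε x)) :
    ∃ T : Pair, T.jost (Real.exp a) = S.jost (Real.exp a) ∧
      T.reflect.jost (Real.exp (-a)) = S.reflect.jost (Real.exp (-a)) ∧ T.jost 0 = S.jost 0 ∧
      ∀ x ∈ s, (T.slope (Real.exp a)).eval x = -(-((S.slope (Real.exp a)).eval x /
          (derivative (S.jost (Real.exp a))).eval x) + ε x) *
            (derivative (S.jost (Real.exp a))).eval x ∧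
        (T.reflect.slope (Real.exp (-a))).eval x = -(-((S.reflect.slope (Real.exp (-a))).eval x /
          (derivative (S.reflect.jost (Real.exp (-a)))).eval x) + -(Real.exp a ^ 2 * ε x)) *
            (derivative (S.reflect.jost (Real.exp (-a)))).eval x := by
  obtain ⟨h1, h2⟩ := (S.isStieltjesPair (Real.exp a)).perturb hs hε
  obtain ⟨h1', h2'⟩ := (S.reflect.isStieltjesPair (Real.exp (-a))).perturb
    (ε := fun x => -(Real.exp a ^ 2 * ε x)) hs' hε'
  have hE : C (Real.exp a) * C (Real.exp (-a)) = (1 : ℝ[X]) := by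
    rw [← C_mul, ← Real.exp_add]; simp
  obtain ⟨T, t1, t2, t3, t4, t5⟩ := S.exists_slope_eq a h1 h1' (by
    -- The factor `e^{2a}` in the mass taken from the left balances the weights `e^{-a}` and `e^a`
    -- of the two slopes in the Wronskian.
    have hsum : C (Real.exp (-a)) * S.jost (Real.exp a) * ∑ x ∈ s, C (-(Real.exp a ^ 2 * ε x)) *
          (S.reflect.jost (Real.exp (-a)) /ₘ (X - C x)) +
        C (Real.exp a) * (∑ x ∈ s, C (ε x) * (S.jost (Real.exp a) /ₘ (X - C x))) *
          S.reflect.jost (Real.exp (-a)) = 0 := by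
      rw [Finset.mul_sum, Finset.mul_sum, Finset.sum_mul, ← Finset.sum_add_distrib]
      refine Finset.sum_eq_zero fun x hx => ?_
      have f1 := mul_divByMonic_eq_iff_isRoot.2 (hs x hx)
      have f2 := mul_divByMonic_eq_iff_isRoot.2 (hs' x hx)
      simp only [C_neg, C_mul, C_pow]
      generalize S.jost (Real.exp a) /ₘ (X - C x) = R at *
      generalize S.reflect.jost (Real.exp (-a)) /ₘ (X - C x) = R' at *
      rw [← f1, ← f2]
      linear_combination (-(C (Real.exp a) * C (ε x) * (X - C x) * R * R')) * hE
    linear_combination -hsum)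
  refine ⟨T, t1, t3, t5, fun x hx => ⟨?_, ?_⟩⟩
  · rw [t2, h2 x hx]
  · rw [t4, h2' x hx]

namespace Pair.IsInteriorData

/-- The norming constants of the eigenvalues whose eigenfunctions vanish at `a` are arbitrary. -/
theorem exists_norming_eq (h : S.IsInteriorData a lam phi) {c : Fin N → ℝ}
    (hc : ∀ j, phi j = 0 → 0 < c j) :
    ∃ T : Pair, T.IsInteriorData a lam phi ∧ ∀ j, phi j = 0 → T.norming (lam j) = c j := by
  classical
  have hSP := S.isStieltjesPair (Real.exp a)
  have hSP' := S.reflect.isStieltjesPair (Real.exp (-a))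
  set s : Finset ℝ := (Finset.univ.filter fun j => phi j = 0).image lam with hs
  have hmem : ∀ x, x ∈ s ↔ ∃ j, phi j = 0 ∧ lam j = x := fun x => by simp [hs]
  have hs1 : ∀ x ∈ s, (S.jost (Real.exp a)).eval x = 0 := by
    intro x hx
    obtain ⟨j, hj, rfl⟩ := (hmem x).1 hx
    exact (h.phi_eq_zero_iff j).1 hj
  have hs2 : ∀ x ∈ s, (S.reflect.jost (Real.exp (-a))).eval x = 0 := by
    intro x hx
    obtain ⟨j, hj, rfl⟩ := (hmem x).1 hx
    exact (h.phi_eq_zero_iff_reflect j).1 hj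
  -- `Function.extend lam c 0` reads `c j` at the point `λ_j`. The last condition scales the ratio
  -- of the right mass to the left one by the wanted quotient of norming constants; points off `s`
  -- receive a dummy value.
  have hex : ∀ x, ∃ ε : ℝ, x ∈ s →
      0 < -((S.slope (Real.exp a)).eval x / (derivative (S.jost (Real.exp a))).eval x) + ε ∧
      0 < -((S.reflect.slope (Real.exp (-a))).eval x /
        (derivative (S.reflect.jost (Real.exp (-a)))).eval x) + -(Real.exp a ^ 2 * ε) ∧
      Function.extend lam c 0 x * ((-((S.reflect.slope (Real.exp (-a))).eval x /
        (derivative (S.reflect.jost (Real.exp (-a)))).eval x) + -(Real.exp a ^ 2 * ε)) *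
        -((S.slope (Real.exp a)).eval x / (derivative (S.jost (Real.exp a))).eval x)) =
      S.norming x * (-((S.reflect.slope (Real.exp (-a))).eval x /
        (derivative (S.reflect.jost (Real.exp (-a)))).eval x) *
        (-((S.slope (Real.exp a)).eval x / (derivative (S.jost (Real.exp a))).eval x) + ε)) := by
    intro x
    by_cases hx : x ∈ s
    · obtain ⟨j, hj, hjx⟩ := (hmem x).1 hx
      have hcx : 0 < Function.extend lam c 0 x := by
        rw [← hjx, h.1.injective.extend_apply]; exact hc j hj
      obtain ⟨ε, hε⟩ := exists_mass_transfer (hjx ▸ h.norming_pos j) hcx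
        (pow_pos (Real.exp_pos a) 2) (hSP.mass_pos (hs1 x hx)) (hSP'.mass_pos (hs2 x hx))
      exact ⟨ε, fun _ => hε⟩
    · exact ⟨0, fun h => absurd h hx⟩
  choose ε hε using hex
  obtain ⟨T, t1, t3, t5, t2⟩ := S.exists_transfer a hs1 hs2 (fun x hx => (hε x hx).1)
    fun x hx => (hε x hx).2.1
  have hev : ∀ j, (T.jost 0).eval (lam j) = 0 := fun j => by rw [t5]; exact h.eval_jost_lam j
  -- Where `φ_j ≠ 0` the norming constant depends only on `W` and the two values at `a`, which `T`
  -- shares with `S`. Where `φ_j = 0` the normalized value is zero whatever the norming constant.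
  have hnorm : ∀ j, phi j ≠ 0 → T.norming (lam j) = S.norming (lam j) := fun j hj => by
    have h1 := norming_mul_reflect_jost (hev j) a
    rw [t1, t3, t5, ← norming_mul_reflect_jost (h.eval_jost_lam j) a] at h1
    refine mul_right_cancel₀ (mul_ne_zero (Real.exp_ne_zero a) fun h0 => ?_) h1
    exact hj ((h.phi_eq_zero_iff_reflect j).2 h0)
  refine ⟨T, ⟨h.1, fun z => ?_, fun j => ?_⟩, fun j hj => ?_⟩
  · rw [T.isEigenvalue_iff, t5, ← S.isEigenvalue_iff, h.2.1]
  · by_cases hj : phi j = 0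
    · rw [hj, phiPlus_real, t1, (h.phi_eq_zero_iff j).1 hj]
      simp
    · rw [hnorm j hj, phiPlus_real, t1, ← phiPlus_real]
      exact h.2.2 j
  · have hx : lam j ∈ s := (hmem _).2 ⟨j, hj, rfl⟩
    have n1 := norming_mul_reflect_slope (hev j) (by rw [t1]; exact hs1 _ hx)
    have n2 := norming_mul_reflect_slope (h.eval_jost_lam j) (hs1 _ hx)
    obtain ⟨e1, e2, e3⟩ := hε _ hx
    rw [h.1.injective.extend_apply] at e3
    rw [(t2 _ hx).1, (t2 _ hx).2, t5] at n1
    have d1 := hSP.derivative_ne_zero (hs1 _ hx)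
    have d2 := hSP'.derivative_ne_zero (hs2 _ hx)
    have q1 : (S.slope (Real.exp a)).eval (lam j) = -(-((S.slope (Real.exp a)).eval (lam j) /
        (derivative (S.jost (Real.exp a))).eval (lam j))) *
        (derivative (S.jost (Real.exp a))).eval (lam j) := by
      field_simp
    have q2 : (S.reflect.slope (Real.exp (-a))).eval (lam j) =
        -(-((S.reflect.slope (Real.exp (-a))).eval (lam j) /
        (derivative (S.reflect.jost (Real.exp (-a)))).eval (lam j))) *
        (derivative (S.reflect.jost (Real.exp (-a)))).eval (lam j) := by
      field_simp
    rw [q1, q2] at n2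
    have p1 := hSP.mass_pos (hs1 _ hx)
    generalize -((S.slope (Real.exp a)).eval (lam j) /
      (derivative (S.jost (Real.exp a))).eval (lam j)) = ρ at *
    generalize -((S.reflect.slope (Real.exp (-a))).eval (lam j) /
      (derivative (S.reflect.jost (Real.exp (-a)))).eval (lam j)) = ρ' at *
    generalize (derivative (S.reflect.jost (Real.exp (-a)))).eval (lam j) = d' at *
    generalize (derivative (S.jost (Real.exp a))).eval (lam j) = d at *
    refine mul_right_cancel₀ (mul_ne_zero (mul_ne_zero e2.ne' p1.ne') d2) ?_
    linear_combination (-ρ) * n1 + (ρ + ε (lam j)) * n2 - d' * e3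

end Pair.IsInteriorData

end InteriorData

/-! ### The family of spectral data -/

theorem mem_range_extendByZero {ι : Type*} {Z : Set ι} (w : ι → ℝ) :
    w ∈ LinearMap.range (Function.ExtendByZero.linearMap ℝ (Subtype.val : Z → ι)) ↔
      ∀ j ∉ Z, w j = 0 := by
  constructor
  · rintro ⟨u, rfl⟩ j hj
    refine Function.extend_apply' _ _ _ ?_
    rintro ⟨k, rfl⟩
    exact hj k.2
  · intro h
    refine ⟨fun j => w j, funext fun j => ?_⟩
    by_cases hj : j ∈ Z
    · exact Subtype.val_injective.extend_apply (fun j : Z => w j) 0 (⟨j, hj⟩ : Z)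
    · rw [h j hj]
      exact Function.extend_apply' (f := (Subtype.val : Z → ι)) (fun j => w j) 0 j
        fun ⟨k, hk⟩ => hj (hk ▸ k.2)

/-- The set is a relatively open part of an affine subspace. Translation by `-p`, restricted to the
open set where the free coordinates are positive, is a chart, and the model subspace is spanned by
the free coordinates. -/
theorem isSubmanifold_of_pinned {N : ℕ} (lam d : Fin N → ℝ) (Z : Finset (Fin N)) :
    IsSubmanifold Z.card {p : (Fin N → ℝ) × (Fin N → ℝ) |
      p.1 = lam ∧ ∀ j, (j ∈ Z → 0 < p.2 j) ∧ (j ∉ Z → p.2 j = d j)} := by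
  rintro p ⟨hp1, hp2⟩
  set U : Set ((Fin N → ℝ) × (Fin N → ℝ)) := {q | ∀ j ∈ Z, 0 < q.2 j} with hU
  have hUo : IsOpen U := by
    have : U = ⋂ j ∈ Z, {q | 0 < q.2 j} := by ext q; simp [hU]
    rw [this]
    exact isOpen_biInter_finset fun j _ => isOpen_lt continuous_const (by fun_prop)
  set f : (↥(Z : Set (Fin N)) → ℝ) →ₗ[ℝ] (Fin N → ℝ) × (Fin N → ℝ) :=
    (LinearMap.inr ℝ (Fin N → ℝ) (Fin N → ℝ)).comp
      (Function.ExtendByZero.linearMap ℝ (Subtype.val : ↥(Z : Set (Fin N)) → Fin N)) with hf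
  have hfinj : Function.Injective f := by
    intro u w huw
    have h1 := congrArg Prod.snd huw
    funext j
    have h2 := congrFun h1 j
    simpa [hf, Function.ExtendByZero.linearMap, Subtype.val_injective.extend_apply] using h2
  have hmem : ∀ q, q ∈ LinearMap.range f ↔ q.1 = 0 ∧ ∀ j, j ∉ Z → q.2 j = 0 := by
    rintro ⟨u, w⟩
    have h1 := mem_range_extendByZero (Z := (Z : Set (Fin N))) w
    simp only [Finset.mem_coe] at h1
    rw [← h1]
    constructor
    · rintro ⟨t, ht⟩
      exact ⟨(congrArg Prod.fst ht).symm, t, congrArg Prod.snd ht⟩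
    · rintro ⟨h2, t, ht⟩
      exact ⟨t, Prod.ext h2.symm ht⟩
  refine ⟨(Homeomorph.addRight (-p)).toOpenPartialHomeomorph.restrOpen U hUo, LinearMap.range f,
    ?_, ?_, ?_, ?_, ?_⟩
  · simpa [hU] using fun j hj => (hp2 j).1 hj
  · exact (contDiff_id.add contDiff_const).contDiffOn
  · exact (contDiff_id.add contDiff_const).contDiffOn
  · rw [LinearMap.finrank_range_of_inj hfinj]
    simp
  · intro x hx
    have hxU : x ∈ U := by simpa using hx
    have hcoe : (Homeomorph.addRight (-p)).toOpenPartialHomeomorph.restrOpen U hUo x = x + -p := rfl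
    rw [hcoe, hmem]
    constructor
    · rintro ⟨h1, h2⟩
      refine ⟨by simp [h1, hp1], fun j hj => ?_⟩
      simp [(h2 j).2 hj, (hp2 j).2 hj]
    · rintro ⟨h1, h2⟩
      refine ⟨?_, fun j => ⟨hxU j, fun hj => ?_⟩⟩
      · rw [← hp1]
        have : x.1 + -p.1 = 0 := h1
        exact eq_of_sub_eq_zero (by rw [sub_eq_add_neg]; exact this)
      · rw [← (hp2 j).2 hj]
        have : x.2 j + -p.2 j = 0 := h2 j hj
        linarith

theorem convex_pinned {N : ℕ} (lam d : Fin N → ℝ) (Z : Finset (Fin N)) :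
    Convex ℝ {p : (Fin N → ℝ) × (Fin N → ℝ) |
      p.1 = lam ∧ ∀ j, (j ∈ Z → 0 < p.2 j) ∧ (j ∉ Z → p.2 j = d j)} := by
  rintro p ⟨hp1, hp2⟩ q ⟨hq1, hq2⟩ s t hs ht hst
  refine ⟨?_, fun j => ⟨fun hj => ?_, fun hj => ?_⟩⟩
  · rw [Prod.fst_add, Prod.smul_fst, Prod.smul_fst, hp1, hq1, ← add_smul, hst, one_smul]
  · have h1 := (hp2 j).1 hj
    have h2 := (hq2 j).1 hj
    have : 0 < s * p.2 j + t * q.2 j := by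
      rcases hs.eq_or_lt with rfl | hs
      · rw [zero_add] at hst
        rw [hst]; linarith
      · exact add_pos_of_pos_of_nonneg (mul_pos hs h1) (mul_nonneg ht h2.le)
    simpa using this
  · have h1 := (hp2 j).2 hj
    have h2 := (hq2 j).2 hj
    have : s * p.2 j + t * q.2 j = d j := by rw [h1, h2, ← add_mul, hst, one_mul]
    simpa using this

/-- As soon as one value vanishes, infinitely many pairs have the same interior data. -/
theorem infinite_setOf_isInteriorData {S : Pair} {a : ℝ} {N : ℕ} {lam phi : Fin N → ℝ}
    (h : S.IsInteriorData a lam phi) {j : Fin N} (hj : phi j = 0) :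
    {S : Pair | S.IsInteriorData a lam phi}.Infinite := by
  refine Set.Infinite.of_image (fun S => S.norming (lam j)) ?_
  refine (Set.Ioi_infinite (0 : ℝ)).mono fun c hc => ?_
  obtain ⟨T, hT, hTc⟩ := h.exists_norming_eq (c := fun _ => c) fun _ _ => hc
  exact ⟨T, hT, hTc j hj⟩

end Multipeakon

theorem theorem3p14 (a : ℝ) (N k : ℕ) (lam phi : Fin N → ℝ)
    (hdata : ∃ S : Multipeakon.Pair, S.IsInteriorData a lam phi)
    (halpha : Multipeakon.alphaCoeff phi = 0)
    (hbeta : Multipeakon.betaCoeff lam phi = 0)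
    (hk : (Finset.univ.filter fun i => phi i = 0).card = k) :
    -- infinitely many pairs have the given interior data as soon as some value vanishes
    (0 < k → {S : Multipeakon.Pair | S.IsInteriorData a lam phi}.Infinite) ∧
    -- the family of spectral data is a connected manifold of dimension `k`
    IsConnected (Multipeakon.spectralFamily a lam phi) ∧
    Multipeakon.IsSubmanifold k (Multipeakon.spectralFamily a lam phi) ∧
    -- its explicit description, in terms of two finite sets determined by the interior data
    ∃ B C : Finset ℝ,
      (∀ μ : ℝ, μ ∈ B ↔ μ ≠ 0 ∧ Multipeakon.greenSum lam phi μ = 0 ∧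
        ∃ i j : Fin N, (i : ℕ) + 1 = j ∧ lam i < μ ∧ μ < lam j ∧ phi i * phi j < 0) ∧
      (∀ μ : ℝ, μ ∈ C ↔ μ ≠ 0 ∧ Multipeakon.greenSum lam phi μ = 0 ∧
        ∃ i j : Fin N, (i : ℕ) + 1 = j ∧ lam i < μ ∧ μ < lam j ∧ 0 < phi i * phi j) ∧
      -- `B`, `C` are the zeros of `φ₊(·, a)` alone and of `φ₋(·, a)` alone
      (∀ S : Multipeakon.Pair, S.IsInteriorData a lam phi → ∀ μ : ℝ,
        (μ ∈ B ↔ S.phiPlus μ a = 0 ∧ S.phiMinus μ a ≠ 0) ∧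
        (μ ∈ C ↔ S.phiMinus μ a = 0 ∧ S.phiPlus μ a ≠ 0)) ∧
      Multipeakon.spectralFamily a lam phi =
        {p | p.1 = lam ∧ ∀ j, (phi j = 0 → 0 < p.2 j) ∧
          (phi j ≠ 0 → p.2 j = Real.exp (-a) *
            (∏ i ∈ Finset.univ.erase j, (1 - lam j / lam i)) *
            (∏ μ ∈ B, (1 - lam j / μ)) * (∏ ν ∈ C, (1 - lam j / ν))⁻¹)} := by
  classical
  obtain ⟨S, hS⟩ := hdata
  set Z : Finset (Fin N) := Finset.univ.filter fun i => phi i = 0 with hZ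
  have hmemZ : ∀ j, j ∈ Z ↔ phi j = 0 := fun j => by simp [hZ]
  set s := (S.jost (Real.exp a)).roots.toFinset with hs
  set t := (S.reflect.jost (Real.exp (-a))).roots.toFinset with ht
  have hmems : ∀ x, x ∈ s ↔ (S.jost (Real.exp a)).eval x = 0 := fun x =>
    (S.isStieltjesPair _).mem_roots_toFinset
  have hmemt : ∀ x, x ∈ t ↔ (S.reflect.jost (Real.exp (-a))).eval x = 0 := fun x =>
    (S.reflect.isStieltjesPair _).mem_roots_toFinset
  -- The sets are built from one particular `S`, but this description involves only the interior
  -- data, so they serve every pair with the same data.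
  have hB : ∀ μ : ℝ, μ ∈ s \ t ↔ μ ≠ 0 ∧ Multipeakon.greenSum lam phi μ = 0 ∧
      ∃ i j : Fin N, (i : ℕ) + 1 = j ∧ lam i < μ ∧ μ < lam j ∧ phi i * phi j < 0 := fun μ => by
    rw [hS.zero_phiPlus_iff halpha hbeta, Finset.mem_sdiff, hmems, hmemt]
  have hC : ∀ μ : ℝ, μ ∈ t \ s ↔ μ ≠ 0 ∧ Multipeakon.greenSum lam phi μ = 0 ∧
      ∃ i j : Fin N, (i : ℕ) + 1 = j ∧ lam i < μ ∧ μ < lam j ∧ 0 < phi i * phi j := fun μ => by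
    rw [hS.zero_phiMinus_iff halpha hbeta, Finset.mem_sdiff, hmems, hmemt]
  have hnorm : ∀ T : Multipeakon.Pair, T.IsInteriorData a lam phi → ∀ j, phi j ≠ 0 →
      T.norming (lam j) = Real.exp (-a) *
        (∏ i ∈ Finset.univ.erase j, (1 - lam j / lam i)) *
        (∏ μ ∈ s \ t, (1 - lam j / μ)) * (∏ ν ∈ t \ s, (1 - lam j / ν))⁻¹ := fun T hT j hj =>
    hT.norming_eq_prod (fun μ => (hB μ).trans (hT.zero_phiPlus_iff halpha hbeta μ))
      (fun μ => (hC μ).trans (hT.zero_phiMinus_iff halpha hbeta μ)) hj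
  have hfam : Multipeakon.spectralFamily a lam phi =
      {p | p.1 = lam ∧ ∀ j, (phi j = 0 → 0 < p.2 j) ∧
        (phi j ≠ 0 → p.2 j = Real.exp (-a) *
          (∏ i ∈ Finset.univ.erase j, (1 - lam j / lam i)) *
          (∏ μ ∈ s \ t, (1 - lam j / μ)) * (∏ ν ∈ t \ s, (1 - lam j / ν))⁻¹)} := by
    ext p
    constructor
    · rintro ⟨T, hT, h1, h2⟩
      exact ⟨h1, fun j => ⟨fun _ => by rw [h2]; exact hT.norming_pos j,
        fun hj => by rw [h2]; exact hnorm T hT j hj⟩⟩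
    · rintro ⟨h1, h2⟩
      -- Only the free constants have to be prescribed; the others are forced by the product formula
      -- for `T`.
      obtain ⟨T, hT, hTc⟩ := hS.exists_norming_eq (c := p.2) fun j hj => (h2 j).1 hj
      refine ⟨T, hT, h1, fun j => ?_⟩
      by_cases hj : phi j = 0
      · exact (hTc j hj).symm
      · rw [(h2 j).2 hj, hnorm T hT j hj]
  have hfamZ : Multipeakon.spectralFamily a lam phi =
      {p | p.1 = lam ∧ ∀ j, (j ∈ Z → 0 < p.2 j) ∧ (j ∉ Z → p.2 j = Real.exp (-a) *
          (∏ i ∈ Finset.univ.erase j, (1 - lam j / lam i)) *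
          (∏ μ ∈ s \ t, (1 - lam j / μ)) * (∏ ν ∈ t \ s, (1 - lam j / ν))⁻¹)} := by
    rw [hfam]
    simp only [hmemZ, ne_eq]
  refine ⟨fun hkpos => ?_, ⟨⟨(lam, fun j => S.norming (lam j)), S, hS, rfl, fun _ => rfl⟩, ?_⟩, ?_,
    s \ t, t \ s, hB, hC, fun T hT μ => ⟨?_, ?_⟩, hfam⟩
  · rw [← hk, Finset.card_pos] at hkpos
    obtain ⟨j, hj⟩ := hkpos
    exact Multipeakon.infinite_setOf_isInteriorData hS ((hmemZ j).1 hj)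
  · rw [hfamZ]
    exact (Multipeakon.convex_pinned lam _ Z).isPreconnected
  · rw [hfamZ, ← hk]
    exact Multipeakon.isSubmanifold_of_pinned lam _ Z
  · rw [hB, hT.zero_phiPlus_iff halpha hbeta, T.phiPlus_eq_zero_iff, ne_eq, ne_eq,
      T.phiMinus_eq_zero_iff]
  · rw [hC, hT.zero_phiMinus_iff halpha hbeta, T.phiMinus_eq_zero_iff, ne_eq, ne_eq,
      T.phiPlus_eq_zero_iff]
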